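/- Let $q\in\mathbb{C}$ be a root of unity with $q^4\neq 1$, and let $D$ be the multiplicative order of $q^2$. Let $S=\mathscr{S}_q(\Sigma_{1,1})$ be the Kauffman bracket skein algebra of the one-punctured torus, given by its Bullock–Przytycki presentation: it is the unital $\mathbb{C}$-algebra generated by $\alpha_0,\alpha_1,\alpha_\infty$ (the simple closed curves of slopes $0,1,\infty$) with relations $$q\alpha_0\alpha_\infty-q^{-1}\alpha_\infty\alpha_0=(q^2-q^{-2})\alpha_1,\quad q\alpha_1\alpha_0-q^{-1}\alpha_0\alpha_1=(q^2-q^{-2})\alpha_\infty,\quad q\alpha_\infty\alpha_1-q^{-1}\alpha_1\alpha_\infty=(q^2-q^{-2})\alpha_0.$$ Let $Z$ be the center of $S$ and let $\mathcal{V}=\operatorname{MaxSpec} Z$ be the classical shadow variety. A point $z\in\mathcal V$ is identified with the corresponding algebra homomorphism $z:Z\to\mathbb{C}$, and it is called singular if the local ring of $Z$ at the maximal ideal $\ker z$ is not regular. The element $A_0=T_D(\alpha_0)$ lies in $Z$, where $T_D$ is the Chebyshev polynomial with $T_D(x+x^{-1})=x^D+x^{-D}$; write $z_0=z(A_0)$.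 A representation $\rho:S\to\operatorname{End}(V)$ on a complex vector space $V$ is called type-$0$ if there are a basis $\{v_i\}_{i\in\mathbb{Z}/D}$ of $V$, numbers $\sigma\in\mathbb{C}\setminus\{0\}$ and $w\in\mathbb{C}$ such that $\hat\lambda_i:=q^{2i}\sigma-q^{-2i}\sigma^{-1}\neq0$ for all $i$, and numbers $s_i,t_i\in\mathbb{C}$ ($i\in\mathbb{Z}/D$) with $$s_it_i=\frac{w+q^{4i+2}\sigma^2+q^{-4i-2}\sigma^{-2}}{\hat\lambda_i\hat\lambda_{i+1}},$$ such that for all $i$ $$\rho(\alpha_0)v_i=(q^{2i}\sigma+q^{-2i}\sigma^{-1})v_i,\quad \rho(\alpha_1)v_i=q^{2i+1}\sigma s_iv_{i+1}+q^{-2i+1}\sigma^{-1}t_{i-1}v_{i-1},\quad \rho(\alpha_\infty)v_i=s_iv_{i+1}+t_{i-1}v_{i-1}.$$ A point $z\in\mathcal{V}$ is the classical shadow of $\rho$ if $\rho(c)=z(c)\,\mathrm{id}_V$ for all $c\in Z$. The representation $\rho$ is reducible if it has an invariant subspace other than $0$ and $V$. **Lemma.** Let $\rho$ be a type-$0$ representation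 of $S$ with classical shadow $z\in\mathcal{V}$, and suppose $z_0\neq\pm2$. Then $\rho$ is reducible if and only if $z$ is a singular point of $\mathcal{V}$. -/

import Mathlib

noncomputable section

namespace PuncturedTorus

/-- The three slopes `0`, `1`, `∞` of the generating simple closed curves. -/
inductive Slope : Type
  | zero : Slope
  | one : Slope
  | infty : Slope

/-- The Bullock-Przytycki relations between the curves of slopes `0`, `1`, `∞`
on the one-punctured torus. -/
inductive SkeinRel (q : ℂ) : FreeAlgebra ℂ Slope → FreeAlgebra ℂ Slope → Prop
  | rel_one : SkeinRel q
      (q • (FreeAlgebra.ι ℂ Slope.zero * FreeAlgebra.ι ℂ Slope.infty)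
        - q⁻¹ • (FreeAlgebra.ι ℂ Slope.infty * FreeAlgebra.ι ℂ Slope.zero))
      ((q ^ 2 - (q⁻¹) ^ 2) • FreeAlgebra.ι ℂ Slope.one)
  | rel_infty : SkeinRel q
      (q • (FreeAlgebra.ι ℂ Slope.one * FreeAlgebra.ι ℂ Slope.zero)
        - q⁻¹ • (FreeAlgebra.ι ℂ Slope.zero * FreeAlgebra.ι ℂ Slope.one))
      ((q ^ 2 - (q⁻¹) ^ 2) • FreeAlgebra.ι ℂ Slope.infty)
  | rel_zero : SkeinRel q
      (q • (FreeAlgebra.ι ℂ Slope.infty * FreeAlgebra.ι ℂ Slope.one)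
        - q⁻¹ • (FreeAlgebra.ι ℂ Slope.one * FreeAlgebra.ι ℂ Slope.infty))
      ((q ^ 2 - (q⁻¹) ^ 2) • FreeAlgebra.ι ℂ Slope.zero)

/-- The Kauffman bracket skein algebra of the one-punctured torus at parameter `q`, in its
Bullock-Przytycki presentation. -/
def SkeinAlgebra (q : ℂ) : Type := RingQuot (SkeinRel q)

instance (q : ℂ) : Ring (SkeinAlgebra q) := inferInstanceAs (Ring (RingQuot (SkeinRel q)))

instance (q : ℂ) : Algebra ℂ (SkeinAlgebra q) :=
  inferInstanceAs (Algebra ℂ (RingQuot (SkeinRel q)))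

/-- The quotient map from the free algebra on the three curves. -/
def toSkein (q : ℂ) : FreeAlgebra ℂ Slope →ₐ[ℂ] SkeinAlgebra q :=
  RingQuot.mkAlgHom ℂ (SkeinRel q)

/-- The simple closed curve of slope `m`, as an element of the skein algebra. -/
def curve (q : ℂ) (m : Slope) : SkeinAlgebra q :=
  toSkein q (FreeAlgebra.ι ℂ m)

/-- The PI degree `D` of the skein algebra of the one-punctured torus, namely the order of `q ^ 2`.
It is also written `n`. -/
def piDegree (q : ℂ) : ℕ := orderOf (q ^ 2)

/-- The center `Z` of the skein algebra. -/
def Center (q : ℂ) : Type := Subalgebra.center ℂ (SkeinAlgebra q)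

instance (q : ℂ) : CommRing (Center q) :=
  inferInstanceAs (CommRing (Subalgebra.center ℂ (SkeinAlgebra q)))

instance (q : ℂ) : Algebra ℂ (Center q) :=
  inferInstanceAs (Algebra ℂ (Subalgebra.center ℂ (SkeinAlgebra q)))

/-- The inclusion of the center in the skein algebra. -/
def Center.incl (q : ℂ) : Center q →ₐ[ℂ] SkeinAlgebra q :=
  (Subalgebra.center ℂ (SkeinAlgebra q)).val

/-! ### Centrality of the Chebyshev elements `T_D(α)` -/

lemma toSkein_surjective (q : ℂ) : Function.Surjective (toSkein q) :=
  RingQuot.mkAlgHom_surjective ℂ (SkeinRel q)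

lemma toSkein_rel {q : ℂ} {x y : FreeAlgebra ℂ Slope} (h : SkeinRel q x y) :
    toSkein q x = toSkein q y :=
  RingQuot.mkAlgHom_rel ℂ h

lemma curve_rel_one (q : ℂ) :
    q • (curve q .zero * curve q .infty) - q⁻¹ • (curve q .infty * curve q .zero)
      = (q ^ 2 - (q⁻¹) ^ 2) • curve q .one := by
  simpa [curve] using toSkein_rel (SkeinRel.rel_one (q := q))

lemma curve_rel_infty (q : ℂ) :
    q • (curve q .one * curve q .zero) - q⁻¹ • (curve q .zero * curve q .one)
      = (q ^ 2 - (q⁻¹) ^ 2) • curve q .infty := by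
  simpa [curve] using toSkein_rel (SkeinRel.rel_infty (q := q))

lemma curve_rel_zero (q : ℂ) :
    q • (curve q .infty * curve q .one) - q⁻¹ • (curve q .one * curve q .infty)
      = (q ^ 2 - (q⁻¹) ^ 2) • curve q .zero := by
  simpa [curve] using toSkein_rel (SkeinRel.rel_zero (q := q))

lemma mem_center_of_commute_curves (q : ℂ) (a : SkeinAlgebra q)
    (h : ∀ m, curve q m * a = a * curve q m) : a ∈ Subalgebra.center ℂ (SkeinAlgebra q) := by
  rw [Subalgebra.mem_center_iff]
  intro b
  obtain ⟨f, rfl⟩ := toSkein_surjective q b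
  induction f using FreeAlgebra.induction with
  | grade0 r => rw [AlgHom.commutes]; exact Algebra.commutes r a
  | grade1 m => exact h m
  | mul x y hx hy => rw [map_mul, mul_assoc, hy, ← mul_assoc, hx, mul_assoc]
  | add x y hx hy => rw [map_add, add_mul, mul_add, hx, hy]

open Polynomial in
lemma mul_cheb_step {S : Type*} [Ring S] [Algebra ℂ S] (q : ℂ) (hq : q ≠ 0) (x b d : S)
    (h1 : q • (x * b) - q⁻¹ • (b * x) = (q ^ 2 - (q⁻¹) ^ 2) • d)
    (h2 : q • (d * x) - q⁻¹ • (x * d) = (q ^ 2 - (q⁻¹) ^ 2) • b) (P Q : ℂ[X]) :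
    x * (b * aeval x P + d * aeval x Q)
      = b * aeval x (Polynomial.C ((q⁻¹) ^ 2) * X * P
          - Polynomial.C (q * (q ^ 2 - (q⁻¹) ^ 2)) * Q)
        + d * aeval x (Polynomial.C (q ^ 2) * X * Q
          + Polynomial.C (q⁻¹ * (q ^ 2 - (q⁻¹) ^ 2)) * P) := by
  have hb : x * b = (q⁻¹) ^ 2 • (b * x) + (q⁻¹ * (q ^ 2 - (q⁻¹) ^ 2)) • d := by
    rw [mul_smul, ← h1, smul_sub, smul_smul, smul_smul, inv_mul_cancel₀ hq, one_smul, ← pow_two]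
    abel
  have hd : x * d = q ^ 2 • (d * x) - (q * (q ^ 2 - (q⁻¹) ^ 2)) • b := by
    rw [mul_smul, ← h2, smul_sub, smul_smul, smul_smul, mul_inv_cancel₀ hq, one_smul, ← pow_two]
    abel
  have e : x * (b * aeval x P + d * aeval x Q)
      = (x * b) * aeval x P + (x * d) * aeval x Q := by noncomm_ring
  rw [e, hb, hd]
  generalize q⁻¹ * (q ^ 2 - (q⁻¹) ^ 2) = c₁
  generalize q * (q ^ 2 - (q⁻¹) ^ 2) = c₂
  simp only [mul_assoc, Polynomial.C_mul', map_sub, map_add, map_smul, map_mul, aeval_X,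
    add_mul, sub_mul, mul_add, mul_sub, smul_mul_assoc, mul_smul_comm]
  abel

open Polynomial in
lemma cheb_mul {S : Type*} [Ring S] [Algebra ℂ S] (q : ℂ) (hq : q ≠ 0) (x b d : S)
    (h1 : q • (x * b) - q⁻¹ • (b * x) = (q ^ 2 - (q⁻¹) ^ 2) • d)
    (h2 : q • (d * x) - q⁻¹ • (x * d) = (q ^ 2 - (q⁻¹) ^ 2) • b) (k : ℕ) :
    aeval x (Chebyshev.C ℂ k) * b
      = b * aeval x (Polynomial.C ((q⁻¹) ^ (2 * k)) * Chebyshev.C ℂ k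
          - Polynomial.C (q ^ (2 * k) - (q⁻¹) ^ (2 * k)) * Chebyshev.S ℂ ((k : ℤ) - 2))
        + d * aeval x (Polynomial.C ((q ^ (2 * k) - (q⁻¹) ^ (2 * k)) * q⁻¹)
          * Chebyshev.S ℂ ((k : ℤ) - 1)) := by
  induction k using Nat.twoStepInduction with
  | zero =>
    have h : aeval x (2 : ℂ[X]) = (2 : S) := map_ofNat _ 2
    simp [h]
    rw [two_mul, mul_two]
  | one =>
    have := mul_cheb_step q hq x b d h1 h2 1 0
    simp only [map_one, map_zero, mul_one, mul_zero, add_zero, sub_zero, zero_add] at this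
    simp only [Nat.cast_one, Chebyshev.C_one, aeval_X, mul_one]
    rw [this]
    rw [mul_comm (q⁻¹) (q ^ 2 - (q⁻¹) ^ 2)]
    norm_num
  | more k ih0 ih1 =>
    have hC : Chebyshev.C ℂ ((k + 2 : ℕ) : ℤ)
        = X * Chebyshev.C ℂ ((k + 1 : ℕ) : ℤ) - Chebyshev.C ℂ (k : ℤ) := by
      push_cast
      exact Chebyshev.C_add_two ℂ (k : ℤ)
    have e : aeval x (Chebyshev.C ℂ ((k + 2 : ℕ) : ℤ)) * b
        = x * (aeval x (Chebyshev.C ℂ ((k + 1 : ℕ) : ℤ)) * b)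
          - aeval x (Chebyshev.C ℂ (k : ℤ)) * b := by
      rw [hC]
      simp [sub_mul, mul_assoc]
    rw [e, ih1, mul_cheb_step q hq x b d h1 h2, ih0]
    have ee : (Polynomial.C q : ℂ[X]) * Polynomial.C q⁻¹ = 1 := by
      rw [← Polynomial.C_mul, mul_inv_cancel₀ hq, Polynomial.C_1]
    have s0 : Chebyshev.S ℂ ((k : ℤ) - 2)
        = X * Chebyshev.S ℂ ((k : ℤ) - 1) - Chebyshev.S ℂ (k : ℤ) := Chebyshev.S_sub_two ℂ _
    have s1 : Chebyshev.S ℂ ((k : ℤ) + 1)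
        = X * Chebyshev.S ℂ (k : ℤ) - Chebyshev.S ℂ ((k : ℤ) - 1) := Chebyshev.S_add_one ℂ _
    have c0 : Chebyshev.C ℂ (k : ℤ)
        = 2 * Chebyshev.S ℂ (k : ℤ) - X * Chebyshev.S ℂ ((k : ℤ) - 1) :=
      Chebyshev.C_eq_S_sub_X_mul_S ℂ _
    have c1 : Chebyshev.C ℂ ((k : ℤ) + 1)
        = X * Chebyshev.S ℂ (k : ℤ) - 2 * Chebyshev.S ℂ ((k : ℤ) - 1) := by
      have := Chebyshev.C_eq_S_sub_X_mul_S ℂ ((k : ℤ) + 1)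
      rw [show (k : ℤ) + 1 - 1 = k by ring, s1] at this
      rw [this]; ring
    have i1 : (((k + 1 : ℕ) : ℤ) - 2) = (k : ℤ) - 1 := by push_cast; ring
    have i2 : (((k + 1 : ℕ) : ℤ) - 1) = (k : ℤ) := by push_cast; ring
    have i3 : (((k + 2 : ℕ) : ℤ) - 2) = (k : ℤ) := by push_cast; ring
    have i4 : (((k + 2 : ℕ) : ℤ) - 1) = (k : ℤ) + 1 := by push_cast; ring
    rw [hC, i1, i2, i3, i4]
    push_cast
    rw [c1, c0, s1, s0]
    generalize Chebyshev.S ℂ ((k : ℤ) - 1) = u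
    generalize Chebyshev.S ℂ (k : ℤ) = v
    rw [add_sub_add_comm, ← mul_sub, ← mul_sub, ← map_sub, ← map_sub]
    congr 3
    · simp only [map_sub, map_mul, map_pow, mul_add, mul_one, pow_add]
      generalize (Polynomial.C q : ℂ[X]) = y at *
      generalize (Polynomial.C q⁻¹ : ℂ[X]) = y' at *
      linear_combination (y ^ (2 * k) * v * (- y ^ 4 + (y * y') ^ 2 + y * y' + 1)
        - y ^ (2 * k) * X * u * (y * y' + 1)
        + y' ^ (2 * k) * v * (- y' ^ 4 + (y * y') ^ 2 + y * y' + 1)) * ee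
    · simp only [map_sub, map_mul, map_pow, mul_add, mul_one, pow_add]
      generalize (Polynomial.C q : ℂ[X]) = y at *
      generalize (Polynomial.C q⁻¹ : ℂ[X]) = y' at *
      linear_combination ((y * y' + 1) * y' * u * (y ^ (2 * k) - y' ^ (2 * k))) * ee

lemma cheb_commute (q : ℂ) {x b d : SkeinAlgebra q}
    (h1 : q • (x * b) - q⁻¹ • (b * x) = (q ^ 2 - (q⁻¹) ^ 2) • d)
    (h2 : q • (d * x) - q⁻¹ • (x * d) = (q ^ 2 - (q⁻¹) ^ 2) • b) :
    b * Polynomial.aeval x (Polynomial.Chebyshev.C ℂ (piDegree q))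
        = Polynomial.aeval x (Polynomial.Chebyshev.C ℂ (piDegree q)) * b
      ∧ d * Polynomial.aeval x (Polynomial.Chebyshev.C ℂ (piDegree q))
        = Polynomial.aeval x (Polynomial.Chebyshev.C ℂ (piDegree q)) * d := by
  by_cases hq : q = 0
  · have h0 : piDegree q = 0 := by
      subst hq
      refine orderOf_eq_zero_iff'.2 fun n hn => ?_
      simp [hn.ne']
    have h : Polynomial.aeval x (2 : Polynomial ℂ) = (2 : SkeinAlgebra q) := map_ofNat _ 2
    simp [h0, h, two_mul, mul_two]
  · have hD : q ^ (2 * piDegree q) = 1 := by rw [pow_mul]; exact pow_orderOf_eq_one _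
    have hD' : (q⁻¹) ^ (2 * piDegree q) = 1 := by rw [inv_pow, hD, inv_one]
    constructor
    · have := cheb_mul q hq x b d h1 h2 (piDegree q)
      rw [hD, hD'] at this
      simpa using this.symm
    · have h1' : q⁻¹ • (x * d) - (q⁻¹)⁻¹ • (d * x) = ((q⁻¹) ^ 2 - ((q⁻¹)⁻¹) ^ 2) • b := by
        rw [inv_inv, ← neg_sub (q ^ 2), neg_smul, ← h2, neg_sub]
      have h2' : q⁻¹ • (b * x) - (q⁻¹)⁻¹ • (x * b) = ((q⁻¹) ^ 2 - ((q⁻¹)⁻¹) ^ 2) • d := by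
        rw [inv_inv, ← neg_sub (q ^ 2), neg_smul, ← h1, neg_sub]
      have := cheb_mul q⁻¹ (inv_ne_zero hq) x d b h1' h2' (piDegree q)
      rw [inv_inv, hD, hD'] at this
      simpa using this.symm

lemma cheb_mem_center (q : ℂ) (m : Slope) :
    Polynomial.aeval (curve q m) (Polynomial.Chebyshev.C ℂ (piDegree q)) ∈ Subalgebra.center ℂ (SkeinAlgebra q) := by
  have self : ∀ (x : SkeinAlgebra q) (P : Polynomial ℂ),
      x * Polynomial.aeval x P = Polynomial.aeval x P * x := fun x P => by
    have := congrArg (Polynomial.aeval x) (mul_comm Polynomial.X P)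
    simpa using this
  apply mem_center_of_commute_curves
  cases m with
  | zero =>
    have h := cheb_commute q (curve_rel_one q) (curve_rel_infty q)
    rintro (_ | _ | _)
    exacts [self _ _, h.2, h.1]
  | one =>
    have h := cheb_commute q (curve_rel_infty q) (curve_rel_zero q)
    rintro (_ | _ | _)
    exacts [h.1, self _ _, h.2]
  | infty =>
    have h := cheb_commute q (curve_rel_zero q) (curve_rel_one q)
    rintro (_ | _ | _)
    exacts [h.2, h.1, self _ _]

/-- The central element `A_m = T_D(α_m)`, where `T_D` is the Chebyshev polynomial normalized by
`T_D (t + t⁻¹) = t ^ D + t ^ (-D)`. -/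
def centralA (q : ℂ) (m : Slope) : Center q :=
  ⟨Polynomial.aeval (curve q m) (Polynomial.Chebyshev.C ℂ (piDegree q)), cheb_mem_center q m⟩

/-! ### Classical shadows and singular points -/

/-- The classical shadow variety, i.e. the maximal spectrum of the center. -/
abbrev ShadowVariety (q : ℂ) : Type := MaximalSpectrum (Center q)

/-- The point of the shadow variety given by an algebra homomorphism `Z → ℂ`: its kernel. -/
def shadowPoint {q : ℂ} (χ : Center q →ₐ[ℂ] ℂ) : ShadowVariety q :=
  ⟨RingHom.ker χ, RingHom.ker_isMaximal_of_surjective χ fun c =>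
    ⟨algebraMap ℂ (Center q) c, χ.commutes c⟩⟩

/-- A point of the maximal spectrum of a commutative ring is singular if the local ring there is
not regular. -/
def IsSingularPoint {R : Type*} [CommRing R] (x : MaximalSpectrum R) : Prop :=
  haveI := x.isMaximal.isPrime
  ¬ IsRegularLocalRing (Localization.AtPrime x.asIdeal)

/-- `χ` is the classical shadow of `ρ`: each central element `z` acts as the scalar `χ z`. -/
def IsClassicalShadow {q : ℂ} {V : Type*} [AddCommGroup V] [Module ℂ V]
    (ρ : SkeinAlgebra q →ₐ[ℂ] Module.End ℂ V) (χ : Center q →ₐ[ℂ] ℂ) : Prop :=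
  ∀ z : Center q, ρ (Center.incl q z) = χ z • LinearMap.id

/-- A representation is reducible if it has a proper nonzero invariant subspace. -/
def IsReducible {q : ℂ} {V : Type*} [AddCommGroup V] [Module ℂ V]
    (ρ : SkeinAlgebra q →ₐ[ℂ] Module.End ℂ V) : Prop :=
  ∃ U : Submodule ℂ V, U ≠ ⊥ ∧ U ≠ ⊤ ∧ ∀ a : SkeinAlgebra q, ∀ u ∈ U, ρ a u ∈ U

/-! ### Type-0 representations -/

/-- `λ_i = q ^ (2 i) σ + q ^ (-2 i) σ⁻¹`. When `D > 0` the index `i : ZMod D` stands for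
its representative in `0, …, D - 1`; the value does not depend on the representative. -/
def lam (q σ : ℂ) (i : ZMod (piDegree q)) : ℂ :=
  q ^ (2 * (i.val : ℤ)) * σ + q ^ (-2 * (i.val : ℤ)) * σ⁻¹

/-- `λ̂_i = q ^ (2 i) σ - q ^ (-2 i) σ⁻¹`. -/
def lamHat (q σ : ℂ) (i : ZMod (piDegree q)) : ℂ :=
  q ^ (2 * (i.val : ℤ)) * σ - q ^ (-2 * (i.val : ℤ)) * σ⁻¹

/-- `r_i(σ, w)`. -/
def rCoeff (q σ w : ℂ) (i : ZMod (piDegree q)) : ℂ :=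
  (w + q ^ (4 * (i.val : ℤ) + 2) * σ ^ 2 + q ^ (-4 * (i.val : ℤ) - 2) * (σ⁻¹) ^ 2)
    / (lamHat q σ i * lamHat q σ (i + 1))

/-- Type-0 representations: for some basis `v_i` indexed by `ℤ/D`, some `σ ≠ 0` that is general
(all `λ̂_i` are nonzero, i.e. their product is nonzero), some `w`, and some `s_i`, `t_i`
with `s_i t_i = r_i(σ, w)`, the generators act by the displayed formulas. -/
def IsTypeZero {q : ℂ} {V : Type*} [AddCommGroup V] [Module ℂ V]
    (ρ : SkeinAlgebra q →ₐ[ℂ] Module.End ℂ V) : Prop :=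
  ∃ (v : Module.Basis (ZMod (piDegree q)) ℂ V) (σ w : ℂ) (s t : ZMod (piDegree q) → ℂ),
    σ ≠ 0 ∧ (∀ i, lamHat q σ i ≠ 0) ∧ (∀ i, s i * t i = rCoeff q σ w i) ∧
    (∀ i, ρ (curve q .zero) (v i) = lam q σ i • v i) ∧
    (∀ i, ρ (curve q .one) (v i)
      = (q ^ (2 * (i.val : ℤ) + 1) * σ * s i) • v (i + 1)
        + (q ^ (-2 * (i.val : ℤ) + 1) * σ⁻¹ * t (i - 1)) • v (i - 1)) ∧
    (∀ i, ρ (curve q .infty) (v i) = s i • v (i + 1) + t (i - 1) • v (i - 1))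

end PuncturedTorus

end

/-!
Write `D` for the order of `q ^ 2`. The idea is to compute the center explicitly as a hypersurface in
four variables and to pull its equation back to the parameters of type-0 representations, where it
becomes `a b = ∏ r_i` with `a = ∏ s_i`, `b = ∏ t_i`.

*The center.* The quantum trace `quantumTrace` embeds the skein algebra in a quantum torus, realized
by operators on functions on `ℤ³`. The ordered monomials span the skein algebra; comparing leading
terms with respect to total degree shows that the trace is injective (`quantumTrace_injective`), that
the center is generated by the three elements `T_D(α)` and the loop `η` around the puncture
(`centralMap_surjective`), and that these satisfy a single relation
`η ^ D - κ A₀ A₁ A_∞ - g = 0` with `κ ≠ 0` and `g` of smaller weight (`exists_center_equation`). In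
particular `g` has degree at most `2` in `A₀, A₁, A_∞`. By the Jacobian criterion
(`isRegularLocalRing_hypersurface_iff`), a point is singular if and only if all partial derivatives
of this relation vanish there.

*Shadows.* On a type-0 representation `A₀` acts by `σ ^ D + σ ^ (-D)` and `η` by `w`, while `α₁` and
`α_∞` act by periodic Jacobi operators, so that `A₁` and `A_∞` act by
`μ a + μ⁻¹ b + p` and `a + b + p`, where `μ = ± σ ^ D` and `p` depends on `σ` and `w` only
(`shadow_eq_shadowCoords`). Substituting these into the relation gives a quadratic polynomial in
`a` and `b`. It vanishes at all points of `a b = ∏ r_i` other than the origin, because these come from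
representations on which the center acts by scalars (`eval_shadowCoords_eq_zero`). Hence it is a
multiple of `a b - ∏ r_i`, and the shape of the top weight part determines the factor: it is a nonzero
constant times `(σ ^ D - σ ^ (-D)) ^ 2` (`exists_eval_shadowCoords_eq`), which is nonzero because
`z (A₀) ≠ ± 2`.

*Conclusion.* Differentiating along `a`, `b`, `w` and `σ`, all partial derivatives vanish if and only
if `a = b = 0` and the derivative of `∏ r_i` in `w` vanishes, that is, at least two of the `r_i` are
zero (`forall_pderiv_eq_zero_iff`). On the other hand, since `z (A₀) ≠ ± 2` the eigenvalues of `α₀` are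
distinct, and invariant subspaces are spanned by arcs of the cycle of basis vectors: the
representation is reducible if and only if `s_i = 0` and `t_j = 0` for some `i ≠ j`, which is the
same condition (`isReducible_iff`).
-/

noncomputable section

namespace PuncturedTorus

/-! ### The quantum torus of the ideal triangulation -/

/-- The exponent lattice of the quantum torus. -/
abbrev Lattice : Type := ℤ × ℤ × ℤ

/-- The antisymmetric form with `ω(e₁, e₂) = ω(e₂, e₃) = ω(e₃, e₁) = 1`. -/
def latticeForm (u v : Lattice) : ℤ :=
  u.1 * v.2.1 - u.2.1 * v.1 + (u.2.1 * v.2.2 - u.2.2 * v.2.1) + (u.2.2 * v.1 - u.1 * v.2.2)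

/-- The total degree of a lattice vector. -/
def latticeDeg (u : Lattice) : ℤ := u.1 + u.2.1 + u.2.2

/-- The Weyl-ordered monomial of exponent `v`, as an operator on functions on the lattice:
`E_v δ_u = q ^ ω(v, u) δ_{u + v}`. -/
def weylOp (q : ℂ) (v : Lattice) : Module.End ℂ (Lattice → ℂ) where
  toFun f u := q ^ latticeForm v u * f (u - v)
  map_add' f g := by ext u; simp [mul_add]
  map_smul' c f := by ext u; simp [mul_left_comm]

@[simp] lemma latticeDeg_add (u v : Lattice) : latticeDeg (u + v) = latticeDeg u + latticeDeg v := by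
  simp [latticeDeg]; ring

@[simp] lemma latticeForm_self (u : Lattice) : latticeForm u u = 0 := by
  simp [latticeForm]; ring

lemma latticeForm_add_left (u u' v : Lattice) :
    latticeForm (u + u') v = latticeForm u v + latticeForm u' v := by
  simp [latticeForm]; ring

lemma latticeForm_swap (u v : Lattice) : latticeForm v u = -latticeForm u v := by
  simp [latticeForm]; ring

lemma weylOp_apply (q : ℂ) (v u : Lattice) (f : Lattice → ℂ) :
    weylOp q v f u = q ^ latticeForm v u * f (u - v) := rfl

lemma weylOp_mul {q : ℂ} (hq : q ≠ 0) (v v' : Lattice) :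
    weylOp q v * weylOp q v' = q ^ latticeForm v v' • weylOp q (v + v') := by
  ext f u
  rw [Module.End.mul_apply, LinearMap.smul_apply, Pi.smul_apply, weylOp_apply, weylOp_apply,
    weylOp_apply, smul_eq_mul, ← mul_assoc, ← mul_assoc, ← zpow_add₀ hq, ← zpow_add₀ hq,
    latticeForm_add_left, sub_sub]
  congr 2
  simp [latticeForm]; ring

lemma weylOp_zero (q : ℂ) : weylOp q 0 = 1 := by
  ext f u
  simp [weylOp_apply, latticeForm]

/-- `f` is supported in total degree less than `d`. -/
def DegLT (d : ℤ) (f : Lattice → ℂ) : Prop := ∀ u, d ≤ latticeDeg u → f u = 0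

lemma degLT_single (u : Lattice) (c : ℂ) : DegLT (latticeDeg u + 1) (Pi.single u c) := by
  intro u' h
  rw [Pi.single_apply, if_neg]
  rintro rfl
  omega

/-- Operators on functions on the lattice that raise the total degree by at most `n`. -/
def orderLE (n : ℤ) : Submodule ℂ (Module.End ℂ (Lattice → ℂ)) where
  carrier := {L | ∀ d f, DegLT d f → DegLT (d + n) (L f)}
  zero_mem' := fun d f _ u _ => rfl
  add_mem' {a b} ha hb d f hf u h := by
    rw [LinearMap.add_apply, Pi.add_apply, ha d f hf u h, hb d f hf u h, add_zero]
  smul_mem' c a ha d f hf u h := by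
    rw [LinearMap.smul_apply, Pi.smul_apply, ha d f hf u h, smul_zero]

lemma orderLE_mono {m n : ℤ} (h : m ≤ n) : orderLE m ≤ orderLE n :=
  fun _ hL d f hf u hu => hL d f hf u (by omega)

lemma mul_mem_orderLE {m n : ℤ} {L L' : Module.End ℂ (Lattice → ℂ)}
    (hL : L ∈ orderLE m) (hL' : L' ∈ orderLE n) : L * L' ∈ orderLE (m + n) := by
  intro d f hf
  rw [Module.End.mul_apply, add_comm m, ← add_assoc]
  exact hL _ _ (hL' _ _ hf)

lemma weylOp_mem_orderLE (q : ℂ) {v : Lattice} {n : ℤ} (h : latticeDeg v ≤ n) :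
    weylOp q v ∈ orderLE n := by
  intro d f hf u hu
  rw [weylOp_apply, hf, mul_zero]
  have : latticeDeg u = latticeDeg (u - v) + latticeDeg v := by
    rw [← latticeDeg_add, sub_add_cancel]
  omega

/-- `L` has leading term `κ E_m`, up to operators that raise the total degree by less than
`deg m`. -/
def HasLead (q : ℂ) (L : Module.End ℂ (Lattice → ℂ)) (m : Lattice) (κ : ℂ) : Prop :=
  L - κ • weylOp q m ∈ orderLE (latticeDeg m - 1)

lemma HasLead.mem_orderLE {q : ℂ} {L : Module.End ℂ (Lattice → ℂ)} {m : Lattice} {κ : ℂ}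
    (h : HasLead q L m κ) : L ∈ orderLE (latticeDeg m) := by
  have := add_mem (orderLE_mono (by omega) h)
    ((orderLE (latticeDeg m)).smul_mem κ (weylOp_mem_orderLE q le_rfl))
  rwa [sub_add_cancel] at this

lemma hasLead_weylOp (q : ℂ) (m : Lattice) : HasLead q (weylOp q m) m 1 := by
  unfold HasLead
  rw [one_smul, sub_self]
  exact zero_mem _

lemma hasLead_one (q : ℂ) : HasLead q 1 0 1 := by
  simpa [weylOp_zero] using hasLead_weylOp q 0

lemma HasLead.add_lower {q : ℂ} {L L' : Module.End ℂ (Lattice → ℂ)} {m : Lattice} {κ : ℂ}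
    (h : HasLead q L m κ) (h' : L' ∈ orderLE (latticeDeg m - 1)) : HasLead q (L + L') m κ := by
  have := add_mem h h'
  rwa [sub_add_eq_add_sub] at this

lemma HasLead.smul {q : ℂ} {L : Module.End ℂ (Lattice → ℂ)} {m : Lattice} {κ : ℂ}
    (h : HasLead q L m κ) (c : ℂ) : HasLead q (c • L) m (c * κ) := by
  have := (orderLE (latticeDeg m - 1)).smul_mem c h
  rwa [smul_sub, smul_smul] at this

lemma HasLead.mul {q : ℂ} (hq : q ≠ 0) {L L' : Module.End ℂ (Lattice → ℂ)} {m m' : Lattice}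
    {κ κ' : ℂ} (h : HasLead q L m κ) (h' : HasLead q L' m' κ') :
    HasLead q (L * L') (m + m') (κ * κ' * q ^ latticeForm m m') := by
  have e : L * L' - (κ * κ' * q ^ latticeForm m m') • weylOp q (m + m')
      = (L - κ • weylOp q m) * L' + (κ • weylOp q m) * (L' - κ' • weylOp q m') := by
    rw [sub_mul, mul_sub, smul_mul_smul_comm, weylOp_mul hq, smul_smul]
    abel
  unfold HasLead
  rw [e, latticeDeg_add]
  refine add_mem ?_ ?_
  · rw [add_sub_right_comm]
    exact mul_mem_orderLE h h'.mem_orderLE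
  · rw [add_sub_assoc]
    exact mul_mem_orderLE (Submodule.smul_mem _ _ (weylOp_mem_orderLE q le_rfl)) h'

lemma HasLead.pow {q : ℂ} (hq : q ≠ 0) {L : Module.End ℂ (Lattice → ℂ)} {m : Lattice}
    (h : HasLead q L m 1) (k : ℕ) : HasLead q (L ^ k) (k • m) 1 := by
  induction k with
  | zero => simpa using hasLead_one q
  | succ k ih =>
    rw [pow_succ, succ_nsmul]
    have h0 : latticeForm (k • m) m = 0 := by
      rw [← natCast_zsmul]
      simp only [latticeForm, Prod.smul_fst, Prod.smul_snd, smul_eq_mul]; ring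
    have := ih.mul hq h
    rwa [h0, zpow_zero, mul_one, mul_one] at this

/-- Evaluating at a basis vector reads off the leading coefficient. -/
lemma HasLead.apply_top {q : ℂ} {L : Module.End ℂ (Lattice → ℂ)} {m : Lattice}
    {κ : ℂ} (h : HasLead q L m κ) {f : Lattice → ℂ} {d : ℤ} (hf : DegLT (d + 1) f)
    {u : Lattice} (hu : d + latticeDeg m ≤ latticeDeg u) :
    L f u = κ * (q ^ latticeForm m u * f (u - m)) := by
  have := h _ f hf u (by omega)
  rwa [LinearMap.sub_apply, Pi.sub_apply, sub_eq_zero] at this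

/-- The images of the three curves under the quantum trace. -/
def traceGen (q : ℂ) : Slope → Module.End ℂ (Lattice → ℂ)
  | .zero => weylOp q (1, 0, 0) + weylOp q (-1, 0, 0) + weylOp q (0, -1, 1)
  | .one => weylOp q (0, 1, 0) + weylOp q (0, -1, 0) + weylOp q (1, 0, -1)
  | .infty => weylOp q (0, 0, 1) + weylOp q (0, 0, -1) + weylOp q (-1, 1, 0)

lemma traceGen_rel_one {q : ℂ} (hq : q ≠ 0) :
    q • (traceGen q .zero * traceGen q .infty) - q⁻¹ • (traceGen q .infty * traceGen q .zero)
      = (q ^ 2 - (q⁻¹) ^ 2) • traceGen q .one := by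
  simp only [traceGen, mul_add, add_mul, weylOp_mul hq, latticeForm, Prod.mk_add_mk]
  norm_num
  match_scalars <;> field_simp <;> norm_num <;> ring

lemma traceGen_rel_infty {q : ℂ} (hq : q ≠ 0) :
    q • (traceGen q .one * traceGen q .zero) - q⁻¹ • (traceGen q .zero * traceGen q .one)
      = (q ^ 2 - (q⁻¹) ^ 2) • traceGen q .infty := by
  simp only [traceGen, mul_add, add_mul, weylOp_mul hq, latticeForm, Prod.mk_add_mk]
  norm_num
  match_scalars <;> field_simp <;> norm_num <;> ring

lemma traceGen_rel_zero {q : ℂ} (hq : q ≠ 0) :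
    q • (traceGen q .infty * traceGen q .one) - q⁻¹ • (traceGen q .one * traceGen q .infty)
      = (q ^ 2 - (q⁻¹) ^ 2) • traceGen q .zero := by
  simp only [traceGen, mul_add, add_mul, weylOp_mul hq, latticeForm, Prod.mk_add_mk]
  norm_num
  match_scalars <;> field_simp <;> norm_num <;> ring

/-- An algebra homomorphism out of the skein algebra from three elements satisfying the
Bullock-Przytycki relations. -/
def liftSkein {q : ℂ} {A : Type*} [Ring A] [Algebra ℂ A] (f : Slope → A)
    (h1 : q • (f .zero * f .infty) - q⁻¹ • (f .infty * f .zero) = (q ^ 2 - (q⁻¹) ^ 2) • f .one)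
    (h2 : q • (f .one * f .zero) - q⁻¹ • (f .zero * f .one) = (q ^ 2 - (q⁻¹) ^ 2) • f .infty)
    (h3 : q • (f .infty * f .one) - q⁻¹ • (f .one * f .infty) = (q ^ 2 - (q⁻¹) ^ 2) • f .zero) :
    SkeinAlgebra q →ₐ[ℂ] A :=
  RingQuot.liftAlgHom ℂ ⟨FreeAlgebra.lift ℂ f, fun x y h => by
    cases h
    · simpa using h1
    · simpa using h2
    · simpa using h3⟩

lemma liftSkein_curve {q : ℂ} {A : Type*} [Ring A] [Algebra ℂ A] (f : Slope → A) (h1 h2 h3)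
    (m : Slope) : liftSkein (q := q) f h1 h2 h3 (curve q m) = f m :=
  (RingQuot.liftAlgHom_mkAlgHom_apply ℂ (s := SkeinRel q) (FreeAlgebra.lift ℂ f) _ _).trans
    (FreeAlgebra.lift_ι_apply f m)

/-- The quantum trace map from the skein algebra to the quantum torus. -/
def quantumTrace {q : ℂ} (hq : q ≠ 0) : SkeinAlgebra q →ₐ[ℂ] Module.End ℂ (Lattice → ℂ) :=
  liftSkein (traceGen q) (traceGen_rel_one hq) (traceGen_rel_infty hq) (traceGen_rel_zero hq)

lemma quantumTrace_curve {q : ℂ} (hq : q ≠ 0) (m : Slope) :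
    quantumTrace hq (curve q m) = traceGen q m := liftSkein_curve ..

/-- The lattice vector of the leading term of a curve. -/
def slopeVec : Slope → Lattice
  | .zero => (1, 0, 0)
  | .one => (0, 1, 0)
  | .infty => (0, 0, 1)

lemma latticeDeg_slopeVec (m : Slope) : latticeDeg (slopeVec m) = 1 := by
  cases m <;> simp [latticeDeg, slopeVec]

lemma hasLead_traceGen (q : ℂ) (m : Slope) : HasLead q (traceGen q m) (slopeVec m) 1 := by
  cases m <;>
  · simp only [traceGen, slopeVec]
    rw [add_assoc]
    refine (hasLead_weylOp q _).add_lower (add_mem ?_ ?_) <;>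
      exact weylOp_mem_orderLE q (by simp [latticeDeg])

/-- The element of the skein algebra given by the loop around the puncture. -/
def boundary (q : ℂ) : SkeinAlgebra q :=
  q⁻¹ • (curve q .zero * curve q .one * curve q .infty) - (q⁻¹) ^ 2 • (curve q .zero * curve q .zero)
    - q ^ 2 • (curve q .one * curve q .one) - (q⁻¹) ^ 2 • (curve q .infty * curve q .infty)
    + algebraMap ℂ _ (q ^ 2 + (q⁻¹) ^ 2)

lemma quantumTrace_boundary {q : ℂ} (hq : q ≠ 0) :
    quantumTrace hq (boundary q) = weylOp q (1, 1, 1) + weylOp q (-1, -1, -1) := by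
  simp only [boundary, map_add, map_sub, map_mul, map_smul, quantumTrace_curve,
    Algebra.algebraMap_eq_smul_one, map_one]
  simp only [traceGen, mul_add, add_mul, weylOp_mul hq, latticeForm, Prod.mk_add_mk, smul_add,
    smul_mul_assoc]
  have h0 : weylOp q (0, 0, 0) = 1 := weylOp_zero q
  norm_num [h0]
  match_scalars <;> field_simp <;> norm_num <;> ring

/-! ### The Poincaré-Birkhoff-Witt basis -/

/-- The ordered monomial `α₀ ^ i α₁ ^ j α_∞ ^ k`. -/
def pbw (q : ℂ) (m : ℕ × ℕ × ℕ) : SkeinAlgebra q :=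
  curve q .zero ^ m.1 * curve q .one ^ m.2.1 * curve q .infty ^ m.2.2

/-- The span of the ordered monomials of degree at most `n`. -/
def pbwFil (q : ℂ) (n : ℕ) : Submodule ℂ (SkeinAlgebra q) :=
  Submodule.span ℂ (pbw q '' {m | m.1 + m.2.1 + m.2.2 ≤ n})

lemma pbw_mem_pbwFil (q : ℂ) {i j k n : ℕ} (h : i + j + k ≤ n) : pbw q (i, j, k) ∈ pbwFil q n :=
  Submodule.subset_span ⟨_, h, rfl⟩

lemma pbwFil_mono (q : ℂ) {m n : ℕ} (h : m ≤ n) : pbwFil q m ≤ pbwFil q n :=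
  Submodule.span_mono (Set.image_mono fun _ hx => le_trans hx h)

lemma mul_mem_pbwFil_of_forall {q : ℂ} {n k : ℕ} {a : SkeinAlgebra q}
    (h : ∀ i j l, i + j + l ≤ n → a * pbw q (i, j, l) ∈ pbwFil q k) {b : SkeinAlgebra q}
    (hb : b ∈ pbwFil q n) : a * b ∈ pbwFil q k := by
  induction hb using Submodule.span_induction with
  | mem x hx => obtain ⟨⟨i, j, l⟩, hm, rfl⟩ := hx; exact h i j l hm
  | zero => simp
  | add x y _ _ hx hy => rw [mul_add]; exact add_mem hx hy
  | smul c x _ hx => rw [mul_smul_comm]; exact Submodule.smul_mem _ _ hx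

lemma curve_zero_mul_mem {q : ℂ} {n : ℕ} {b : SkeinAlgebra q} (hb : b ∈ pbwFil q n) :
    curve q .zero * b ∈ pbwFil q (n + 1) := by
  refine mul_mem_pbwFil_of_forall (fun i j l h => ?_) hb
  have : curve q .zero * pbw q (i, j, l) = pbw q (i + 1, j, l) := by
    simp [pbw, pow_succ', mul_assoc]
  rw [this]
  exact pbw_mem_pbwFil q (by omega)

lemma curve_infty_mul_zero {q : ℂ} (hq : q ≠ 0) : curve q .infty * curve q .zero
    = q ^ 2 • (curve q .zero * curve q .infty) - (q * (q ^ 2 - (q⁻¹) ^ 2)) • curve q .one := by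
  rw [mul_smul, ← curve_rel_one, smul_sub, smul_smul, smul_smul, mul_inv_cancel₀ hq]
  module

lemma curve_one_mul_zero {q : ℂ} (hq : q ≠ 0) : curve q .one * curve q .zero
    = (q⁻¹) ^ 2 • (curve q .zero * curve q .one)
      + (q⁻¹ * (q ^ 2 - (q⁻¹) ^ 2)) • curve q .infty := by
  rw [mul_smul, ← curve_rel_infty, smul_sub, smul_smul, smul_smul, inv_mul_cancel₀ hq]
  module

lemma curve_infty_mul_one {q : ℂ} (hq : q ≠ 0) : curve q .infty * curve q .one
    = (q⁻¹) ^ 2 • (curve q .one * curve q .infty)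
      + (q⁻¹ * (q ^ 2 - (q⁻¹) ^ 2)) • curve q .zero := by
  rw [mul_smul, ← curve_rel_zero, smul_sub, smul_smul, smul_smul, inv_mul_cancel₀ hq]
  module

lemma curve_mul_pbw_mem {q : ℂ} (hq : q ≠ 0) (n : ℕ) : ∀ i j k, i + j + k ≤ n →
    curve q .one * pbw q (i, j, k) ∈ pbwFil q (n + 1)
      ∧ curve q .infty * pbw q (i, j, k) ∈ pbwFil q (n + 1) := by
  -- The relations trade a wrongly ordered product for a correctly ordered one and a shorter word,
  -- so that the statement for `n` follows from that for `n - 1`, first for `α₁`, then for `α_∞`.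
  induction n with
  | zero =>
    intro i j k h
    obtain ⟨rfl, rfl, rfl⟩ : i = 0 ∧ j = 0 ∧ k = 0 := by omega
    constructor
    · simpa [pbw] using pbw_mem_pbwFil q (i := 0) (j := 1) (k := 0) (n := 1) (by simp)
    · simpa [pbw] using pbw_mem_pbwFil q (i := 0) (j := 0) (k := 1) (n := 1) (by simp)
  | succ n ih =>
    have h1 : ∀ i j k, i + j + k ≤ n + 1 →
        curve q .one * pbw q (i, j, k) ∈ pbwFil q (n + 1 + 1) := by
      intro i j k h
      cases i with
      | zero =>
        have : curve q .one * pbw q (0, j, k) = pbw q (0, j + 1, k) := by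
          simp [pbw, pow_succ', mul_assoc]
        rw [this]
        exact pbw_mem_pbwFil q (by omega)
      | succ i =>
        have : curve q .one * pbw q (i + 1, j, k)
            = (curve q .one * curve q .zero) * pbw q (i, j, k) := by
          simp [pbw, pow_succ', mul_assoc]
        rw [this, curve_one_mul_zero hq, add_mul, smul_mul_assoc, smul_mul_assoc, mul_assoc]
        exact add_mem (Submodule.smul_mem _ _ (curve_zero_mul_mem (ih i j k (by omega)).1))
          (Submodule.smul_mem _ _ (pbwFil_mono q (by omega) (ih i j k (by omega)).2))
    intro i j k h
    refine ⟨h1 i j k h, ?_⟩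
    cases i with
    | zero =>
      cases j with
      | zero =>
        have : curve q .infty * pbw q (0, 0, k) = pbw q (0, 0, k + 1) := by
          simp [pbw, pow_succ']
        rw [this]
        exact pbw_mem_pbwFil q (by omega)
      | succ j =>
        have : curve q .infty * pbw q (0, j + 1, k)
            = (curve q .infty * curve q .one) * pbw q (0, j, k) := by
          simp [pbw, pow_succ', mul_assoc]
        rw [this, curve_infty_mul_one hq, add_mul, smul_mul_assoc, smul_mul_assoc, mul_assoc]
        exact add_mem
          (Submodule.smul_mem _ _ (mul_mem_pbwFil_of_forall h1 (ih 0 j k (by omega)).2))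
          (Submodule.smul_mem _ _ (curve_zero_mul_mem (pbw_mem_pbwFil q (by omega))))
    | succ i =>
      have : curve q .infty * pbw q (i + 1, j, k)
          = (curve q .infty * curve q .zero) * pbw q (i, j, k) := by
        simp [pbw, pow_succ', mul_assoc]
      rw [this, curve_infty_mul_zero hq, sub_mul, smul_mul_assoc, smul_mul_assoc, mul_assoc]
      exact sub_mem (Submodule.smul_mem _ _ (curve_zero_mul_mem (ih i j k (by omega)).2))
        (Submodule.smul_mem _ _ (pbwFil_mono q (by omega) (ih i j k (by omega)).1))

lemma pbw_span {q : ℂ} (hq : q ≠ 0) (a : SkeinAlgebra q) :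
    a ∈ Submodule.span ℂ (Set.range (pbw q)) := by
  have hle : ∀ n, pbwFil q n ≤ Submodule.span ℂ (Set.range (pbw q)) := fun n =>
    Submodule.span_mono (Set.image_subset_range _ _)
  have hmul : ∀ (m : Slope) (b), b ∈ Submodule.span ℂ (Set.range (pbw q)) →
      curve q m * b ∈ Submodule.span ℂ (Set.range (pbw q)) := by
    intro m b hb
    induction hb using Submodule.span_induction with
    | mem x hx =>
      obtain ⟨⟨i, j, k⟩, rfl⟩ := hx
      cases m
      · exact hle _ (curve_zero_mul_mem (pbw_mem_pbwFil q le_rfl))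
      · exact hle _ (curve_mul_pbw_mem hq _ i j k le_rfl).1
      · exact hle _ (curve_mul_pbw_mem hq _ i j k le_rfl).2
    | zero => simp
    | add x y _ _ hx hy => rw [mul_add]; exact add_mem hx hy
    | smul c x _ hx => rw [mul_smul_comm]; exact Submodule.smul_mem _ _ hx
  suffices h : ∀ b ∈ Submodule.span ℂ (Set.range (pbw q)),
      a * b ∈ Submodule.span ℂ (Set.range (pbw q)) by
    simpa using h 1 (Submodule.subset_span ⟨(0, 0, 0), by simp [pbw]⟩)
  obtain ⟨f, rfl⟩ := toSkein_surjective q a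
  induction f using FreeAlgebra.induction with
  | grade0 r =>
    intro b hb
    rw [AlgHom.commutes, ← Algebra.smul_def]
    exact Submodule.smul_mem _ _ hb
  | grade1 m => exact hmul m
  | mul x y hx hy => intro b hb; rw [map_mul, mul_assoc]; exact hx _ (hy _ hb)
  | add x y hx hy => intro b hb; rw [map_add, add_mul]; exact add_mem (hx b hb) (hy b hb)

/-! ### Leading terms -/

/-- In a combination of operators with distinct leading exponents, the coefficient of a term of
maximal degree is read off at the basis vector `δ₀`. -/
lemma sum_apply_top {q : ℂ} {ι : Type*} {B : ι → Module.End ℂ (Lattice → ℂ)}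
    {m : ι → Lattice} {κ : ι → ℂ} {c : ι →₀ ℂ} (hB : ∀ i, HasLead q (B i) (m i) (κ i))
    (hm : Set.InjOn m c.support) {j : ι} (hj : j ∈ c.support)
    (hmax : ∀ i ∈ c.support, latticeDeg (m i) ≤ latticeDeg (m j)) :
    (c.sum fun i a => a • B i) (Pi.single 0 1) (m j) = c j * κ j := by
  rw [Finsupp.sum, LinearMap.sum_apply, Finset.sum_apply, Finset.sum_eq_single_of_mem j hj]
  · rw [LinearMap.smul_apply, Pi.smul_apply,
      (hB j).apply_top (d := 0) (degLT_single 0 1) (by simp)]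
    simp
  · intro i hi hij
    rw [LinearMap.smul_apply, Pi.smul_apply,
      (hB i).apply_top (d := 0) (degLT_single 0 1) (by simpa using hmax i hi)]
    have : m j - m i ≠ 0 := fun h => hij (hm hi hj (sub_eq_zero.1 h).symm)
    simp [this]

lemma coeff_eq_zero_of_mem_orderLE {q : ℂ} {ι : Type*} {B : ι → Module.End ℂ (Lattice → ℂ)}
    {m : ι → Lattice} {κ : ι → ℂ} {c : ι →₀ ℂ} (hB : ∀ i, HasLead q (B i) (m i) (κ i))
    (hκ : ∀ i, κ i ≠ 0) (hm : Set.InjOn m c.support) {n : ℤ}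
    (h : (c.sum fun i a => a • B i) ∈ orderLE n) {j : ι} (hj : n < latticeDeg (m j)) :
    c j = 0 := by
  by_contra hcj
  obtain ⟨i, hi, hmax⟩ := c.support.exists_max_image (fun i => latticeDeg (m i))
    ⟨j, Finsupp.mem_support_iff.2 hcj⟩
  have h1 := sum_apply_top hB hm hi hmax
  have h2 := hmax j (Finsupp.mem_support_iff.2 hcj)
  rw [h _ _ (degLT_single 0 1) (m i) (by simp [latticeDeg] at *; omega)] at h1
  exact mul_ne_zero (Finsupp.mem_support_iff.1 hi) (hκ i) h1.symm

/-- The exponents of the leading terms of an operator commuting with an operator of leading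
exponent `v` are orthogonal to `v`, modulo the order of `q ^ 2`. -/
lemma zpow_latticeForm_eq_of_commute {q : ℂ} (hq : q ≠ 0) {ι : Type*}
    {B : ι → Module.End ℂ (Lattice → ℂ)} {m : ι → Lattice} {κ : ι → ℂ} {c : ι →₀ ℂ}
    (hB : ∀ i, HasLead q (B i) (m i) (κ i)) (hκ : ∀ i, κ i ≠ 0) (hm : Set.InjOn m c.support)
    {G : Module.End ℂ (Lattice → ℂ)} {v : Lattice} (hG : HasLead q G v 1)
    (h : G * (c.sum fun i a => a • B i) = (c.sum fun i a => a • B i) * G) {j : ι}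
    (hj : j ∈ c.support) (hmax : ∀ i ∈ c.support, latticeDeg (m i) ≤ latticeDeg (m j)) :
    q ^ latticeForm v (m j) = q ^ latticeForm (m j) v := by
  have hl : G * (c.sum fun i a => a • B i) = c.sum fun i a => a • (G * B i) := by
    simp [Finsupp.sum, Finset.mul_sum]
  have hr : (c.sum fun i a => a • B i) * G = c.sum fun i a => a • (B i * G) := by
    simp [Finsupp.sum, Finset.sum_mul]
  have e1 := sum_apply_top (c := c) (fun i => hG.mul hq (hB i))
    (fun a ha b hb hab => hm ha hb (add_left_cancel hab)) hj
    (fun i hi => by simpa using hmax i hi)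
  have e2 := sum_apply_top (c := c) (fun i => (hB i).mul hq hG)
    (fun a ha b hb hab => hm ha hb (add_right_cancel hab)) hj
    (fun i hi => by simpa using hmax i hi)
  rw [← hl, h, hr, add_comm v, e2] at e1
  have := mul_left_cancel₀ (Finsupp.mem_support_iff.1 hj) e1
  rw [mul_one, one_mul] at this
  exact (mul_left_cancel₀ (hκ j) this).symm

/-- The exponent of an ordered monomial, as a lattice vector. -/
def pbwVec (m : ℕ × ℕ × ℕ) : Lattice := (m.1, m.2.1, m.2.2)

lemma pbwVec_injective : Function.Injective pbwVec := by
  rintro ⟨i, j, k⟩ ⟨i', j', k'⟩ h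
  simpa [pbwVec] using h

lemma latticeDeg_pbwVec (m : ℕ × ℕ × ℕ) :
    latticeDeg (pbwVec m) = ((m.1 + m.2.1 + m.2.2 : ℕ) : ℤ) := by
  simp [latticeDeg, pbwVec]

lemma exists_hasLead_pow_mul {q : ℂ} (hq : q ≠ 0) {L L' : Module.End ℂ (Lattice → ℂ)}
    {v v' : Lattice} (h : HasLead q L v 1) {κ : ℂ} (hκ : κ ≠ 0) (h' : HasLead q L' v' κ) (k : ℕ) :
    ∃ κ' ≠ 0, HasLead q (L' * L ^ k) (v' + k • v) κ' :=
  ⟨_, mul_ne_zero (mul_ne_zero hκ one_ne_zero) (zpow_ne_zero _ hq), h'.mul hq (h.pow hq k)⟩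

lemma exists_hasLead_pbw {q : ℂ} (hq : q ≠ 0) (m : ℕ × ℕ × ℕ) :
    ∃ κ ≠ 0, HasLead q (quantumTrace hq (pbw q m)) (pbwVec m) κ := by
  obtain ⟨κ, h0, h⟩ := exists_hasLead_pow_mul hq (hasLead_traceGen q .one) one_ne_zero
    ((hasLead_traceGen q .zero).pow hq m.1) m.2.1
  obtain ⟨κ', h0', h'⟩ := exists_hasLead_pow_mul hq (hasLead_traceGen q .infty) h0 h m.2.2
  refine ⟨κ', h0', ?_⟩
  have e : m.1 • slopeVec .zero + m.2.1 • slopeVec .one + m.2.2 • slopeVec .infty = pbwVec m := by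
    simp [slopeVec, pbwVec]
  rw [e] at h'
  simpa only [pbw, map_mul, map_pow, quantumTrace_curve] using h'

/-- A presentation of an element of the skein algebra by ordered monomials of bounded degree. -/
lemma exists_pbw_sum {q : ℂ} (hq : q ≠ 0) (a : SkeinAlgebra q) :
    ∃ c : (ℕ × ℕ × ℕ) →₀ ℂ, a = c.sum (fun m r => r • pbw q m) ∧
      ∀ n : ℤ, quantumTrace hq a ∈ orderLE n → ∀ m ∈ c.support, latticeDeg (pbwVec m) ≤ n := by
  obtain ⟨c, hc⟩ := Finsupp.mem_span_range_iff_exists_finsupp.1 (pbw_span hq a)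
  refine ⟨c, hc.symm, fun n hn m hm => ?_⟩
  by_contra! hlt
  choose κ hκ hlead using exists_hasLead_pbw hq
  refine Finsupp.mem_support_iff.1 hm (coeff_eq_zero_of_mem_orderLE hlead hκ
    (pbwVec_injective.injOn) ?_ hlt)
  rw [← hc] at hn
  simpa [map_finsuppSum] using hn

lemma eq_zero_of_quantumTrace_mem {q : ℂ} (hq : q ≠ 0) {a : SkeinAlgebra q}
    (h : quantumTrace hq a ∈ orderLE (-1)) : a = 0 := by
  obtain ⟨c, rfl, hc⟩ := exists_pbw_sum hq a
  refine Finset.sum_eq_zero fun m hm => ?_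
  have := hc _ h m hm
  rw [latticeDeg_pbwVec] at this
  omega

lemma quantumTrace_injective {q : ℂ} (hq : q ≠ 0) : Function.Injective (quantumTrace hq) :=
  (injective_iff_map_eq_zero _).2 fun a ha => eq_zero_of_quantumTrace_mem hq (by
    rw [ha]; exact zero_mem _)

/-! ### The center of the skein algebra -/

section

open MvPolynomial

lemma commute_boundary {q : ℂ} (hq : q ≠ 0) (m : Slope) :
    curve q m * boundary q = boundary q * curve q m := by
  apply quantumTrace_injective hq
  rw [map_mul, map_mul, quantumTrace_curve, quantumTrace_boundary]
  have key : ∀ v, latticeForm (1, 1, 1) v = 0 →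
      weylOp q v * (weylOp q (1, 1, 1) + weylOp q (-1, -1, -1))
        = (weylOp q (1, 1, 1) + weylOp q (-1, -1, -1)) * weylOp q v := by
    intro v hv
    have hv' : latticeForm (-1, -1, -1) v = 0 := by
      simp only [latticeForm] at hv ⊢; linarith
    rw [mul_add, add_mul, weylOp_mul hq, weylOp_mul hq, weylOp_mul hq, weylOp_mul hq,
      latticeForm_swap _ v, latticeForm_swap (-1, -1, -1) v, hv, hv', add_comm v, add_comm v,
      neg_zero]
  cases m <;> simp only [traceGen, add_mul _ _ (weylOp q (1, 1, 1) + _),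
    mul_add (weylOp q (1, 1, 1) + _), key _ (by simp [latticeForm] : latticeForm (1, 1, 1) _ = 0)]

/-- The loop around the puncture, as a central element. -/
def boundaryZ {q : ℂ} (hq : q ≠ 0) : Center q :=
  ⟨boundary q, mem_center_of_commute_curves q _ (commute_boundary hq)⟩

/-- The generators of the center: the Chebyshev elements of the three curves and the loop around
the puncture. -/
def centralGen {q : ℂ} (hq : q ≠ 0) : Fin 4 → Center q :=
  ![centralA q .zero, centralA q .one, centralA q .infty, boundaryZ hq]

/-- The map from the polynomial ring in four variables to the center. -/
def centralMap {q : ℂ} (hq : q ≠ 0) : MvPolynomial (Fin 4) ℂ →ₐ[ℂ] Center q :=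
  aeval (centralGen hq)

/-- The central elements, as operators in the quantum torus. -/
def centralTrace {q : ℂ} (hq : q ≠ 0) :
    MvPolynomial (Fin 4) ℂ →ₐ[ℂ] Module.End ℂ (Lattice → ℂ) :=
  (quantumTrace hq).comp ((Center.incl q).comp (centralMap hq))

lemma incl_centralA (q : ℂ) (m : Slope) : Center.incl q (centralA q m)
    = Polynomial.aeval (curve q m) (Polynomial.Chebyshev.C ℂ (piDegree q)) := rfl

lemma incl_boundaryZ {q : ℂ} (hq : q ≠ 0) : Center.incl q (boundaryZ hq) = boundary q := rfl

lemma Center.incl_injective (q : ℂ) : Function.Injective (Center.incl q) :=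
  Subtype.val_injective

lemma hasLead_chebyshev {q : ℂ} (hq : q ≠ 0) {L : Module.End ℂ (Lattice → ℂ)} {v : Lattice}
    (h : HasLead q L v 1) (hv : 0 < latticeDeg v) (k : ℕ) :
    HasLead q (Polynomial.aeval L (Polynomial.Chebyshev.C ℂ ((k + 1 : ℕ) : ℤ))) ((k + 1) • v) 1 := by
  have hdeg : ∀ j : ℕ, latticeDeg (j • v) = j * latticeDeg v := fun j => by
    induction j with
    | zero => simp [latticeDeg]
    | succ j ih => rw [succ_nsmul, latticeDeg_add, ih]; push_cast; ring
  have hone : ∀ n : ℤ, 0 ≤ n → (2 : Module.End ℂ (Lattice → ℂ)) ∈ orderLE n := fun n hn => by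
    have h1 : (1 : Module.End ℂ (Lattice → ℂ)) ∈ orderLE n :=
      weylOp_zero q ▸ weylOp_mem_orderLE q (by simpa [latticeDeg] using hn)
    rw [← one_add_one_eq_two]
    exact add_mem h1 h1
  have hstep : ∀ j : ℕ, Polynomial.aeval L (Polynomial.Chebyshev.C ℂ ((j + 2 : ℕ) : ℤ))
      = L * Polynomial.aeval L (Polynomial.Chebyshev.C ℂ ((j + 1 : ℕ) : ℤ))
        + -Polynomial.aeval L (Polynomial.Chebyshev.C ℂ (j : ℤ)) := fun j => by
    push_cast
    rw [Polynomial.Chebyshev.C_add_two, map_sub, map_mul, Polynomial.aeval_X, sub_eq_add_neg]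
  have hmul : ∀ j : ℕ, HasLead q (Polynomial.aeval L (Polynomial.Chebyshev.C ℂ ((j + 1 : ℕ) : ℤ)))
      ((j + 1) • v) 1 →
      HasLead q (L * Polynomial.aeval L (Polynomial.Chebyshev.C ℂ ((j + 1 : ℕ) : ℤ)))
        ((j + 2) • v) 1 := fun j hj => by
    have h0 : latticeForm v ((j + 1) • v) = 0 := by
      rw [← natCast_zsmul]
      simp only [latticeForm, Prod.smul_fst, Prod.smul_snd, smul_eq_mul]; ring
    have := h.mul hq hj
    rwa [h0, zpow_zero, mul_one, mul_one, ← succ_nsmul'] at this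
  induction k using Nat.twoStepInduction with
  | zero => simpa using h
  | one =>
    rw [show (1 + 1 : ℕ) = 0 + 2 from rfl, hstep 0]
    refine (hmul 0 (by simpa using h)).add_lower (neg_mem ?_)
    rw [Nat.cast_zero, Polynomial.Chebyshev.C_zero, hdeg, map_ofNat]
    exact hone _ (by push_cast; linarith)
  | more k ih0 ih1 =>
    rw [show k + 2 + 1 = (k + 1) + 2 by ring, hstep (k + 1)]
    refine (hmul (k + 1) ih1).add_lower (neg_mem ?_)
    refine orderLE_mono ?_ ih0.mem_orderLE
    rw [hdeg, hdeg]
    push_cast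
    nlinarith

/-- The exponent of the leading term of a monomial in the generators of the center. -/
def centralVec (D : ℕ) (n : Fin 4 →₀ ℕ) : Lattice :=
  ((D * n 0 + n 3 : ℕ), (D * n 1 + n 3 : ℕ), (D * n 2 + n 3 : ℕ))

lemma centralVec_injOn (D : ℕ) : Set.InjOn (centralVec D) {n | n 3 < D} := by
  intro n hn n' hn' h
  simp only [Set.mem_ofPred_eq] at hn hn'
  simp only [centralVec, Prod.mk.injEq, Nat.cast_inj] at h
  have aux : ∀ a b : ℕ, D * a + n 3 = D * b + n' 3 → n 3 = n' 3 ∧ a = b := by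
    intro a b hab
    have h1 := congrArg (· % D) hab
    simp only [Nat.mul_add_mod, Nat.mod_eq_of_lt hn, Nat.mod_eq_of_lt hn'] at h1
    refine ⟨h1, ?_⟩
    rw [h1] at hab
    exact Nat.eq_of_mul_eq_mul_left (by omega) (Nat.add_right_cancel hab)
  ext i
  fin_cases i
  exacts [(aux _ _ h.1).2, (aux _ _ h.2.1).2, (aux _ _ h.2.2).2, (aux _ _ h.1).1]

/-- The total degree of `centralVec`. -/
def centralWeight (D : ℕ) (n : Fin 4 →₀ ℕ) : ℕ := D * (n 0 + n 1 + n 2) + 3 * n 3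

lemma latticeDeg_centralVec (D : ℕ) (n : Fin 4 →₀ ℕ) :
    latticeDeg (centralVec D n) = centralWeight D n := by
  simp only [latticeDeg, centralVec, centralWeight]; push_cast; ring

lemma centralTrace_monomial {q : ℂ} (hq : q ≠ 0) (n : Fin 4 →₀ ℕ) :
    centralTrace hq (monomial n 1)
      = quantumTrace hq (Center.incl q (centralA q .zero)) ^ n 0
        * quantumTrace hq (Center.incl q (centralA q .one)) ^ n 1
        * quantumTrace hq (Center.incl q (centralA q .infty)) ^ n 2
        * quantumTrace hq (Center.incl q (boundaryZ hq)) ^ n 3 := by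
  rw [centralTrace, AlgHom.comp_apply, AlgHom.comp_apply, centralMap, aeval_monomial, map_one,
    one_mul, Finsupp.prod_fintype _ _ (by simp), Fin.prod_univ_four]
  simp only [map_mul, map_pow, centralGen, Matrix.cons_val]

lemma exists_hasLead_centralTrace {q : ℂ} (hq : q ≠ 0) (hD : 0 < piDegree q) (n : Fin 4 →₀ ℕ) :
    ∃ κ ≠ 0, HasLead q (centralTrace hq (monomial n 1)) (centralVec (piDegree q) n) κ := by
  have hA : ∀ m, HasLead q (quantumTrace hq (Center.incl q (centralA q m)))
      (piDegree q • slopeVec m) 1 := fun m => by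
    have := hasLead_chebyshev hq (hasLead_traceGen q m) (by rw [latticeDeg_slopeVec]; norm_num)
      (piDegree q - 1)
    rw [Nat.sub_add_cancel hD] at this
    rwa [incl_centralA, ← Polynomial.aeval_algHom_apply, quantumTrace_curve]
  have hη : HasLead q (quantumTrace hq (Center.incl q (boundaryZ hq))) (1, 1, 1) 1 := by
    rw [incl_boundaryZ, quantumTrace_boundary]
    exact (hasLead_weylOp q _).add_lower (weylOp_mem_orderLE q (by simp [latticeDeg]))
  obtain ⟨κ₁, h1, h⟩ := exists_hasLead_pow_mul hq (hA .one) one_ne_zero ((hA .zero).pow hq (n 0))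
    (n 1)
  obtain ⟨κ₂, h2, h⟩ := exists_hasLead_pow_mul hq (hA .infty) h1 h (n 2)
  obtain ⟨κ₃, h3, h⟩ := exists_hasLead_pow_mul hq hη h2 h (n 3)
  refine ⟨κ₃, h3, ?_⟩
  rw [centralTrace_monomial]
  convert! h using 1
  simp [centralVec, slopeVec, mul_comm]

/-- The monomials in the generators of the center with exponent of the puncture loop less than `D`
are linearly independent. -/
lemma eq_zero_of_centralMap_eq_zero {q : ℂ} (hq : q ≠ 0) (hD : 0 < piDegree q)
    {g : MvPolynomial (Fin 4) ℂ} (hg : ∀ n ∈ g.support, n 3 < piDegree q)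
    (h : centralMap hq g = 0) : g = 0 := by
  choose κ hκ hlead using exists_hasLead_centralTrace hq hD
  have h0 : centralTrace hq g = 0 := by
    rw [centralTrace, AlgHom.comp_apply, AlgHom.comp_apply, h, map_zero, map_zero]
  let c : (Fin 4 →₀ ℕ) →₀ ℂ := Finsupp.onFinset g.support (fun n => g.coeff n)
    (fun n hn => mem_support_iff.2 hn)
  have hc : c.support ⊆ g.support := Finsupp.support_onFinset_subset
  have hsum : (c.sum fun n a => a • centralTrace hq (monomial n 1)) = centralTrace hq g := by
    conv_rhs => rw [g.as_sum]
    rw [map_sum, Finsupp.onFinset_sum _ (by simp)]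
    refine Finset.sum_congr rfl fun n _ => ?_
    rw [← map_smul, smul_monomial, smul_eq_mul, mul_one]
  ext n
  refine coeff_eq_zero_of_mem_orderLE (c := c) (n := -1) hlead hκ
    ((centralVec_injOn (piDegree q)).mono fun n hn => hg n (hc hn)) ?_ ?_
  · rw [hsum, h0]
    exact zero_mem _
  · rw [latticeDeg_centralVec]; omega

/-- The leading exponents of a central element are leading exponents of monomials in the
generators. -/
lemma exists_centralVec_eq {q : ℂ} (hq : q ≠ 0) (hD : 0 < piDegree q) (m : ℕ × ℕ × ℕ)
    (h : ∀ s, q ^ latticeForm (slopeVec s) (pbwVec m) = q ^ latticeForm (pbwVec m) (slopeVec s)) :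
    ∃ n : Fin 4 →₀ ℕ, n 3 < piDegree q ∧ centralVec (piDegree q) n = pbwVec m := by
  have hdvd : ∀ s, (piDegree q : ℤ) ∣ latticeForm (slopeVec s) (pbwVec m) := fun s => by
    have hu : orderOf (q ^ 2) = orderOf (Units.mk0 (q ^ 2) (pow_ne_zero 2 hq)) := by
      rw [← orderOf_units, Units.val_mk0]
    rw [piDegree, hu, orderOf_dvd_iff_zpow_eq_one, ← Units.val_inj, Units.val_zpow_eq_zpow_val,
      Units.val_mk0, Units.val_one, ← zpow_natCast, ← zpow_mul]
    have := h s
    rw [latticeForm_swap (slopeVec s)] at this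
    rw [show ((2 : ℕ) : ℤ) * latticeForm (slopeVec s) (pbwVec m)
      = latticeForm (slopeVec s) (pbwVec m) - -latticeForm (slopeVec s) (pbwVec m) by
        push_cast; ring, zpow_sub₀ hq, this, div_self (zpow_ne_zero _ hq)]
  obtain ⟨i, j, k⟩ := m
  have h1 : i % piDegree q = k % piDegree q := by
    have := hdvd .one
    simp only [latticeForm, slopeVec, pbwVec] at this
    refine (Nat.modEq_iff_dvd.2 ?_)
    convert! this using 1; ring
  have h2 : j % piDegree q = k % piDegree q := by
    have := hdvd .zero
    simp only [latticeForm, slopeVec, pbwVec] at this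
    refine (Nat.modEq_iff_dvd.2 ?_).symm
    convert! this using 1; ring
  refine ⟨Finsupp.equivFunOnFinite.symm
    ![i / piDegree q, j / piDegree q, k / piDegree q, k % piDegree q], ?_, ?_⟩
  · simpa using Nat.mod_lt _ hD
  · have e1 := Nat.div_add_mod i (piDegree q)
    have e2 := Nat.div_add_mod j (piDegree q)
    have e3 := Nat.div_add_mod k (piDegree q)
    rw [h1] at e1
    rw [h2] at e2
    simp only [centralVec, pbwVec, Finsupp.equivFunOnFinite_symm_apply_apply, Matrix.cons_val,
      e1, e2, e3]

/-- Every central element of bounded order is a combination of monomials in the generators whose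
weight is bounded accordingly. -/
lemma exists_centralMap_eq {q : ℂ} (hq : q ≠ 0) (hD : 0 < piDegree q) (N : ℕ) (c : Center q)
    (hc : quantumTrace hq (Center.incl q c) ∈ orderLE ((N : ℤ) - 1)) :
    ∃ g : MvPolynomial (Fin 4) ℂ, (∀ n ∈ g.support, n 3 < piDegree q ∧
      centralWeight (piDegree q) n < N) ∧ centralMap hq g = c := by
  induction N generalizing c with
  | zero =>
    refine ⟨0, by simp, ?_⟩
    rw [map_zero]
    apply Center.incl_injective q
    rw [map_zero]
    exact (eq_zero_of_quantumTrace_mem hq (by simpa using hc)).symm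
  | succ N ih =>
    obtain ⟨a, ha, hle⟩ := exists_pbw_sum hq (Center.incl q c)
    have hle := hle _ hc
    choose κ hκ hlead using exists_hasLead_pbw hq
    choose κ' hκ' hlead' using exists_hasLead_centralTrace hq hD
    have hsum : quantumTrace hq (Center.incl q c)
        = a.sum fun m r => r • quantumTrace hq (pbw q m) := by
      rw [ha, map_finsuppSum]
      simp
    have htop : ∀ m ∈ a.support, latticeDeg (pbwVec m) = N →
        ∃ n : Fin 4 →₀ ℕ, n 3 < piDegree q ∧ centralVec (piDegree q) n = pbwVec m := by
      intro m hm hmN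
      refine exists_centralVec_eq hq hD m fun s => ?_
      refine zpow_latticeForm_eq_of_commute hq hlead hκ pbwVec_injective.injOn
        (hasLead_traceGen q s) ?_ hm ?_
      · rw [← hsum, ← quantumTrace_curve hq, ← map_mul, ← map_mul]
        exact congrArg _ (Subalgebra.mem_center_iff.1 c.2 (curve q s))
      · intro i hi
        have := hle i hi
        push_cast at this
        omega
    -- The monomial with the leading exponent of a term of top degree, normalized to cancel it.
    have hg : ∀ m ∈ a.support, ∃ g : MvPolynomial (Fin 4) ℂ,
        (∀ n ∈ g.support, n 3 < piDegree q ∧ centralWeight (piDegree q) n < N + 1) ∧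
        a m • quantumTrace hq (pbw q m) - centralTrace hq g ∈ orderLE ((N : ℤ) - 1) := by
      intro m hm
      by_cases hmN : latticeDeg (pbwVec m) = N
      · obtain ⟨n, hn3, hn⟩ := htop m hm hmN
        refine ⟨monomial n (a m * κ m / κ' n), ?_, ?_⟩
        · intro n' hn'
          have := support_monomial_subset hn'
          rw [Finset.mem_singleton] at this
          subst this
          refine ⟨hn3, ?_⟩
          have := latticeDeg_centralVec (piDegree q) n'
          rw [hn, hmN] at this
          omega
        · have e : monomial n (a m * κ m / κ' n) = (a m * κ m / κ' n) • monomial n (1 : ℂ) := by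
            rw [smul_monomial, smul_eq_mul, mul_one]
          have h1 := (hlead m).smul (a m)
          have h2 := (hlead' n).smul (a m * κ m / κ' n)
          rw [div_mul_cancel₀ _ (hκ' n), hn] at h2
          unfold HasLead at h1 h2
          rw [hmN] at h1 h2
          rw [e, map_smul]
          simpa using sub_mem h1 h2
      · refine ⟨0, by simp, ?_⟩
        rw [map_zero, sub_zero]
        refine Submodule.smul_mem _ _ (orderLE_mono ?_ (hlead m).mem_orderLE)
        have := hle m hm
        push_cast at this
        omega
    choose! g hg1 hg2 using hg
    obtain ⟨g', hg', hgc⟩ := ih (c - centralMap hq (∑ m ∈ a.support, g m)) (by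
      have : quantumTrace hq (Center.incl q (c - centralMap hq (∑ m ∈ a.support, g m)))
          = ∑ m ∈ a.support, (a m • quantumTrace hq (pbw q m) - centralTrace hq (g m)) := by
        rw [map_sub, map_sub, hsum, Finset.sum_sub_distrib, ← map_sum]
        rfl
      rw [this]
      exact sum_mem fun m hm => hg2 m hm)
    refine ⟨g' + ∑ m ∈ a.support, g m, ?_, by rw [map_add, hgc, sub_add_cancel]⟩
    intro n hn
    rcases Finset.mem_union.1 (support_add hn) with h | h
    · exact ⟨(hg' n h).1, (hg' n h).2.trans (Nat.lt_succ_self N)⟩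
    · obtain ⟨m, hm, hmn⟩ := Finset.mem_biUnion.1 (support_sum h)
      exact hg1 m hm n hmn

lemma exists_orderLE {q : ℂ} (hq : q ≠ 0) (a : SkeinAlgebra q) :
    ∃ N : ℕ, quantumTrace hq a ∈ orderLE ((N : ℤ) - 1) := by
  obtain ⟨c, rfl, -⟩ := exists_pbw_sum hq a
  refine ⟨c.support.sup (fun m => m.1 + m.2.1 + m.2.2) + 1, ?_⟩
  rw [map_finsuppSum]
  refine sum_mem fun m hm => ?_
  obtain ⟨κ, -, h⟩ := exists_hasLead_pbw hq m
  simp only [map_smul]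
  refine Submodule.smul_mem _ _ (orderLE_mono ?_ h.mem_orderLE)
  have := Finset.le_sup (f := fun m : ℕ × ℕ × ℕ => m.1 + m.2.1 + m.2.2) hm
  rw [latticeDeg_pbwVec]
  push_cast at this ⊢
  omega

lemma centralMap_surjective {q : ℂ} (hq : q ≠ 0) (hD : 0 < piDegree q) :
    Function.Surjective (centralMap hq) := fun c => by
  obtain ⟨N, hN⟩ := exists_orderLE hq (Center.incl q c)
  obtain ⟨g, -, h⟩ := exists_centralMap_eq hq hD N c hN
  exact ⟨g, h⟩

/-- The center is a hypersurface, with an equation whose part of top weight is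
`η ^ D - κ A₀ A₁ A_∞`. -/
lemma exists_center_equation {q : ℂ} (hq : q ≠ 0) (hD : 0 < piDegree q) :
    ∃ (κ : ℂ) (g : MvPolynomial (Fin 4) ℂ), κ ≠ 0 ∧ (∀ n ∈ g.support, n 3 < piDegree q ∧
        centralWeight (piDegree q) n < 3 * piDegree q) ∧
      RingHom.ker (centralMap hq)
        = Ideal.span {X 3 ^ piDegree q - MvPolynomial.C κ * (X 0 * X 1 * X 2) - g} := by
  set D := piDegree q
  obtain ⟨κ₁, h1, hl1⟩ := exists_hasLead_centralTrace hq hD (Finsupp.single 3 D)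
  obtain ⟨κ₂, h2, hl2⟩ := exists_hasLead_centralTrace hq hD
    (Finsupp.single 0 1 + Finsupp.single 1 1 + Finsupp.single 2 1)
  have e1 : (monomial (Finsupp.single 3 D) 1 : MvPolynomial (Fin 4) ℂ) = X 3 ^ D := by
    rw [X_pow_eq_monomial]
  have e2 : (monomial (Finsupp.single 0 1 + Finsupp.single 1 1 + Finsupp.single 2 1) 1 :
      MvPolynomial (Fin 4) ℂ) = X 0 * X 1 * X 2 := by
    simp [X, monomial_mul]
  have v1 : centralVec D (Finsupp.single 3 D) = ((D : ℤ), (D : ℤ), (D : ℤ)) := by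
    simp [centralVec]
  have v2 : centralVec D (Finsupp.single 0 1 + Finsupp.single 1 1 + Finsupp.single 2 1)
      = ((D : ℤ), (D : ℤ), (D : ℤ)) := by
    simp [centralVec]
  rw [e1, v1] at hl1
  rw [e2, v2] at hl2
  have hdeg : latticeDeg ((D : ℤ), (D : ℤ), (D : ℤ)) = ((3 * D : ℕ) : ℤ) := by
    simp only [latticeDeg]; push_cast; ring
  obtain ⟨g, hg, hgc⟩ := exists_centralMap_eq hq hD (3 * D)
    (centralMap hq (X 3 ^ D - MvPolynomial.C (κ₁ / κ₂) * (X 0 * X 1 * X 2))) (by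
      have h2' := hl2.smul (κ₁ / κ₂)
      rw [div_mul_cancel₀ _ h2] at h2'
      unfold HasLead at hl1 h2'
      rw [hdeg] at hl1 h2'
      have := sub_mem hl1 h2'
      rw [sub_sub_sub_cancel_right, ← map_smul, ← map_sub, MvPolynomial.smul_eq_C_mul] at this
      exact this)
  refine ⟨κ₁ / κ₂, g, div_ne_zero h1 h2, hg, ?_⟩
  set F : MvPolynomial (Fin 4) ℂ := X 3 ^ D - MvPolynomial.C (κ₁ / κ₂) * (X 0 * X 1 * X 2) - g
    with hF
  have hF0 : centralMap hq F = 0 := by rw [hF, map_sub, hgc, sub_self]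
  -- Division by `F`, which is monic in the last variable.
  set M : Submodule ℂ (MvPolynomial (Fin 4) ℂ) := restrictSupport ℂ {n | n 3 < D}
  have hM : ∀ p : MvPolynomial (Fin 4) ℂ, p ∈ M ↔ ∀ n ∈ p.support, n 3 < D := fun p =>
    Iff.rfl
  have hmono : ∀ (n : Fin 4 →₀ ℕ) (r : ℂ), n 3 < D → monomial n r ∈ M := fun n r hn => by
    rw [hM]
    intro n' hn'
    have := support_monomial_subset hn'
    rw [Finset.mem_singleton] at this
    rwa [this]
  have hdiv : ∀ p : MvPolynomial (Fin 4) ℂ,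
      p ∈ M ⊔ (Ideal.span {F}).restrictScalars ℂ := by
    have hspan : ∀ (k : ℕ) (n : Fin 4 →₀ ℕ), n 3 = k → ∀ r : ℂ,
        monomial n r ∈ M ⊔ (Ideal.span {F}).restrictScalars ℂ := by
      intro k
      induction k using Nat.strong_induction_on with
      | _ k ih =>
        intro n hn r
        by_cases hk : k < D
        · exact Submodule.mem_sup_left (hmono n r (by omega))
        · obtain ⟨n', rfl⟩ : ∃ n', n = n' + Finsupp.single 3 D :=
            ⟨n - Finsupp.single 3 D, by
              rw [tsub_add_cancel_of_le]
              rw [Finsupp.single_le_iff]; omega⟩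
          have hn' : n' 3 + D = k := by simpa using hn
          have e : monomial (n' + Finsupp.single 3 D) r = monomial n' r * F
              + (monomial (n' + (Finsupp.single 0 1 + Finsupp.single 1 1 + Finsupp.single 2 1))
                  (r * (κ₁ / κ₂)) + monomial n' r * g) := by
            have e3 : (monomial (n' + Finsupp.single 3 D) r : MvPolynomial (Fin 4) ℂ)
                = monomial n' r * X 3 ^ D := by rw [← e1, monomial_mul, mul_one]
            have e4 : (monomial (n' + (Finsupp.single 0 1 + Finsupp.single 1 1
                + Finsupp.single 2 1)) (r * (κ₁ / κ₂)) : MvPolynomial (Fin 4) ℂ)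
                = monomial n' r * (MvPolynomial.C (κ₁ / κ₂) * (X 0 * X 1 * X 2)) := by
              rw [← e2, C_mul_monomial, monomial_mul, mul_one]
            rw [e3, e4, hF]
            ring
          rw [e]
          refine add_mem (Submodule.mem_sup_right ?_) (add_mem ?_ ?_)
          · exact Ideal.mul_mem_left _ _ (Ideal.subset_span rfl)
          · exact ih (n' 3) (by omega) _ (by simp) _
          · rw [g.as_sum, Finset.mul_sum]
            refine sum_mem fun n'' hn'' => ?_
            rw [monomial_mul]
            have := (hg n'' hn'').1
            exact ih (n' 3 + n'' 3) (by omega) _ (by simp) _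
    intro p
    rw [p.as_sum]
    exact sum_mem fun n _ => hspan _ n rfl _
  refine le_antisymm (fun p hp => ?_) ?_
  · obtain ⟨g', hg', f, hf, rfl⟩ := Submodule.mem_sup.1 (hdiv p)
    have hf0 : centralMap hq f = 0 := by
      obtain ⟨c, rfl⟩ := Ideal.mem_span_singleton.1 hf
      rw [map_mul, hF0, zero_mul]
    have : g' = 0 := by
      refine eq_zero_of_centralMap_eq_zero hq hD ((hM g').1 hg') ?_
      have := (RingHom.mem_ker).1 hp
      rwa [map_add, hf0, add_zero] at this
    rw [this, zero_add]
    exact hf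
  · rw [Ideal.span_singleton_le_iff_mem]
    exact hF0

end

/-! ### The Jacobian criterion for a hypersurface -/

section

open MvPolynomial IsLocalRing

section Jacobian

variable {k : Type*} [Field k] {σ : Type*}

/-- The embedding dimension of a local ring is at least the dimension of the square-zero ideal of a
split square-zero quotient. -/
lemma card_le_spanFinrank [Fintype σ] {A : Type*} [CommRing A] [IsLocalRing A] [IsNoetherianRing A]
    (φ : A →+* TrivSqZeroExt k (σ → k)) (hφ : Function.Surjective φ) :
    Fintype.card σ ≤ (maximalIdeal A).spanFinrank := by
  set ψ : A →+* k := (TrivSqZeroExt.fstHom k k (σ → k)).toRingHom.comp φ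
  have hψ : ∀ a, ψ a = (φ a).fst := fun a => rfl
  have hψs : Function.Surjective ψ := fun c => by
    obtain ⟨a, ha⟩ := hφ (TrivSqZeroExt.inl c)
    exact ⟨a, by rw [hψ, ha, TrivSqZeroExt.fst_inl]⟩
  have hmax : RingHom.ker ψ = maximalIdeal A :=
    eq_maximalIdeal (RingHom.ker_isMaximal_of_surjective ψ hψs)
  have hfg : Submodule.FG (maximalIdeal A) := IsNoetherian.noetherian _
  have hfin := hfg.finite_generators
  rw [← hfg.generators_ncard]
  set s := (maximalIdeal A).generators
  have hs : Submodule.span A s = maximalIdeal A := Submodule.span_generators _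
  have hspan : Submodule.span k ((fun a => (φ a).snd) '' s) = ⊤ := by
    refine eq_top_iff.2 fun v _ => ?_
    obtain ⟨y, hy⟩ := hφ (TrivSqZeroExt.inr v)
    have hym : y ∈ maximalIdeal A := by
      rw [← hmax, RingHom.mem_ker, hψ, hy, TrivSqZeroExt.fst_inr]
    suffices h : ∀ a ∈ maximalIdeal A, (φ a).snd ∈ Submodule.span k ((fun a => (φ a).snd) '' s) by
      simpa [hy] using h y hym
    intro a ha
    rw [← hs] at ha
    induction ha using Submodule.span_induction with
    | mem a ha => exact Submodule.subset_span ⟨a, ha, rfl⟩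
    | zero => simp
    | add a b _ _ ha hb => rw [map_add, TrivSqZeroExt.snd_add]; exact add_mem ha hb
    | smul c a ha' ha =>
      have h0 : (φ a).fst = 0 := by
        rw [hs, ← hmax] at ha'
        exact ha'
      rw [smul_eq_mul, map_mul, TrivSqZeroExt.snd_mul, h0]
      simpa using Submodule.smul_mem _ _ ha
  have := (hfin.image fun a => (φ a).snd).fintype
  have h1 := finrank_span_le_card (R := k) ((fun a => (φ a).snd) '' s)
  rw [hspan, finrank_top, Module.finrank_fintype_fun_eq_card, ← Set.ncard_eq_toFinset_card'] at h1
  exact h1.trans (Set.ncard_image_le hfin)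

/-- A homomorphism to a local ring that reflects a point factors through the local ring there. -/
lemma exists_localization_lift {A : Type*} [CommRing A] (m : Ideal A) [m.IsPrime]
    (φ : A →+* TrivSqZeroExt k (σ → k)) (hφ : Function.Surjective φ)
    (hm : ∀ a, (φ a).fst = 0 → a ∈ m) :
    ∃ φ' : Localization.AtPrime m →+* TrivSqZeroExt k (σ → k), Function.Surjective φ' := by
  have hunit : ∀ y : m.primeCompl, IsUnit (φ y) := fun y => by
    rw [TrivSqZeroExt.isUnit_iff_isUnit_fst, isUnit_iff_ne_zero]
    exact fun h => y.2 (hm _ h)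
  refine ⟨IsLocalization.lift (M := m.primeCompl) hunit, fun t => ?_⟩
  obtain ⟨a, rfl⟩ := hφ t
  exact ⟨algebraMap A _ a, IsLocalization.lift_eq hunit a⟩

/-- A rational point, in coordinates. -/
lemma apply_eq_eval {Z : Type*} [CommRing Z] [Algebra k Z] (π : MvPolynomial σ k →ₐ[k] Z)
    (χ : Z →ₐ[k] k) (p : MvPolynomial σ k) : χ (π p) = eval (fun i => χ (π (X i))) p := by
  have : χ.comp π = aeval fun i => χ (π (X i)) := by
    ext i
    simp
  rw [← AlgHom.comp_apply, this]
  simp [aeval_eq_eval]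

variable [DecidableEq σ] [Fintype σ]

/-- First-order Taylor expansion modulo the square of the ideal of a point. -/
lemma sub_taylor_mem_sq (x : σ → k) (p : MvPolynomial σ k) :
    p - C (eval x p) - ∑ i, C (eval x (pderiv i p)) * (X i - C (x i))
      ∈ (Ideal.span (Set.range fun i => (X i - C (x i) : MvPolynomial σ k))) ^ 2 := by
  set I := Ideal.span (Set.range fun i => (X i - C (x i) : MvPolynomial σ k))
  have hX : ∀ i, (X i - C (x i) : MvPolynomial σ k) ∈ I := fun i => Ideal.subset_span ⟨i, rfl⟩
  induction p using MvPolynomial.induction_on with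
  | C a => simp
  | add p p' hp hp' =>
    convert! add_mem hp hp' using 1
    simp only [map_add, add_mul, Finset.sum_add_distrib]
    ring
  | mul_X p j hp =>
    have e : p * X j - C (eval x (p * X j))
        - ∑ i, C (eval x (pderiv i (p * X j))) * (X i - C (x i))
        = (p - C (eval x p) - ∑ i, C (eval x (pderiv i p)) * (X i - C (x i))) * X j
          + (∑ i, C (eval x (pderiv i p)) * (X i - C (x i))) * (X j - C (x j)) := by
      have : ∑ i, C (eval x (pderiv i (p * X j))) * (X i - C (x i))
          = (∑ i, C (eval x (pderiv i p)) * (X i - C (x i))) * C (x j)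
            + C (eval x p) * (X j - C (x j)) := by
        simp only [pderiv_mul, map_add, map_mul, eval_X, pderiv_X, add_mul, Finset.sum_add_distrib]
        congr 1
        · rw [Finset.sum_mul]
          exact Finset.sum_congr rfl fun i _ => by ring
        · rw [Finset.sum_eq_single j]
          · simp
          · intro i _ hij
            simp [hij.symm]
          · simp
      rw [this, map_mul, map_mul, eval_X]
      ring
    rw [e, pow_two]
    refine add_mem (Ideal.mul_mem_right _ _ (pow_two I ▸ hp)) (Ideal.mul_mem_mul ?_ (hX j))
    exact sum_mem fun i _ => Ideal.mul_mem_left _ _ (hX i)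

lemma ker_eval_eq_span (x : σ → k) : RingHom.ker (eval x)
    = Ideal.span (Set.range fun i => (X i - C (x i) : MvPolynomial σ k)) := by
  refine le_antisymm (fun p hp => ?_) ?_
  · have h1 := Ideal.pow_le_self two_ne_zero (sub_taylor_mem_sq x p)
    have h2 : ∑ i, C (eval x (pderiv i p)) * (X i - C (x i)) ∈
        Ideal.span (Set.range fun i => (X i - C (x i) : MvPolynomial σ k)) :=
      sum_mem fun i _ => Ideal.mul_mem_left _ _ (Ideal.subset_span ⟨i, rfl⟩)
    have := add_mem h1 h2
    rwa [sub_add_cancel, (RingHom.mem_ker).1 hp, map_zero, sub_zero] at this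
  · rw [Ideal.span_le]
    rintro _ ⟨i, rfl⟩
    simp [RingHom.mem_ker]

/-- The first-order neighbourhood of a rational point of affine space. -/
def jetMap (x : σ → k) : MvPolynomial σ k →ₐ[k] TrivSqZeroExt k (σ → k) :=
  aeval fun i => TrivSqZeroExt.inl (x i) + TrivSqZeroExt.inr (Pi.single i 1)

lemma jetMap_apply (x : σ → k) (p : MvPolynomial σ k) :
    jetMap x p = TrivSqZeroExt.inl (eval x p)
      + TrivSqZeroExt.inr (fun i => eval x (pderiv i p)) := by
  have hC : ∀ a : k, jetMap x (C a) = TrivSqZeroExt.inl a := fun a => by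
    rw [jetMap, algHom_C]; rfl
  have hX : ∀ i, jetMap x (X i - C (x i)) = TrivSqZeroExt.inr (Pi.single i 1) := fun i => by
    rw [map_sub, hC, jetMap, aeval_X, add_sub_cancel_left]
  have hsq : jetMap x (p - C (eval x p) - ∑ i, C (eval x (pderiv i p)) * (X i - C (x i))) = 0 := by
    have hle : (Ideal.span (Set.range fun i => (X i - C (x i) : MvPolynomial σ k))) ^ 2
        ≤ RingHom.ker (jetMap x) := by
      rw [pow_two, Ideal.span_mul_span', Ideal.span_le]
      rintro _ ⟨_, ⟨i, rfl⟩, _, ⟨j, rfl⟩, rfl⟩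
      simp only [SetLike.mem_coe, RingHom.mem_ker, map_mul, hX, TrivSqZeroExt.inr_mul_inr]
    exact hle (sub_taylor_mem_sq x p)
  rw [map_sub, map_sub, hC, sub_sub, sub_eq_zero] at hsq
  rw [hsq, map_sum]
  congr 1
  simp only [map_mul, hC, hX, TrivSqZeroExt.inl_mul_inr]
  ext i
  · simp [TrivSqZeroExt.fst_sum]
  · simp [TrivSqZeroExt.snd_sum, Pi.single_apply]

lemma jetMap_surjective (x : σ → k) : Function.Surjective (jetMap x) := by
  intro t
  refine ⟨C t.fst + ∑ i, C (t.snd i) * (X i - C (x i)), ?_⟩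
  rw [jetMap_apply]
  ext i
  · simp
  · simp [pderiv_X, Pi.single_apply]

/-- The local ring of affine space at a rational point has the dimension of the space. -/
lemma ringKrullDim_localization_ker_eval (x : σ → k) [(RingHom.ker (eval x)).IsPrime] :
    ringKrullDim (Localization.AtPrime (RingHom.ker (eval x))) = (Fintype.card σ : ℕ) := by
  rw [← IsRegularLocalRing.spanFinrank_maximalIdeal]
  congr 1
  refine le_antisymm ?_ ?_
  · rw [← Localization.AtPrime.map_eq_maximalIdeal]
    have : (RingHom.ker (eval x)).map
        (algebraMap _ (Localization.AtPrime (RingHom.ker (eval x))))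
        = Ideal.span (algebraMap _ (Localization.AtPrime (RingHom.ker (eval x))) ''
          (Set.range fun i => (X i - C (x i) : MvPolynomial σ k))) := by
      conv_lhs => arg 2; rw [ker_eval_eq_span x]
      rw [Ideal.map_span]
    rw [this]
    refine (Submodule.spanFinrank_span_le_ncard_of_finite (Set.toFinite _)).trans ?_
    refine (Set.ncard_image_le (Set.toFinite _)).trans ?_
    rw [← Set.image_univ]
    refine (Set.ncard_image_le (Set.toFinite _)).trans ?_
    rw [Set.ncard_univ, Nat.card_eq_fintype_card]
  · obtain ⟨φ, hφ⟩ := exists_localization_lift (RingHom.ker (eval x)) (jetMap x).toRingHom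
      (jetMap_surjective x) (fun a ha => by
        have : jetMap x a = _ := jetMap_apply x a
        have ha : (jetMap x a).fst = 0 := ha
        rw [this] at ha
        simpa [RingHom.mem_ker] using ha)
    exact card_le_spanFinrank φ hφ

variable {Z : Type*} [CommRing Z] [Algebra k Z]

lemma ringKrullDim_localization_hypersurface {π : MvPolynomial σ k →ₐ[k] Z}
    (hπ : Function.Surjective π) {F : MvPolynomial σ k} (hF : F ≠ 0)
    (hker : RingHom.ker π = Ideal.span {F}) (χ : Z →ₐ[k] k) [(RingHom.ker χ).IsPrime] :
    ringKrullDim (Localization.AtPrime (RingHom.ker χ)) + 1 = (Fintype.card σ : ℕ) := by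
  have hχ := apply_eq_eval π χ
  set x : σ → k := fun i => χ (π (X i))
  set M := RingHom.ker (eval x)
  have hMp : M.IsPrime := RingHom.ker_isPrime _
  have hT : Submonoid.map π.toRingHom M.primeCompl = (RingHom.ker χ).primeCompl := by
    ext z
    constructor
    · rintro ⟨p, hp, rfl⟩
      intro h
      exact hp ((RingHom.mem_ker).2 ((hχ p).symm.trans h))
    · intro hz
      obtain ⟨p, rfl⟩ := hπ z
      exact ⟨p, fun h => hz ((RingHom.mem_ker).2 ((hχ p).trans h)), rfl⟩
  have : IsLocalization (Submonoid.map π.toRingHom M.primeCompl)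
      (Localization.AtPrime (RingHom.ker χ)) := by
    rw [hT]; infer_instance
  have hsurj := IsLocalization.map_surjective_of_surjective M.primeCompl
    (Localization.AtPrime M) (Localization.AtPrime (RingHom.ker χ))
    (show Function.Surjective π.toRingHom from hπ)
  have hk := IsLocalization.ker_map (S := Localization.AtPrime M)
    (Localization.AtPrime (RingHom.ker χ)) π.toRingHom hT
  have hk' : RingHom.ker π.toRingHom = Ideal.span {F} := hker
  rw [hk', Ideal.map_span, Set.image_singleton] at hk
  have hequiv := (Ideal.quotEquivOfEq hk.symm).trans (RingHom.quotientKerEquivOfSurjective hsurj)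
  have hd : ringKrullDim (Localization.AtPrime M ⧸
      Ideal.span {algebraMap _ (Localization.AtPrime M) F})
      = ringKrullDim (Localization.AtPrime (RingHom.ker χ)) := ringKrullDim_eq_of_ringEquiv hequiv
  rw [← ringKrullDim_localization_ker_eval x, ← hd]
  refine ringKrullDim_quotient_span_singleton_succ_eq_ringKrullDim_of_mem_nonZeroDivisors ?_ ?_
  · refine mem_nonZeroDivisors_of_ne_zero fun h => hF ?_
    exact IsLocalization.injective _ M.primeCompl_le_nonZeroDivisors (h.trans (map_zero _).symm)
  · rw [← Localization.AtPrime.map_eq_maximalIdeal]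
    refine Ideal.mem_map_of_mem _ ?_
    have : π F = 0 := (RingHom.mem_ker).1 (hker ▸ Ideal.subset_span rfl)
    rw [RingHom.mem_ker, ← hχ, this, map_zero]

/-- **Jacobian criterion**: a rational point of a hypersurface is regular if and only if some partial
derivative of the equation does not vanish there. -/
theorem isRegularLocalRing_hypersurface_iff {π : MvPolynomial σ k →ₐ[k] Z}
    (hπ : Function.Surjective π) {F : MvPolynomial σ k} (hF : F ≠ 0)
    (hker : RingHom.ker π = Ideal.span {F}) (χ : Z →ₐ[k] k) [(RingHom.ker χ).IsPrime] :
    IsRegularLocalRing (Localization.AtPrime (RingHom.ker χ)) ↔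
      ∃ i, eval (fun i => χ (π (X i))) (pderiv i F) ≠ 0 := by
  have hdim := ringKrullDim_localization_hypersurface hπ hF hker χ
  have hχ := apply_eq_eval π χ
  have hπF : π F = 0 := (RingHom.mem_ker).1 (hker ▸ Ideal.subset_span rfl)
  set x : σ → k := fun i => χ (π (X i)) with hx
  have hFx : eval x F = 0 := by rw [← hχ, hπF, map_zero]
  have : IsNoetherianRing Z := isNoetherianRing_of_surjective _ _ π.toRingHom hπ
  have : IsNoetherianRing (Localization.AtPrime (RingHom.ker χ)) :=
    IsLocalization.isNoetherianRing (RingHom.ker χ).primeCompl _ inferInstance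
  set R := Localization.AtPrime (RingHom.ker χ)
  constructor
  · intro hreg
    by_contra! hall
    -- The first-order neighbourhood of the point in affine space lies on the hypersurface, so that
    -- the embedding dimension exceeds the dimension.
    have hjet : jetMap x F = 0 := by
      rw [jetMap_apply, hFx]
      simp only [hall]
      ext <;> simp
    have hle : RingHom.ker π.toRingHom ≤ RingHom.ker (jetMap x).toRingHom := by
      have hk' : RingHom.ker π.toRingHom = Ideal.span {F} := hker
      rw [hk', Ideal.span_singleton_le_iff_mem]
      exact hjet
    set φ : Z →+* TrivSqZeroExt k (σ → k) :=
      RingHom.liftOfSurjective π.toRingHom hπ ⟨(jetMap x).toRingHom, hle⟩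
    have hφ : ∀ p, φ (π p) = jetMap x p := fun p =>
      RingHom.liftOfRightInverse_comp_apply π.toRingHom _ _ ⟨(jetMap x).toRingHom, hle⟩ p
    obtain ⟨φ', hφ'⟩ := exists_localization_lift (RingHom.ker χ) φ
      (fun t => by
        obtain ⟨p, rfl⟩ := jetMap_surjective x t
        exact ⟨π p, hφ p⟩)
      (fun a ha => by
        obtain ⟨p, rfl⟩ := hπ a
        rw [hφ, jetMap_apply] at ha
        rw [RingHom.mem_ker, hχ]
        simpa using ha)
    have h1 : Fintype.card σ ≤ (maximalIdeal R).spanFinrank := card_le_spanFinrank φ' hφ'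
    rw [← hreg.spanFinrank_maximalIdeal] at hdim
    have h2 : (maximalIdeal R).spanFinrank + 1 = Fintype.card σ := by exact_mod_cast hdim
    omega
  · rintro ⟨j, hj⟩
    refine IsRegularLocalRing.of_spanFinrank_maximalIdeal_le R ?_
    -- By Nakayama, the maximal ideal is generated by all coordinates but the `j`-th.
    set y : σ → R := fun i => algebraMap Z R (π (X i - C (x i)))
    have hspan : maximalIdeal R = Ideal.span (Set.range y) := by
      have h1 : RingHom.ker χ = (RingHom.ker (eval x)).map π.toRingHom := by
        refine le_antisymm (fun z hz => ?_) (Ideal.map_le_iff_le_comap.2 fun p hp => ?_)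
        · obtain ⟨p, rfl⟩ := hπ z
          exact Ideal.mem_map_of_mem π.toRingHom ((RingHom.mem_ker).2 ((hχ p).symm.trans hz))
        · exact (RingHom.mem_ker).2 ((hχ p).trans hp)
      rw [← Localization.AtPrime.map_eq_maximalIdeal]
      have h2 : (RingHom.ker χ).map (algebraMap Z R)
          = ((RingHom.ker (eval x)).map π.toRingHom).map (algebraMap Z R) := by rw [← h1]
      rw [h2, Ideal.map_map, ker_eval_eq_span, Ideal.map_span, ← Set.range_comp]
      rfl
    have hym : ∀ i, y i ∈ maximalIdeal R := fun i => hspan ▸ Ideal.subset_span ⟨i, rfl⟩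
    set N : Ideal R := Ideal.span (y '' {i | i ≠ j})
    have hyj : y j ∈ N ⊔ maximalIdeal R • maximalIdeal R := by
      have ht : ∑ i, algebraMap k R (eval x (pderiv i F)) * y i
          ∈ maximalIdeal R • maximalIdeal R := by
        have h1 := Ideal.mem_map_of_mem ((algebraMap Z R).comp π.toRingHom)
          (sub_taylor_mem_sq x F)
        rw [Ideal.map_pow, Ideal.map_span, ← Set.range_comp] at h1
        have h2 : (Ideal.span (Set.range (((algebraMap Z R).comp π.toRingHom) ∘
          fun i => (X i - C (x i) : MvPolynomial σ k)))) = maximalIdeal R := hspan.symm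
        rw [h2, hFx, map_zero, sub_zero, map_sub, map_sum, pow_two] at h1
        have h3 : ((algebraMap Z R).comp π.toRingHom) F = 0 := by
          simp [hπF]
        rw [h3, zero_sub, neg_mem_iff] at h1
        convert! h1 using 1
        refine Finset.sum_congr rfl fun i _ => ?_
        rw [map_mul]
        congr 1
        simp only [RingHom.comp_apply, AlgHom.toRingHom_eq_coe, RingHom.coe_coe, algHom_C]
        exact IsScalarTower.algebraMap_apply k Z R _
      rw [← Finset.add_sum_erase _ _ (Finset.mem_univ j)] at ht
      have hs : ∑ i ∈ Finset.univ.erase j, algebraMap k R (eval x (pderiv i F)) * y i ∈ N :=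
        sum_mem fun i hi => Ideal.mul_mem_left _ _
          (Ideal.subset_span ⟨i, Finset.ne_of_mem_erase hi, rfl⟩)
      have h4 := sub_mem (Submodule.mem_sup_right (S := N) ht)
        (Submodule.mem_sup_left (T := maximalIdeal R • maximalIdeal R) hs)
      rw [add_sub_cancel_right] at h4
      have h5 := Ideal.mul_mem_left _ (algebraMap k R (eval x (pderiv j F))⁻¹) h4
      rwa [← mul_assoc, ← map_mul, inv_mul_cancel₀ hj, map_one, one_mul] at h5
    have hle : maximalIdeal R ≤ N := by
      refine Submodule.le_of_le_smul_of_le_jacobson_bot (I := maximalIdeal R)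
        (IsNoetherian.noetherian _) (maximalIdeal_le_jacobson _) ?_
      conv_lhs => rw [hspan]
      rw [Ideal.span_le]
      rintro _ ⟨i, rfl⟩
      by_cases hij : i = j
      · exact hij ▸ hyj
      · exact Submodule.mem_sup_left (Ideal.subset_span ⟨i, hij, rfl⟩)
    have hN : maximalIdeal R = N := le_antisymm hle <| by
      rw [Ideal.span_le]
      rintro _ ⟨i, -, rfl⟩
      exact hym i
    have hcard : (maximalIdeal R).spanFinrank + 1 ≤ Fintype.card σ := by
      rw [hN]
      have h1 := (Submodule.spanFinrank_span_le_ncard_of_finite (R := R)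
        (Set.toFinite (y '' {i | i ≠ j}))).trans (Set.ncard_image_le (Set.toFinite _))
      have h2 : ({i | i ≠ j} : Set σ).ncard + 1 = Fintype.card σ := by
        have : ({i | i ≠ j} : Set σ) = {j}ᶜ := rfl
        rw [this, ← Set.ncard_singleton j, add_comm, Set.ncard_add_ncard_compl,
          Nat.card_eq_fintype_card]
      exact h2 ▸ Nat.add_le_add_right h1 1
    obtain ⟨n, hn⟩ : ∃ n, Fintype.card σ = n + 1 := ⟨Fintype.card σ - 1, by omega⟩
    rw [hn] at hdim hcard
    push_cast at hdim
    rw [ENat.WithBot.add_one_cancel] at hdim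
    rw [hdim]
    exact_mod_cast Nat.le_of_succ_le_succ hcard

end Jacobian

end

/-! ### Type-0 actions -/

/-- The numbers `q ^ (2 i) σ`, which parametrize the eigenvalues of `α₀`. -/
def toralPt (q σ : ℂ) (i : ZMod (piDegree q)) : ℂ := q ^ (2 * (i.val : ℤ)) * σ

lemma toralPt_add_one {q : ℂ} (hD : 0 < piDegree q) (σ : ℂ) (i : ZMod (piDegree q)) :
    toralPt q σ (i + 1) = q ^ 2 * toralPt q σ i := by
  have : NeZero (piDegree q) := ⟨hD.ne'⟩
  have hper : (q ^ 2) ^ piDegree q = 1 := pow_orderOf_eq_one _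
  have hnat : ∀ j : ZMod (piDegree q), toralPt q σ j = (q ^ 2) ^ j.val * σ := fun j => by
    rw [toralPt, zpow_mul, zpow_natCast]; rfl
  have hv : (i + 1).val ≡ i.val + 1 [MOD piDegree q] := by
    rw [← ZMod.natCast_eq_natCast_iff]; simp
  rw [hnat, hnat, ← mul_assoc, ← pow_succ', pow_eq_pow_of_modEq hv hper]

lemma toralPt_sub_one {q : ℂ} (hq : q ≠ 0) (hD : 0 < piDegree q) (σ : ℂ) (i : ZMod (piDegree q)) :
    toralPt q σ (i - 1) = (q ^ 2)⁻¹ * toralPt q σ i := by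
  have := toralPt_add_one hD σ (i - 1)
  rw [sub_add_cancel] at this
  rw [this, inv_mul_cancel_left₀ (pow_ne_zero 2 hq)]

lemma toralPt_ne_zero {q σ : ℂ} (hq : q ≠ 0) (hσ : σ ≠ 0) (i : ZMod (piDegree q)) :
    toralPt q σ i ≠ 0 := mul_ne_zero (zpow_ne_zero _ hq) hσ

lemma toralPt_pow (q σ : ℂ) (i : ZMod (piDegree q)) :
    toralPt q σ i ^ piDegree q = σ ^ piDegree q := by
  have hper : (q ^ 2) ^ piDegree q = 1 := pow_orderOf_eq_one _
  rw [toralPt, zpow_mul, zpow_natCast, mul_pow, ← pow_mul, mul_comm i.val, pow_mul]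
  rw [show (q ^ (2 : ℤ)) = q ^ 2 from rfl, hper, one_pow, one_mul]

lemma toralPt_injective {q σ : ℂ} (hD : 0 < piDegree q) (hσ : σ ≠ 0) :
    Function.Injective (toralPt q σ) := by
  have : NeZero (piDegree q) := ⟨hD.ne'⟩
  intro i j hij
  have hnat : ∀ j : ZMod (piDegree q), toralPt q σ j = (q ^ 2) ^ j.val * σ := fun j => by
    rw [toralPt, zpow_mul, zpow_natCast]; rfl
  rw [hnat, hnat] at hij
  have := pow_injOn_Iio_orderOf (x := q ^ 2) (ZMod.val_lt i) (ZMod.val_lt j)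
    (mul_right_cancel₀ hσ hij)
  exact ZMod.val_injective _ this

lemma lam_eq (q σ : ℂ) (i : ZMod (piDegree q)) :
    lam q σ i = toralPt q σ i + (toralPt q σ i)⁻¹ := by
  rw [lam, toralPt, mul_inv, ← zpow_neg, neg_mul]

lemma lamHat_eq (q σ : ℂ) (i : ZMod (piDegree q)) :
    lamHat q σ i = toralPt q σ i - (toralPt q σ i)⁻¹ := by
  rw [lamHat, toralPt, mul_inv, ← zpow_neg, neg_mul]

/-- The numerator of `r_i`. -/
def rNum (q σ w : ℂ) (i : ZMod (piDegree q)) : ℂ :=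
  w + q ^ 2 * toralPt q σ i ^ 2 + (q ^ 2)⁻¹ * (toralPt q σ i ^ 2)⁻¹

lemma rCoeff_eq {q : ℂ} (hq : q ≠ 0) (σ w : ℂ) (i : ZMod (piDegree q)) :
    rCoeff q σ w i = rNum q σ w i / (lamHat q σ i * lamHat q σ (i + 1)) := by
  rw [rCoeff, rNum, toralPt]
  congr 2
  · congr 1
    rw [zpow_add₀ hq, mul_pow, ← zpow_natCast (q ^ (2 * (i.val : ℤ))), ← zpow_mul]
    rw [show 2 * (i.val : ℤ) * ((2 : ℕ) : ℤ) = 4 * i.val by push_cast; ring]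
    rw [show q ^ (2 : ℤ) = q ^ 2 from rfl]; ring
  · rw [show -4 * (i.val : ℤ) - 2 = -(4 * (i.val : ℤ) + 2) by ring, zpow_neg, zpow_add₀ hq, mul_pow,
      ← zpow_natCast (q ^ (2 * (i.val : ℤ))), ← zpow_mul]
    rw [show 2 * (i.val : ℤ) * ((2 : ℕ) : ℤ) = 4 * i.val by push_cast; ring]
    rw [show q ^ (2 : ℤ) = q ^ 2 from rfl, mul_inv, mul_inv, inv_pow]; ring

/-- Operators attached to the three curves that act on a family of vectors by the type-0 formulas. -/
structure TypeZeroAction {q : ℂ} {V : Type*} [AddCommGroup V] [Module ℂ V]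
    (A : Slope → Module.End ℂ V) (v : ZMod (piDegree q) → V) (σ w : ℂ)
    (s t : ZMod (piDegree q) → ℂ) : Prop where
  ne_zero : σ ≠ 0
  hat_ne_zero : ∀ i, lamHat q σ i ≠ 0
  mul_eq : ∀ i, s i * t i = rCoeff q σ w i
  zero_apply : ∀ i, A .zero (v i) = (toralPt q σ i + (toralPt q σ i)⁻¹) • v i
  one_apply : ∀ i, A .one (v i) = (q * toralPt q σ i * s i) • v (i + 1)
    + (q * (toralPt q σ i)⁻¹ * t (i - 1)) • v (i - 1)
  infty_apply : ∀ i, A .infty (v i) = s i • v (i + 1) + t (i - 1) • v (i - 1)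

namespace TypeZeroAction

variable {q : ℂ} {V : Type*} [AddCommGroup V] [Module ℂ V] {A : Slope → Module.End ℂ V}
  {v : ZMod (piDegree q) → V} {σ w : ℂ} {s t : ZMod (piDegree q) → ℂ}

lemma hat_eq (h : TypeZeroAction A v σ w s t) (i : ZMod (piDegree q)) :
    toralPt q σ i ^ 2 - 1 ≠ 0 := by
  have h1 := h.hat_ne_zero i
  rw [lamHat_eq] at h1
  intro h2
  apply h1
  have : toralPt q σ i ≠ 0 := by
    intro h0; rw [h0] at h2; norm_num at h2
  field_simp
  rw [h2, mul_zero]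

lemma hat_eq_next (h : TypeZeroAction A v σ w s t) (hD : 0 < piDegree q) (i : ZMod (piDegree q)) :
    q ^ 4 * toralPt q σ i ^ 2 - 1 ≠ 0 := by
  have := h.hat_eq (i + 1)
  rw [toralPt_add_one hD] at this
  convert! this using 1; ring

lemma hat_eq_prev (h : TypeZeroAction A v σ w s t) (hq : q ≠ 0) (hD : 0 < piDegree q)
    (i : ZMod (piDegree q)) : toralPt q σ i ^ 2 - q ^ 4 ≠ 0 := by
  have := h.hat_eq (i - 1)
  rw [toralPt_sub_one hq hD] at this
  contrapose this
  field_simp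
  linear_combination this

lemma mul_eq_div (h : TypeZeroAction A v σ w s t) (hq : q ≠ 0) (hD : 0 < piDegree q)
    (i : ZMod (piDegree q)) : s i * t i
      = (w * q ^ 2 * toralPt q σ i ^ 2 + q ^ 4 * toralPt q σ i ^ 4 + 1)
        / ((toralPt q σ i ^ 2 - 1) * (q ^ 4 * toralPt q σ i ^ 2 - 1)) := by
  have hX := toralPt_ne_zero hq h.ne_zero i
  have h1 := h.hat_eq i
  have h2 := h.hat_eq_next hD i
  rw [h.mul_eq, rCoeff_eq hq, lamHat_eq, lamHat_eq, toralPt_add_one hD, rNum]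
  have e1 : toralPt q σ i - (toralPt q σ i)⁻¹ = (toralPt q σ i ^ 2 - 1) / toralPt q σ i := by
    field_simp
  have e2 : q ^ 2 * toralPt q σ i - (q ^ 2 * toralPt q σ i)⁻¹
      = (q ^ 4 * toralPt q σ i ^ 2 - 1) / (q ^ 2 * toralPt q σ i) := by
    field_simp
  rw [e1, e2]
  field_simp

lemma mul_eq_div_prev (h : TypeZeroAction A v σ w s t) (hq : q ≠ 0) (hD : 0 < piDegree q)
    (i : ZMod (piDegree q)) : s (i - 1) * t (i - 1)
      = (w * q ^ 2 * toralPt q σ i ^ 2 + toralPt q σ i ^ 4 + q ^ 4)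
        / ((toralPt q σ i ^ 2 - q ^ 4) * (toralPt q σ i ^ 2 - 1)) := by
  have h1 := h.hat_eq i
  have h2 := h.hat_eq_prev hq hD i
  have h3 := h.mul_eq_div hq hD (i - 1)
  rw [toralPt_sub_one hq hD] at h3
  rw [h3]
  have e1 : ((q ^ 2)⁻¹ * toralPt q σ i) ^ 2 - 1 = (toralPt q σ i ^ 2 - q ^ 4) / q ^ 4 := by
    field_simp
  have e2 : q ^ 4 * ((q ^ 2)⁻¹ * toralPt q σ i) ^ 2 - 1 = toralPt q σ i ^ 2 - 1 := by
    field_simp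
  rw [e1, e2]
  field_simp

lemma rel_one (h : TypeZeroAction A v σ w s t) (hq : q ≠ 0) (hD : 0 < piDegree q)
    (i : ZMod (piDegree q)) :
    (q • (A .zero * A .infty) - q⁻¹ • (A .infty * A .zero)) (v i)
      = ((q ^ 2 - (q⁻¹) ^ 2) • A .one) (v i) := by
  have hX := toralPt_ne_zero hq h.ne_zero i
  simp only [LinearMap.sub_apply, LinearMap.smul_apply, Module.End.mul_apply, h.infty_apply,
    h.zero_apply, h.one_apply, map_add, map_smul, toralPt_add_one hD, toralPt_sub_one hq hD]
  match_scalars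
  · field_simp; ring
  · field_simp; ring

lemma rel_infty (h : TypeZeroAction A v σ w s t) (hq : q ≠ 0) (hD : 0 < piDegree q)
    (i : ZMod (piDegree q)) :
    (q • (A .one * A .zero) - q⁻¹ • (A .zero * A .one)) (v i)
      = ((q ^ 2 - (q⁻¹) ^ 2) • A .infty) (v i) := by
  have hX := toralPt_ne_zero hq h.ne_zero i
  simp only [LinearMap.sub_apply, LinearMap.smul_apply, Module.End.mul_apply, h.infty_apply,
    h.zero_apply, h.one_apply, map_add, map_smul, toralPt_add_one hD, toralPt_sub_one hq hD]
  match_scalars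
  · field_simp; ring
  · field_simp; ring

lemma rel_zero (h : TypeZeroAction A v σ w s t) (hq : q ≠ 0) (hD : 0 < piDegree q)
    (i : ZMod (piDegree q)) :
    (q • (A .infty * A .one) - q⁻¹ • (A .one * A .infty)) (v i)
      = ((q ^ 2 - (q⁻¹) ^ 2) • A .zero) (v i) := by
  have hX := toralPt_ne_zero hq h.ne_zero i
  have h1 := h.mul_eq_div hq hD i
  have h2 := h.mul_eq_div_prev hq hD i
  have h3 := h.hat_eq i
  have h4 := h.hat_eq_next hD i
  have h5 := h.hat_eq_prev hq hD i
  simp only [LinearMap.sub_apply, LinearMap.smul_apply, Module.End.mul_apply, h.infty_apply,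
    h.zero_apply, h.one_apply, map_add, map_smul, toralPt_add_one hD, toralPt_sub_one hq hD,
    add_sub_cancel_right, sub_add_cancel]
  generalize toralPt q σ i = x at *
  match_scalars
  · field_simp; ring
  · have e : q ^ 2 * x - (q ^ 2 * x)⁻¹ = (q ^ 4 * x ^ 2 - 1) / (q ^ 2 * x) := by field_simp
    have e' : ((q ^ 2)⁻¹ * x)⁻¹ - (q ^ 2)⁻¹ * x = -((x ^ 2 - q ^ 4) / (q ^ 2 * x)) := by
      field_simp; ring
    have e3 : (w * q ^ 2 * x ^ 2 + q ^ 4 * x ^ 4 + 1) / ((x ^ 2 - 1) * (q ^ 4 * x ^ 2 - 1))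
          * ((q ^ 4 * x ^ 2 - 1) / (q ^ 2 * x))
        - (w * q ^ 2 * x ^ 2 + x ^ 4 + q ^ 4) / ((x ^ 2 - q ^ 4) * (x ^ 2 - 1))
          * ((x ^ 2 - q ^ 4) / (q ^ 2 * x)) = (q ^ 2 - (q⁻¹) ^ 2) * (x + x⁻¹) := by
      field_simp; ring
    rw [← h1, ← h2, ← neg_neg ((x ^ 2 - q ^ 4) / (q ^ 2 * x)), ← e, ← e'] at e3
    trans s i * t i * (q ^ 2 * x - (q ^ 2 * x)⁻¹)
        - s (i - 1) * t (i - 1) * -(((q ^ 2)⁻¹ * x)⁻¹ - (q ^ 2)⁻¹ * x)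
    · field_simp; ring
    · rw [e3]; field_simp
  · field_simp; ring

/-- The loop around the puncture acts by the scalar `w`. -/
lemma boundary_apply (h : TypeZeroAction A v σ w s t) (hq : q ≠ 0) (hD : 0 < piDegree q)
    (i : ZMod (piDegree q)) :
    (q⁻¹ • (A .zero * A .one * A .infty) - (q⁻¹) ^ 2 • (A .zero * A .zero)
      - q ^ 2 • (A .one * A .one) - (q⁻¹) ^ 2 • (A .infty * A .infty)
      + algebraMap ℂ _ (q ^ 2 + (q⁻¹) ^ 2)) (v i) = w • v i := by
  have hX := toralPt_ne_zero hq h.ne_zero i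
  have h1 := h.mul_eq_div hq hD i
  have h2 := h.mul_eq_div_prev hq hD i
  have h3 := h.hat_eq i
  have h4 := h.hat_eq_next hD i
  have h5 := h.hat_eq_prev hq hD i
  simp only [LinearMap.sub_apply, LinearMap.add_apply, LinearMap.smul_apply, Module.End.mul_apply,
    Module.algebraMap_end_apply, h.infty_apply,
    h.zero_apply, h.one_apply, map_add, map_smul, toralPt_add_one hD, toralPt_sub_one hq hD,
    add_sub_cancel_right, sub_add_cancel]
  generalize toralPt q σ i = x at *
  match_scalars
  · field_simp; ring
  · have e : (q⁻¹) ^ 2 * (x⁻¹) ^ 2 - q ^ 2 = -((q ^ 4 * x ^ 2 - 1) / (q ^ 2 * x ^ 2)) := by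
      field_simp; ring
    have e' : (q⁻¹) ^ 2 * x ^ 2 - q ^ 2 = (x ^ 2 - q ^ 4) / q ^ 2 := by field_simp
    have e3 : (w * q ^ 2 * x ^ 2 + q ^ 4 * x ^ 4 + 1) / ((x ^ 2 - 1) * (q ^ 4 * x ^ 2 - 1))
          * -((q ^ 4 * x ^ 2 - 1) / (q ^ 2 * x ^ 2))
        + (w * q ^ 2 * x ^ 2 + x ^ 4 + q ^ 4) / ((x ^ 2 - q ^ 4) * (x ^ 2 - 1))
          * ((x ^ 2 - q ^ 4) / q ^ 2)
        - (q⁻¹) ^ 2 * (x + x⁻¹) ^ 2 + (q ^ 2 + (q⁻¹) ^ 2) = w := by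
      field_simp; ring
    rw [← h1, ← h2, ← e, ← e'] at e3
    trans s i * t i * ((q⁻¹) ^ 2 * (x⁻¹) ^ 2 - q ^ 2)
        + s (i - 1) * t (i - 1) * ((q⁻¹) ^ 2 * x ^ 2 - q ^ 2)
        - (q⁻¹) ^ 2 * (x + x⁻¹) ^ 2 + (q ^ 2 + (q⁻¹) ^ 2)
    · field_simp; ring
    · rw [e3, mul_one]
  · field_simp; ring

end TypeZeroAction

/-! ### Chebyshev polynomials of periodic Jacobi operators -/

lemma chebyshev_apply_add_two {V : Type*} [AddCommGroup V] [Module ℂ V] (L : Module.End ℂ V)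
    (k : ℕ) (u : V) :
    Polynomial.aeval L (Polynomial.Chebyshev.C ℂ ((k + 2 : ℕ) : ℤ)) u
      = L (Polynomial.aeval L (Polynomial.Chebyshev.C ℂ ((k + 1 : ℕ) : ℤ)) u)
        - Polynomial.aeval L (Polynomial.Chebyshev.C ℂ (k : ℤ)) u := by
  push_cast
  rw [Polynomial.Chebyshev.C_add_two, map_sub, map_mul, Polynomial.aeval_X]
  rfl

lemma chebyshev_apply_zero {V : Type*} [AddCommGroup V] [Module ℂ V] (L : Module.End ℂ V) (u : V) :
    Polynomial.aeval L (Polynomial.Chebyshev.C ℂ ((0 : ℕ) : ℤ)) u = (2 : ℂ) • u := by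
  rw [Nat.cast_zero, Polynomial.Chebyshev.C_zero, map_ofNat, ← one_add_one_eq_two, two_smul]
  rfl

lemma chebyshev_apply_one {V : Type*} [AddCommGroup V] [Module ℂ V] (L : Module.End ℂ V) (u : V) :
    Polynomial.aeval L (Polynomial.Chebyshev.C ℂ ((1 : ℕ) : ℤ)) u = L u := by
  rw [Nat.cast_one, Polynomial.Chebyshev.C_one, Polynomial.aeval_X]

lemma chebyshev_apply_eigenvector {V : Type*} [AddCommGroup V] [Module ℂ V] {L : Module.End ℂ V}
    {u : V} {x : ℂ} (hx : x ≠ 0) (h : L u = (x + x⁻¹) • u) (k : ℕ) :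
    Polynomial.aeval L (Polynomial.Chebyshev.C ℂ (k : ℤ)) u = (x ^ k + (x ^ k)⁻¹) • u := by
  induction k using Nat.twoStepInduction with
  | zero => rw [chebyshev_apply_zero]; norm_num
  | one => rw [chebyshev_apply_one, h, pow_one]
  | more k ih0 ih1 =>
    rw [chebyshev_apply_add_two, ih0, ih1, map_smul, h, smul_smul, ← sub_smul]
    congr 1
    field_simp
    ring

section Jacobi

variable {D : ℕ} (r : ZMod D → ℂ)

/-- The weight of the step `m → m + 1`: steps away from the origin are normalized to weight `1`. -/
def stepUp (m : ℤ) : ℂ := if 0 ≤ m then 1 else r m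

/-- The weight of the step `m → m - 1`: steps away from the origin are normalized to weight `1`. -/
def stepDown (m : ℤ) : ℂ := if m ≤ 0 then 1 else r ((m - 1 : ℤ) : ZMod D)

/-- The Jacobi operator on the infinite path covering the cycle `ℤ/D`, in the gauge in which the
steps away from the origin have weight `1`; it depends only on the products `r_i` of the two weights
of each edge. -/
def pathOp : (ℤ →₀ ℂ) →ₗ[ℂ] (ℤ →₀ ℂ) :=
  Finsupp.lsum ℂ fun m =>
    stepUp r m • Finsupp.lsingle (m + 1) + stepDown r m • Finsupp.lsingle (m - 1)

/-- The image of `δ₀` under the `k`-th Chebyshev polynomial of `pathOp`. -/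
def pathCheb : ℕ → ℤ →₀ ℂ
  | 0 => Finsupp.single 0 2
  | 1 => pathOp r (Finsupp.single 0 1)
  | k + 2 => pathOp r (pathCheb (k + 1)) - pathCheb k

lemma pathOp_single (m : ℤ) (c : ℂ) : pathOp r (Finsupp.single m c)
    = Finsupp.single (m + 1) (stepUp r m * c) + Finsupp.single (m - 1) (stepDown r m * c) := by
  simp [pathOp]

lemma pathOp_apply (f : ℤ →₀ ℂ) (m : ℤ) :
    pathOp r f m = stepUp r (m - 1) * f (m - 1) + stepDown r (m + 1) * f (m + 1) := by
  induction f using Finsupp.induction_linear with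
  | zero => simp
  | add f g hf hg => rw [map_add, Finsupp.add_apply, hf, hg, Finsupp.add_apply, Finsupp.add_apply]; ring
  | single n c =>
    rw [pathOp_single, Finsupp.add_apply]
    simp only [Finsupp.single_apply]
    have e1 : n + 1 = m ↔ n = m - 1 := by omega
    have e2 : n - 1 = m ↔ n = m + 1 := by omega
    simp only [e1, e2]
    congr 1
    · split_ifs with h
      · rw [h]
      · simp
    · split_ifs with h
      · rw [h]
      · simp

lemma pathCheb_one_apply (m : ℤ) :
    pathCheb r 1 m = (if m = 1 then 1 else 0) + (if m = -1 then 1 else 0) := by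
  rw [pathCheb, pathOp_single, Finsupp.add_apply, Finsupp.single_apply, Finsupp.single_apply]
  simp [stepUp, stepDown, eq_comm]

lemma pathCheb_eq_zero (k : ℕ) (m : ℤ) (h : (k : ℤ) < |m|) : pathCheb r k m = 0 := by
  induction k using Nat.twoStepInduction generalizing m with
  | zero =>
    rw [pathCheb, Finsupp.single_apply, if_neg]
    rintro rfl
    simp at h
  | one =>
    rw [pathCheb_one_apply, if_neg, if_neg, add_zero]
    · rintro rfl; simp at h
    · rintro rfl; simp at h
  | more k ih0 ih1 =>
    rw [pathCheb, Finsupp.sub_apply, pathOp_apply, ih0, ih1, ih1]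
    · ring
    all_goals
      push_cast at h ⊢
      rw [lt_abs] at h ⊢
      omega

lemma pathCheb_top (k : ℕ) :
    pathCheb r (k + 1) (k + 1 : ℤ) = 1 ∧ pathCheb r (k + 1) (-(k + 1 : ℤ)) = 1 := by
  induction k with
  | zero => simp [pathCheb_one_apply]
  | succ k ih =>
    have e1 : pathCheb r (k + 1) ((k + 1 : ℤ) + 1 + 1) = 0 := pathCheb_eq_zero _ _ _ (by
      push_cast; rw [lt_abs]; omega)
    have e2 : pathCheb r (k + 1) (-((k + 1 : ℤ) + 1) - 1) = 0 := pathCheb_eq_zero _ _ _ (by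
      push_cast; rw [lt_abs]; omega)
    have e3 : pathCheb r k ((k + 1 : ℤ) + 1) = 0 := pathCheb_eq_zero _ _ _ (by
      rw [lt_abs]; omega)
    have e4 : pathCheb r k (-((k + 1 : ℤ) + 1)) = 0 := pathCheb_eq_zero _ _ _ (by
      rw [lt_abs]; omega)
    have e5 : -((k + 1 : ℤ) + 1) + 1 = -(k + 1 : ℤ) := by ring
    have e6 : (0 : ℤ) ≤ k + 1 := by omega
    push_cast
    rw [pathCheb, Finsupp.sub_apply, Finsupp.sub_apply, pathOp_apply, pathOp_apply, e1, e2, e3, e4,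
      e5, add_sub_cancel_right, ih.1, ih.2]
    simp [stepUp, stepDown, e6]

/-- The weight of the monotone path from the origin to `m`. -/
def pathWeight (a b : ZMod D → ℂ) (m : ℤ) : ℂ :=
  (∏ i ∈ Finset.range m.toNat, a i) * ∏ i ∈ Finset.range (-m).toNat, b (-1 - i)

variable {r} {a b : ZMod D → ℂ}

lemma mul_pathWeight_up (h : ∀ i, a i * b i = r i) (m : ℤ) :
    a m * pathWeight a b m = stepUp r m * pathWeight a b (m + 1) := by
  by_cases hm : 0 ≤ m
  · have e1 : (m + 1).toNat = m.toNat + 1 := by omega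
    have e2 : (-m).toNat = 0 := by omega
    have e3 : (-(m + 1)).toNat = 0 := by omega
    have e4 : ((m.toNat : ℕ) : ZMod D) = (m : ZMod D) := by
      rw [← Int.cast_natCast, Int.toNat_of_nonneg hm]
    rw [stepUp, if_pos hm, pathWeight, pathWeight, e1, e2, e3, Finset.prod_range_succ, e4]
    ring
  · have e1 : (m + 1).toNat = 0 := by omega
    have e2 : m.toNat = 0 := by omega
    have e3 : (-m).toNat = (-(m + 1)).toNat + 1 := by omega
    have e4 : -1 - (((-(m + 1)).toNat : ℕ) : ZMod D) = (m : ZMod D) := by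
      rw [← Int.cast_natCast, Int.toNat_of_nonneg (by omega)]
      push_cast; ring
    rw [stepUp, if_neg hm, pathWeight, pathWeight, e1, e2, e3, Finset.prod_range_succ, e4, ← h]
    ring

lemma mul_pathWeight_down (h : ∀ i, a i * b i = r i) (m : ℤ) :
    b ((m - 1 : ℤ) : ZMod D) * pathWeight a b m = stepDown r m * pathWeight a b (m - 1) := by
  by_cases hm : m ≤ 0
  · have e1 : (m - 1).toNat = 0 := by omega
    have e2 : m.toNat = 0 := by omega
    have e3 : (-(m - 1)).toNat = (-m).toNat + 1 := by omega
    have e4 : -1 - (((-m).toNat : ℕ) : ZMod D) = ((m - 1 : ℤ) : ZMod D) := by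
      rw [← Int.cast_natCast, Int.toNat_of_nonneg (by omega)]
      push_cast; ring
    rw [stepDown, if_pos hm, pathWeight, pathWeight, e1, e2, e3, Finset.prod_range_succ, e4]
    ring
  · have e1 : m.toNat = (m - 1).toNat + 1 := by omega
    have e2 : (-m).toNat = 0 := by omega
    have e3 : (-(m - 1)).toNat = 0 := by omega
    have e4 : (((m - 1).toNat : ℕ) : ZMod D) = ((m - 1 : ℤ) : ZMod D) := by
      rw [← Int.cast_natCast, Int.toNat_of_nonneg (by omega)]
    rw [stepDown, if_neg hm, pathWeight, pathWeight, e1, e2, e3, Finset.prod_range_succ, e4, ← h]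
    ring

lemma prod_range_natCast (hD : 0 < D) (f : ZMod D → ℂ) [Fintype (ZMod D)] :
    ∏ i ∈ Finset.range D, f i = ∏ i, f i := by
  have : NeZero D := ⟨hD.ne'⟩
  refine Finset.prod_bij' (fun i _ => (i : ZMod D)) (fun j _ => j.val) ?_ ?_ ?_ ?_ ?_
  · simp
  · intro j _; exact Finset.mem_range.2 (ZMod.val_lt j)
  · intro i hi; exact ZMod.val_cast_of_lt (Finset.mem_range.1 hi)
  · intro j _; exact ZMod.natCast_rightInverse j
  · simp

/-- If the `D`-th Chebyshev polynomial of a periodic Jacobi operator on the cycle `ℤ/D` is a scalar,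
then the scalar is the sum of the two weights of the cycle and a term that depends only on the
products of the two weights of each edge. -/
lemma chebyshev_jacobi_scalar (hD : 0 < D) [Fintype (ZMod D)] {V : Type*} [AddCommGroup V]
    [Module ℂ V] (v : Module.Basis (ZMod D) ℂ V) {J : Module.End ℂ V}
    (hJ : ∀ i, J (v i) = a i • v (i + 1) + b (i - 1) • v (i - 1)) (h : ∀ i, a i * b i = r i)
    {c : ℂ} (hc : Polynomial.aeval J (Polynomial.Chebyshev.C ℂ (D : ℤ)) (v 0) = c • v 0) :
    c = ∏ i, a i + ∏ i, b i + pathCheb r D 0 := by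
  have : NeZero D := ⟨hD.ne'⟩
  -- The cover of the cycle by the path, with the weights absorbed into the map.
  let θ : (ℤ →₀ ℂ) →ₗ[ℂ] V := Finsupp.lsum ℂ fun m =>
    LinearMap.toSpanSingleton ℂ V (pathWeight a b m • v (m : ZMod D))
  have hθs : ∀ m c, θ (Finsupp.single m c) = c • pathWeight a b m • v (m : ZMod D) := fun m c => by
    simp [θ]
  have hθ : ∀ f, J (θ f) = θ (pathOp r f) := by
    intro f
    induction f using Finsupp.induction_linear with
    | zero => simp
    | add f g hf hg => simp only [map_add, hf, hg]
    | single m c =>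
      rw [pathOp_single, map_add, hθs, hθs, hθs, map_smul, map_smul, hJ, smul_add]
      have e1 := mul_pathWeight_up h m
      have e2 := mul_pathWeight_down h m
      push_cast at e1 e2 ⊢
      rw [smul_smul (pathWeight a b m), smul_smul (pathWeight a b m), mul_comm _ (a m),
        mul_comm _ (b (m - 1)), e1, e2]
      module
  have hcheb : ∀ k : ℕ, Polynomial.aeval J (Polynomial.Chebyshev.C ℂ (k : ℤ)) (v 0)
      = θ (pathCheb r k) := by
    have h0 : v 0 = θ (Finsupp.single 0 1) := by simp [hθs, pathWeight]
    intro k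
    induction k using Nat.twoStepInduction with
    | zero =>
      rw [chebyshev_apply_zero, pathCheb, h0, ← map_smul, Finsupp.smul_single]
      norm_num
    | one => rw [chebyshev_apply_one, pathCheb, h0, hθ]
    | more k ih0 ih1 => rw [chebyshev_apply_add_two, ih0, ih1, pathCheb, map_sub, hθ]
  have hcoord : ∀ f : ℤ →₀ ℂ, v.repr (θ f) 0
      = f.sum fun m c => if (m : ZMod D) = 0 then c * pathWeight a b m else 0 := by
    intro f
    induction f using Finsupp.induction_linear with
    | zero => simp
    | add f g hf hg =>
      rw [map_add, map_add, Finsupp.add_apply, hf, hg, Finsupp.sum_add_index']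
      · simp
      · intro m c c'; split_ifs <;> ring
    | single m c =>
      rw [hθs, Finsupp.sum_single_index (by simp), map_smul, map_smul, Finsupp.smul_apply,
        Finsupp.smul_apply, Module.Basis.repr_self, Finsupp.single_apply]
      simp
  have key := congrArg (fun u => v.repr u 0) ((hcheb D).symm.trans hc)
  simp only [hcoord, map_smul, Finsupp.smul_apply, Module.Basis.repr_self, Finsupp.single_eq_same,
    smul_eq_mul, mul_one] at key
  rw [← key]
  have hsub : (pathCheb r D).support ⊆ Finset.Icc (-(D : ℤ)) D := fun m hm => by
    rw [Finset.mem_Icc, ← abs_le]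
    by_contra! hlt
    exact Finsupp.mem_support_iff.1 hm (pathCheb_eq_zero r D m hlt)
  rw [Finsupp.sum_of_support_subset _ hsub _ (by simp)]
  have hthree : ({(D : ℤ), -(D : ℤ), 0} : Finset ℤ) ⊆ Finset.Icc (-(D : ℤ)) D := by
    intro m hm
    simp only [Finset.mem_insert, Finset.mem_singleton] at hm
    rw [Finset.mem_Icc]
    omega
  rw [← Finset.sum_subset hthree]
  · have htop := pathCheb_top r (D - 1)
    have hDD : D - 1 + 1 = D := Nat.sub_add_cancel hD
    have hDZ : ((D - 1 : ℕ) : ℤ) + 1 = D := by omega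
    rw [hDD, hDZ] at htop
    rw [Finset.sum_insert, Finset.sum_insert, Finset.sum_singleton, htop.1, htop.2]
    · have w1 : pathWeight a b D = ∏ i, a i := by
        rw [pathWeight, Int.toNat_natCast, prod_range_natCast hD]
        simp
      have w2 : pathWeight a b (-(D : ℤ)) = ∏ i, b i := by
        rw [pathWeight, neg_neg, Int.toNat_natCast, prod_range_natCast hD fun i => b (-1 - i),
          ← (Equiv.subLeft (-1 : ZMod D)).prod_comp b]
        simp
      rw [w1, w2]
      simp [pathWeight]
      ring
    · simp; omega
    · simp only [Finset.mem_insert, Finset.mem_singleton]; omega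
  · intro m hm hm'
    rw [if_neg]
    intro h0
    rw [ZMod.intCast_zmod_eq_zero_iff_dvd] at h0
    obtain ⟨n, rfl⟩ := h0
    rw [Finset.mem_Icc] at hm
    have hDp : (0 : ℤ) < D := by exact_mod_cast hD
    have h1 : n ≤ 1 := by nlinarith
    have h2 : -1 ≤ n := by nlinarith
    apply hm'
    simp only [Finset.mem_insert, Finset.mem_singleton]
    interval_cases n <;> simp

end Jacobi

/-! ### Classical shadows of type-0 representations -/

section

open MvPolynomial

lemma add_one_ne_sub_one {D : ℕ} (hD : 2 < D) (i : ZMod D) : i + 1 ≠ i - 1 := by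
  intro hi
  have h2 : ((2 : ℕ) : ZMod D) = 0 := by
    push_cast
    linear_combination hi
  rw [ZMod.natCast_eq_zero_iff] at h2
  exact absurd (Nat.le_of_dvd two_pos h2) (by omega)

lemma isTypeZero_iff {q : ℂ} {V : Type*} [AddCommGroup V] [Module ℂ V] (hq : q ≠ 0)
    (ρ : SkeinAlgebra q →ₐ[ℂ] Module.End ℂ V) : IsTypeZero ρ ↔
      ∃ (v : Module.Basis (ZMod (piDegree q)) ℂ V) (σ w : ℂ) (s t : ZMod (piDegree q) → ℂ),
        TypeZeroAction (fun m => ρ (curve q m)) v σ w s t := by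
  have e1 : ∀ (σ : ℂ) (i : ZMod (piDegree q)),
      q ^ (2 * (i.val : ℤ) + 1) * σ = q * toralPt q σ i := fun σ i => by
    rw [toralPt, zpow_add₀ hq, zpow_one]; ring
  have e2 : ∀ (σ : ℂ) (i : ZMod (piDegree q)),
      q ^ (-2 * (i.val : ℤ) + 1) * σ⁻¹ = q * (toralPt q σ i)⁻¹ := fun σ i => by
    rw [toralPt, zpow_add₀ hq, zpow_one, mul_inv, ← zpow_neg, neg_mul]; ring
  constructor
  · rintro ⟨v, σ, w, s, t, h1, h2, h3, h4, h5, h6⟩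
    refine ⟨v, σ, w, s, t, h1, h2, h3, fun i => ?_, fun i => ?_, h6⟩
    · rw [← lam_eq, h4]
    · rw [← e1, ← e2, h5]
  · rintro ⟨v, σ, w, s, t, h⟩
    refine ⟨v, σ, w, s, t, h.1, h.2, h.3, fun i => ?_, fun i => ?_, h.6⟩
    · rw [lam_eq, ← h.4]
    · rw [e1, e2, ← h.5]

lemma toralPt_eq_of_add_inv_eq {q σ : ℂ} (hq : q ≠ 0) (hD : 0 < piDegree q) (hσ : σ ≠ 0)
    (hgen : (σ ^ piDegree q) ^ 2 ≠ 1) {i j : ZMod (piDegree q)}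
    (h : toralPt q σ i + (toralPt q σ i)⁻¹ = toralPt q σ j + (toralPt q σ j)⁻¹) : i = j := by
  have hi := toralPt_ne_zero hq hσ i
  have hj := toralPt_ne_zero hq hσ j
  have h1 : (toralPt q σ i - toralPt q σ j) * (toralPt q σ i * toralPt q σ j - 1) = 0 := by
    field_simp at h
    linear_combination h
  rcases mul_eq_zero.1 h1 with h2 | h2
  · exact toralPt_injective hD hσ (sub_eq_zero.1 h2)
  · refine absurd ?_ hgen
    have := congrArg (· ^ piDegree q) (sub_eq_zero.1 h2)
    simp only [mul_pow, toralPt_pow, one_pow] at this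
    rw [← this]; ring

lemma lamHat_ne_zero_of_generic {q σ : ℂ} (hq : q ≠ 0) (hσ : σ ≠ 0)
    (hgen : (σ ^ piDegree q) ^ 2 ≠ 1) (i : ZMod (piDegree q)) : lamHat q σ i ≠ 0 := by
  have hi := toralPt_ne_zero hq hσ i
  rw [lamHat_eq]
  intro h
  apply hgen
  have h2 : toralPt q σ i ^ 2 = 1 := by
    field_simp at h
    linear_combination h
  rw [← toralPt_pow q σ i, ← pow_mul, mul_comm, pow_mul, h2, one_pow]

/-- The product of the ratios between the weights of `α₁` and those of `α_∞`; it is `± σ ^ D`. -/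
def slopeRatio (q σ : ℂ) [Fintype (ZMod (piDegree q))] : ℂ := ∏ i, q * toralPt q σ i

lemma slopeRatio_ne_zero {q σ : ℂ} [Fintype (ZMod (piDegree q))] (hq : q ≠ 0) (hσ : σ ≠ 0) :
    slopeRatio q σ ≠ 0 :=
  Finset.prod_ne_zero_iff.2 fun i _ => mul_ne_zero hq (toralPt_ne_zero hq hσ i)

lemma exists_slopeRatio_eq (q : ℂ) [Fintype (ZMod (piDegree q))] (hD : 0 < piDegree q) :
    ∃ ε : ℂ, ε ^ 2 = 1 ∧ ∀ σ, slopeRatio q σ = ε * σ ^ piDegree q := by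
  have hper : (q ^ 2) ^ piDegree q = 1 := pow_orderOf_eq_one _
  have hnat : ∀ (σ : ℂ) (n : ℕ), toralPt q σ n = (q ^ 2) ^ n * σ := fun σ n => by
    induction n with
    | zero => simp [toralPt]
    | succ n ih => rw [Nat.cast_succ, toralPt_add_one hD, ih, pow_succ']; ring
  refine ⟨q ^ (piDegree q ^ 2), ?_, fun σ => ?_⟩
  · rw [← pow_mul, show piDegree q ^ 2 * 2 = 2 * piDegree q * piDegree q by ring, pow_mul,
      pow_mul q 2, hper, one_pow]
  · rw [slopeRatio, ← prod_range_natCast hD]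
    simp only [hnat]
    generalize piDegree q = n
    induction n with
    | zero => simp
    | succ n ih => rw [Finset.prod_range_succ, ih]; ring

variable {q : ℂ} {V : Type*} [AddCommGroup V] [Module ℂ V]

/-- The coordinates of the classical shadow of a type-0 representation, in terms of `σ`, `w` and the
two products `a = ∏ s_i`, `b = ∏ t_i`. -/
def shadowCoords (q σ w a b : ℂ) [Fintype (ZMod (piDegree q))] : Fin 4 → ℂ :=
  ![σ ^ piDegree q + (σ ^ piDegree q)⁻¹,
    slopeRatio q σ * a + (slopeRatio q σ)⁻¹ * b + pathCheb (rCoeff q σ w) (piDegree q) 0,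
    a + b + pathCheb (rCoeff q σ w) (piDegree q) 0, w]

/-- The classical shadow of a type-0 representation. -/
lemma shadow_eq_shadowCoords (hq : q ≠ 0) (hD : 0 < piDegree q) [Fintype (ZMod (piDegree q))]
    {ρ : SkeinAlgebra q →ₐ[ℂ] Module.End ℂ V} {v : Module.Basis (ZMod (piDegree q)) ℂ V} {σ w : ℂ}
    {s t : ZMod (piDegree q) → ℂ} (h : TypeZeroAction (fun m => ρ (curve q m)) v σ w s t)
    {χ : Center q →ₐ[ℂ] ℂ} (hχ : ∀ x, ρ (Center.incl q x) (v 0) = χ x • v 0) :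
    (fun i => χ (centralMap hq (X i))) = shadowCoords q σ w (∏ i, s i) (∏ i, t i) := by
  have hA : ∀ m, Polynomial.aeval (ρ (curve q m))
      (Polynomial.Chebyshev.C ℂ (piDegree q : ℤ)) (v 0) = χ (centralA q m) • v 0 := fun m => by
    rw [← hχ, incl_centralA, ← Polynomial.aeval_algHom_apply]
  have hv0 : v 0 ≠ 0 := v.ne_zero 0
  have h0 : χ (centralA q .zero) = σ ^ piDegree q + (σ ^ piDegree q)⁻¹ := by
    have := hA .zero
    rw [chebyshev_apply_eigenvector (toralPt_ne_zero hq h.ne_zero 0) (h.zero_apply 0),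
      toralPt_pow] at this
    exact (smul_left_injective ℂ hv0 this).symm
  have h1 : χ (centralA q .one) = slopeRatio q σ * ∏ i, s i + (slopeRatio q σ)⁻¹ * ∏ i, t i
      + pathCheb (rCoeff q σ w) (piDegree q) 0 := by
    have := chebyshev_jacobi_scalar (a := fun i => q * toralPt q σ i * s i)
      (b := fun i => (q * toralPt q σ i)⁻¹ * t i) (r := rCoeff q σ w) hD v (fun i => ?_)
      (fun i => ?_) (hA .one)
    · rw [this, Finset.prod_mul_distrib (g := s), Finset.prod_mul_distrib (g := t),
        Finset.prod_inv_distrib]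
      rfl
    · have hi := toralPt_ne_zero hq h.ne_zero i
      rw [h.one_apply, toralPt_sub_one hq hD]
      congr 3
      field_simp
    · have hi := toralPt_ne_zero hq h.ne_zero i
      rw [← h.mul_eq]
      field_simp
  have h2 : χ (centralA q .infty) = ∏ i, s i + ∏ i, t i
      + pathCheb (rCoeff q σ w) (piDegree q) 0 :=
    chebyshev_jacobi_scalar hD v h.infty_apply h.mul_eq (hA .infty)
  have h3 : χ (boundaryZ hq) = w := by
    have := hχ (boundaryZ hq)
    have hb := h.boundary_apply hq hD 0
    simp only [← map_mul, ← map_smul, ← map_sub, ← AlgHom.commutes ρ, ← map_add] at hb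
    rw [incl_boundaryZ] at this
    exact smul_left_injective ℂ hv0 (this.symm.trans hb)
  funext i
  simp only [centralMap, aeval_X, centralGen, shadowCoords]
  fin_cases i
  exacts [h0, h1, h2, h3]

/-- An operator commuting with a type-0 representation whose weights in one direction do not vanish
is a scalar. -/
lemma exists_scalar_of_commute (hq : q ≠ 0) (hD : 2 < piDegree q)
    {A : Slope → Module.End ℂ V} {v : Module.Basis (ZMod (piDegree q)) ℂ V} {σ w : ℂ}
    {s t : ZMod (piDegree q) → ℂ} (h : TypeZeroAction A v σ w s t)
    (hgen : (σ ^ piDegree q) ^ 2 ≠ 1) (hst : (∀ i, s i ≠ 0) ∨ ∀ i, t i ≠ 0)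
    {T : Module.End ℂ V} (h0 : A .zero * T = T * A .zero) (h1 : A .infty * T = T * A .infty) :
    ∃ c : ℂ, T = c • LinearMap.id := by
  have : NeZero (piDegree q) := ⟨by omega⟩
  have hdiag : ∀ i, T (v i) = v.repr (T (v i)) i • v i := by
    intro i
    apply v.repr.injective
    ext j
    rw [map_smul, Finsupp.smul_apply, Module.Basis.repr_self, Finsupp.single_apply]
    split_ifs with hij
    · rw [hij]; simp
    · have e := congrArg (fun u => v.repr u j) (LinearMap.congr_fun h0 (v i))
      simp only [Module.End.mul_apply, h.zero_apply, map_smul, Finsupp.smul_apply, smul_eq_mul] at e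
      have hA : ∀ u, v.repr (A .zero u) j = (toralPt q σ j + (toralPt q σ j)⁻¹) * v.repr u j := by
        intro u
        refine LinearMap.congr_fun (f := v.coord j ∘ₗ A .zero)
          (g := (toralPt q σ j + (toralPt q σ j)⁻¹) • v.coord j) (v.ext fun k => ?_) u
        simp only [LinearMap.comp_apply, h.zero_apply, map_smul, LinearMap.smul_apply,
          Module.Basis.coord_apply, Module.Basis.repr_self, Finsupp.single_apply, smul_eq_mul]
        split_ifs with hk
        · rw [hk]
        · simp
      rw [hA, ← sub_eq_zero, ← sub_mul] at e
      rw [smul_zero]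
      exact (mul_eq_zero.1 e).resolve_left fun h' =>
        hij (toralPt_eq_of_add_inv_eq hq (by omega) h.ne_zero hgen (sub_eq_zero.1 h')).symm
  set c : ZMod (piDegree q) → ℂ := fun i => v.repr (T (v i)) i
  have hne := add_one_ne_sub_one hD
  have hstep : ∀ i, s i * (c i - c (i + 1)) = 0 ∧ t (i - 1) * (c i - c (i - 1)) = 0 := by
    intro i
    have e := LinearMap.congr_fun h1 (v i)
    rw [Module.End.mul_apply, Module.End.mul_apply, hdiag, map_smul (A .infty), h.infty_apply,
      map_add T, map_smul T, map_smul T, hdiag (i + 1), hdiag (i - 1)] at e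
    constructor
    · have := congrArg (fun u => v.repr u (i + 1)) e
      simp [(hne i).symm] at this
      linear_combination this
    · have := congrArg (fun u => v.repr u (i - 1)) e
      simp [hne i] at this
      linear_combination this
  have hconst : ∀ i, c (i + 1) = c i := by
    intro i
    rcases hst with hs | ht
    · exact (sub_eq_zero.1 ((mul_eq_zero.1 (hstep i).1).resolve_left (hs i))).symm
    · have := (hstep (i + 1)).2
      rw [add_sub_cancel_right] at this
      exact sub_eq_zero.1 ((mul_eq_zero.1 this).resolve_left (ht i))
  have hall : ∀ n : ℕ, c n = c 0 := by
    intro n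
    induction n with
    | zero => simp
    | succ n ih => rw [Nat.cast_succ, hconst, ih]
  refine ⟨c 0, v.ext fun i => ?_⟩
  have hi := hall i.val
  rw [ZMod.natCast_zmod_val] at hi
  rw [hdiag, LinearMap.smul_apply, LinearMap.id_apply, ← hi]

/-- The type-0 representation with prescribed parameters. -/
lemma exists_rep (hq : q ≠ 0) (hD : 0 < piDegree q) {σ w : ℂ} {s t : ZMod (piDegree q) → ℂ}
    (hσ : σ ≠ 0) (hat : ∀ i, lamHat q σ i ≠ 0) (hst : ∀ i, s i * t i = rCoeff q σ w i) :
    ∃ (v : Module.Basis (ZMod (piDegree q)) ℂ (ZMod (piDegree q) → ℂ))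
      (ρ : SkeinAlgebra q →ₐ[ℂ] Module.End ℂ (ZMod (piDegree q) → ℂ)),
      TypeZeroAction (fun m => ρ (curve q m)) v σ w s t := by
  have : NeZero (piDegree q) := ⟨hD.ne'⟩
  let v := Pi.basisFun ℂ (ZMod (piDegree q))
  let A : Slope → Module.End ℂ (ZMod (piDegree q) → ℂ) := fun m => match m with
    | .zero => v.constr ℂ fun i => (toralPt q σ i + (toralPt q σ i)⁻¹) • v i
    | .one => v.constr ℂ fun i => (q * toralPt q σ i * s i) • v (i + 1)
        + (q * (toralPt q σ i)⁻¹ * t (i - 1)) • v (i - 1)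
    | .infty => v.constr ℂ fun i => s i • v (i + 1) + t (i - 1) • v (i - 1)
  have hA : TypeZeroAction A v σ w s t := ⟨hσ, hat, hst, fun i => v.constr_basis ℂ _ i,
    fun i => v.constr_basis ℂ _ i, fun i => v.constr_basis ℂ _ i⟩
  refine ⟨v, liftSkein A (v.ext fun i => hA.rel_one hq hD i) (v.ext fun i => hA.rel_infty hq hD i)
    (v.ext fun i => hA.rel_zero hq hD i), ?_⟩
  simp only [liftSkein_curve]
  exact hA

/-- The equation of the center holds at the coordinates given by generic parameters. -/
lemma eval_shadowCoords_eq_zero (hq : q ≠ 0) (hD : 2 < piDegree q) [Fintype (ZMod (piDegree q))]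
    {σ w : ℂ} {s t : ZMod (piDegree q) → ℂ} (hσ : σ ≠ 0) (hgen : (σ ^ piDegree q) ^ 2 ≠ 1)
    (hst : ∀ i, s i * t i = rCoeff q σ w i) (hne : (∀ i, s i ≠ 0) ∨ ∀ i, t i ≠ 0)
    {F : MvPolynomial (Fin 4) ℂ} (hF : centralMap hq F = 0) :
    eval (shadowCoords q σ w (∏ i, s i) (∏ i, t i)) F = 0 := by
  obtain ⟨v, ρ, h⟩ := exists_rep hq (by omega) hσ (lamHat_ne_zero_of_generic hq hσ hgen) hst
  have hscal : ∀ x : Center q, ∃ c : ℂ, ρ (Center.incl q x) = c • LinearMap.id := by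
    intro x
    refine exists_scalar_of_commute hq hD h hgen hne ?_ ?_
    all_goals
      rw [← map_mul, ← map_mul]
      exact congrArg _ (Subalgebra.mem_center_iff.1 x.2 _)
  choose c hc using hscal
  have hcv : ∀ x, v.repr (ρ (Center.incl q x) (v 0)) 0 = c x := fun x => by
    rw [hc]; simp
  let χ : Center q →ₐ[ℂ] ℂ := AlgHom.ofLinearMap
    { toFun := fun x => v.repr (ρ (Center.incl q x) (v 0)) 0
      map_add' := fun x y => by simp only [map_add, LinearMap.add_apply, Finsupp.add_apply]
      map_smul' := fun r x => by
        simp only [map_smul, LinearMap.smul_apply, Finsupp.smul_apply, RingHom.id_apply] }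
    (by simp)
    (fun x y => by
      change v.repr (ρ (Center.incl q (x * y)) (v 0)) 0
        = v.repr (ρ (Center.incl q x) (v 0)) 0 * v.repr (ρ (Center.incl q y) (v 0)) 0
      rw [map_mul, map_mul, Module.End.mul_apply, hcv, hcv, hc, hc]
      simp [mul_comm])
  have hχ : ∀ x, ρ (Center.incl q x) (v 0) = χ x • v 0 := fun x => by
    have : χ x = c x := hcv x
    rw [this, hc]; rfl
  rw [← shadow_eq_shadowCoords hq (by omega) h hχ, ← apply_eq_eval, hF, map_zero]

end

section

/-! ### Reducibility of type-0 representations -/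

/-- A nonempty proper subset of the cycle `ℤ/D` is left by some step `i → i + 1`. -/
lemma exists_mem_add_one_notMem {D : ℕ} (hD : 0 < D) {I : Set (ZMod D)} (hI : I.Nonempty)
    (hI' : ∃ j, j ∉ I) : ∃ i, i ∈ I ∧ i + 1 ∉ I := by
  have : NeZero D := ⟨hD.ne'⟩
  by_contra! H
  obtain ⟨i, hi⟩ := hI
  obtain ⟨j, hj⟩ := hI'
  have h : ∀ n : ℕ, i + n ∈ I := fun n => by
    induction n with
    | zero => simpa
    | succ n ih => rw [Nat.cast_succ, ← add_assoc]; exact H _ ih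
  apply hj
  have := h (j - i).val
  rwa [ZMod.natCast_zmod_val, add_sub_cancel] at this

variable {q : ℂ} {V : Type*} [AddCommGroup V] [Module ℂ V]

lemma forall_rep_mem_of_forall_curve (ρ : SkeinAlgebra q →ₐ[ℂ] Module.End ℂ V) {U : Submodule ℂ V}
    (h : ∀ m, ∀ u ∈ U, ρ (curve q m) u ∈ U) (a : SkeinAlgebra q) : ∀ u ∈ U, ρ a u ∈ U := by
  obtain ⟨f, rfl⟩ := toSkein_surjective q a
  induction f using FreeAlgebra.induction with
  | grade0 c =>
    intro u hu
    rw [AlgHom.commutes, AlgHom.commutes, Module.algebraMap_end_apply]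
    exact U.smul_mem c hu
  | grade1 m => exact h m
  | mul x y hx hy =>
    intro u hu
    rw [map_mul, map_mul, Module.End.mul_apply]
    exact hx _ (hy u hu)
  | add x y hx hy =>
    intro u hu
    rw [map_add, map_add, LinearMap.add_apply]
    exact U.add_mem (hx u hu) (hy u hu)

/-- An invariant subspace contains every weight vector that occurs in one of its elements. -/
lemma basis_mem_of_repr_ne_zero (hq : q ≠ 0) (hD : 0 < piDegree q)
    {ρ : SkeinAlgebra q →ₐ[ℂ] Module.End ℂ V} {v : Module.Basis (ZMod (piDegree q)) ℂ V} {σ w : ℂ}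
    {s t : ZMod (piDegree q) → ℂ} (h : TypeZeroAction (fun m => ρ (curve q m)) v σ w s t)
    (hgen : (σ ^ piDegree q) ^ 2 ≠ 1) {U : Submodule ℂ V}
    (hU : ∀ a : SkeinAlgebra q, ∀ u ∈ U, ρ a u ∈ U) {u : V} (hu : u ∈ U) {i : ZMod (piDegree q)}
    (hi : v.repr u i ≠ 0) : v i ∈ U := by
  have : NeZero (piDegree q) := ⟨hD.ne'⟩
  -- The Lagrange projection onto the weight space of `v i`.
  let P : Polynomial ℂ := ∏ j ∈ Finset.univ.erase i,
    (Polynomial.X - Polynomial.C (toralPt q σ j + (toralPt q σ j)⁻¹))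
  have hP : ∀ k, ρ (Polynomial.aeval (curve q .zero) P) (v k)
      = P.eval (toralPt q σ k + (toralPt q σ k)⁻¹) • v k := fun k => by
    rw [← Polynomial.aeval_algHom_apply]
    exact Module.End.aeval_apply_of_hasEigenvector
      (Module.End.hasEigenvector_iff.2 ⟨Module.End.mem_eigenspace_iff.2 (h.zero_apply k), v.ne_zero k⟩)
  have hPk : ∀ k, k ≠ i → P.eval (toralPt q σ k + (toralPt q σ k)⁻¹) = 0 := fun k hk => by
    rw [Polynomial.eval_prod]
    exact Finset.prod_eq_zero (Finset.mem_erase.2 ⟨hk, Finset.mem_univ k⟩) (by simp)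
  have hPi : P.eval (toralPt q σ i + (toralPt q σ i)⁻¹) ≠ 0 := by
    rw [Polynomial.eval_prod, Finset.prod_ne_zero_iff]
    intro j hj
    rw [Polynomial.eval_sub, Polynomial.eval_X, Polynomial.eval_C, sub_ne_zero]
    exact fun h' => (Finset.mem_erase.1 hj).1 (toralPt_eq_of_add_inv_eq hq hD h.ne_zero hgen h').symm
  have key := hU (Polynomial.aeval (curve q .zero) P) u hu
  rw [← v.sum_repr u, map_sum, Finset.sum_eq_single i] at key
  · rw [map_smul, hP, smul_smul] at key
    exact (U.smul_mem_iff (mul_ne_zero hi hPi)).1 key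
  · intro k _ hk
    rw [map_smul, hP, hPk k hk, zero_smul, smul_zero]
  · simp

lemma exists_of_isReducible (hq : q ≠ 0) (hD : 2 < piDegree q)
    {ρ : SkeinAlgebra q →ₐ[ℂ] Module.End ℂ V} {v : Module.Basis (ZMod (piDegree q)) ℂ V} {σ w : ℂ}
    {s t : ZMod (piDegree q) → ℂ} (h : TypeZeroAction (fun m => ρ (curve q m)) v σ w s t)
    (hgen : (σ ^ piDegree q) ^ 2 ≠ 1) (hred : IsReducible ρ) :
    ∃ i j, i ≠ j ∧ s i = 0 ∧ t j = 0 := by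
  have hD0 : 0 < piDegree q := by omega
  obtain ⟨U, hbot, htop, hU⟩ := hred
  have hmem : ∀ {u}, u ∈ U → ∀ {i}, v.repr u i ≠ 0 → v i ∈ U := fun {_} hu {_} hi =>
    basis_mem_of_repr_ne_zero hq hD0 h hgen hU hu hi
  let I : Set (ZMod (piDegree q)) := {i | v i ∈ U}
  have hne : I.Nonempty := by
    obtain ⟨u, hu, hu0⟩ := U.ne_bot_iff.1 hbot
    have : v.repr u ≠ 0 := by simpa using hu0
    obtain ⟨i, hi⟩ := Finsupp.ne_iff.1 this
    exact ⟨i, hmem hu hi⟩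
  have hproper : ∃ j, j ∉ I := by
    by_contra! H
    apply htop
    rw [eq_top_iff, ← v.span_eq, Submodule.span_le]
    rintro _ ⟨i, rfl⟩
    exact H i
  have hup : ∀ i, i ∈ I → i + 1 ∉ I → s i = 0 := by
    intro i hi hi'
    by_contra hs
    apply hi'
    refine hmem (hU (curve q .infty) _ hi) ?_
    rw [show ρ (curve q .infty) (v i) = _ from h.infty_apply i]
    simpa [(add_one_ne_sub_one hD i).symm] using hs
  have hdown : ∀ i, i + 1 ∈ I → i ∉ I → t i = 0 := by
    intro i hi hi'
    by_contra ht
    apply hi'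
    refine hmem (hU (curve q .infty) _ hi) ?_
    rw [show ρ (curve q .infty) (v (i + 1)) = _ from h.infty_apply (i + 1), add_sub_cancel_right]
    have h2 : i + 1 + 1 ≠ i := by
      have := add_one_ne_sub_one hD (i + 1)
      rwa [add_sub_cancel_right] at this
    simpa [h2] using ht
  obtain ⟨i, hi, hi'⟩ := exists_mem_add_one_notMem hD0 hne hproper
  obtain ⟨j, hj, hj'⟩ := exists_mem_add_one_notMem (I := Iᶜ) hD0 hproper
    (hne.imp fun i hi hi' => hi' hi)
  refine ⟨i, j, ?_, hup i hi hi', hdown j (not_not.1 hj') hj⟩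
  rintro rfl
  exact hj hi

lemma isReducible_of_exists (hD : 0 < piDegree q)
    {ρ : SkeinAlgebra q →ₐ[ℂ] Module.End ℂ V} {v : Module.Basis (ZMod (piDegree q)) ℂ V} {σ w : ℂ}
    {s t : ZMod (piDegree q) → ℂ} (h : TypeZeroAction (fun m => ρ (curve q m)) v σ w s t)
    {i j : ZMod (piDegree q)} (hij : i ≠ j) (hs : s i = 0) (ht : t j = 0) : IsReducible ρ := by
  have : NeZero (piDegree q) := ⟨hD.ne'⟩
  -- The arc of the cycle from `j + 1` to `i`.
  let M : ℕ := (i - (j + 1)).val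
  have hM : i = j + 1 + M := by rw [ZMod.natCast_zmod_val]; ring
  let I : Set (ZMod (piDegree q)) := {k | ∃ m : ℕ, m ≤ M ∧ k = j + 1 + m}
  have hup : ∀ k ∈ I, s k ≠ 0 → k + 1 ∈ I := by
    rintro k ⟨m, hm, rfl⟩ hk
    have hmM : m ≠ M := by
      rintro rfl
      rw [← hM] at hk
      exact hk hs
    exact ⟨m + 1, by omega, by push_cast; ring⟩
  have hdown : ∀ k ∈ I, t (k - 1) ≠ 0 → k - 1 ∈ I := by
    rintro k ⟨m, hm, rfl⟩ hk
    have hm0 : m ≠ 0 := by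
      rintro rfl
      apply hk
      rw [Nat.cast_zero, add_zero, add_sub_cancel_right, ht]
    exact ⟨m - 1, by omega, by rw [Nat.cast_sub (by omega)]; push_cast; ring⟩
  have hjI : j ∉ I := by
    rintro ⟨m, hm, hj⟩
    have h0 : ((m + 1 : ℕ) : ZMod (piDegree q)) = 0 := by
      push_cast
      linear_combination -hj
    have h1 := Nat.le_of_dvd (by omega) ((ZMod.natCast_eq_zero_iff _ _).1 h0)
    have h2 : M < piDegree q := ZMod.val_lt _
    have h3 : m = M := by omega
    rw [h3] at hj
    exact hij (hM.trans hj.symm)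
  let U : Submodule ℂ V := Submodule.span ℂ (v '' I)
  have hvU : ∀ {k}, k ∈ I → v k ∈ U := fun hk => Submodule.subset_span ⟨_, hk, rfl⟩
  have hsU : ∀ {k}, k ∈ I → ∀ c : ℂ, (c * s k) • v (k + 1) ∈ U := fun {k} hk c => by
    by_cases h0 : s k = 0
    · simp [h0]
    · exact U.smul_mem _ (hvU (hup k hk h0))
  have htU : ∀ {k}, k ∈ I → ∀ c : ℂ, (c * t (k - 1)) • v (k - 1) ∈ U := fun {k} hk c => by
    by_cases h0 : t (k - 1) = 0
    · simp [h0]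
    · exact U.smul_mem _ (hvU (hdown k hk h0))
  refine ⟨U, ?_, ?_, forall_rep_mem_of_forall_curve ρ fun m => ?_⟩
  · exact fun hb => v.ne_zero i ((Submodule.mem_bot ℂ).1 (hb ▸ hvU ⟨M, le_rfl, hM⟩))
  · intro htop
    have hle : U ≤ LinearMap.ker (v.coord j) := by
      rw [Submodule.span_le]
      rintro _ ⟨k, hk, rfl⟩
      have : k ≠ j := fun h' => hjI (h' ▸ hk)
      simp [this]
    have : v j ∈ LinearMap.ker (v.coord j) := hle (htop ▸ Submodule.mem_top)
    simp at this
  · suffices H : U ≤ U.comap (ρ (curve q m)) from H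
    rw [Submodule.span_le]
    rintro _ ⟨k, hk, rfl⟩
    rw [SetLike.mem_coe, Submodule.mem_comap]
    cases m with
    | zero =>
      rw [show ρ (curve q .zero) (v k) = _ from h.zero_apply k]
      exact U.smul_mem _ (hvU hk)
    | one =>
      rw [show ρ (curve q .one) (v k) = _ from h.one_apply k]
      exact U.add_mem (hsU hk _) (htU hk _)
    | infty =>
      rw [show ρ (curve q .infty) (v k) = _ from h.infty_apply k]
      have h1 := hsU hk 1
      have h2 := htU hk 1
      rw [one_mul] at h1 h2
      exact U.add_mem h1 h2

/-- A type-0 representation is reducible exactly when both products of weights vanish and at least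
two of the numbers `r_i = s_i t_i` vanish. -/
lemma isReducible_iff (hq : q ≠ 0) (hD : 2 < piDegree q) [Fintype (ZMod (piDegree q))]
    {ρ : SkeinAlgebra q →ₐ[ℂ] Module.End ℂ V} {v : Module.Basis (ZMod (piDegree q)) ℂ V} {σ w : ℂ}
    {s t : ZMod (piDegree q) → ℂ} (h : TypeZeroAction (fun m => ρ (curve q m)) v σ w s t)
    (hgen : (σ ^ piDegree q) ^ 2 ≠ 1) :
    IsReducible ρ ↔ ∏ i, s i = 0 ∧ ∏ i, t i = 0 ∧
      ∃ i j, i ≠ j ∧ rCoeff q σ w i = 0 ∧ rCoeff q σ w j = 0 := by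
  constructor
  · intro hred
    obtain ⟨i, j, hij, hs, ht⟩ := exists_of_isReducible hq hD h hgen hred
    refine ⟨Finset.prod_eq_zero (Finset.mem_univ i) hs, Finset.prod_eq_zero (Finset.mem_univ j) ht,
      i, j, hij, ?_, ?_⟩
    · rw [← h.mul_eq, hs, zero_mul]
    · rw [← h.mul_eq, ht, mul_zero]
  · rintro ⟨hs, ht, k, l, hkl, hk, hl⟩
    obtain ⟨i, -, hi⟩ := Finset.prod_eq_zero_iff.1 hs
    obtain ⟨j, -, hj⟩ := Finset.prod_eq_zero_iff.1 ht
    by_cases hij : i = j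
    · subst hij
      obtain ⟨m, hm, hmr⟩ : ∃ m, m ≠ i ∧ s m * t m = 0 := by
        by_cases hki : k = i
        · exact ⟨l, fun h' => hkl (hki.trans h'.symm), by rw [h.mul_eq, hl]⟩
        · exact ⟨k, hki, by rw [h.mul_eq, hk]⟩
      rcases mul_eq_zero.1 hmr with h' | h'
      · exact isReducible_of_exists (by omega) h hm h' hj
      · exact isReducible_of_exists (by omega) h hm.symm hi h'
    · exact isReducible_of_exists (by omega) h hij hi hj

end

/-! ### The equation of the center in the parameters of a representation -/

section

open MvPolynomial

lemma exists_eval_eq_of_deg_le_two {g : MvPolynomial (Fin 4) ℂ}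
    (hg : ∀ n ∈ g.support, n 0 + n 1 + n 2 ≤ 2) :
    ∃ (a b c : ℂ → ℂ) (l₁ l₂ l₀ : ℂ → ℂ → ℂ), ∀ x₀ x₁ x₂ w, eval ![x₀, x₁, x₂, w] g
      = a w * x₁ ^ 2 + b w * (x₁ * x₂) + c w * x₂ ^ 2 + l₁ x₀ w * x₁ + l₂ x₀ w * x₂ + l₀ x₀ w := by
  rw [g.as_sum]
  refine Finset.sum_induction _ (fun f : MvPolynomial (Fin 4) ℂ =>
    ∃ (a b c : ℂ → ℂ) (l₁ l₂ l₀ : ℂ → ℂ → ℂ), ∀ x₀ x₁ x₂ w, eval ![x₀, x₁, x₂, w] f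
      = a w * x₁ ^ 2 + b w * (x₁ * x₂) + c w * x₂ ^ 2 + l₁ x₀ w * x₁ + l₂ x₀ w * x₂ + l₀ x₀ w)
    ?_ ?_ ?_
  · rintro f f' ⟨a, b, c, l₁, l₂, l₀, h⟩ ⟨a', b', c', l₁', l₂', l₀', h'⟩
    refine ⟨a + a', b + b', c + c', l₁ + l₁', l₂ + l₂', l₀ + l₀', fun x₀ x₁ x₂ w => ?_⟩
    rw [map_add, h, h']
    simp only [Pi.add_apply]
    ring
  · exact ⟨0, 0, 0, 0, 0, 0, by simp⟩
  · intro n hn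
    have hdeg := hg n hn
    generalize coeff n g = k
    have he : ∀ x₀ x₁ x₂ w, eval ![x₀, x₁, x₂, w] (monomial n k)
        = k * (x₀ ^ n 0 * x₁ ^ n 1 * x₂ ^ n 2 * w ^ n 3) := fun x₀ x₁ x₂ w => by
      rw [eval_monomial, Finsupp.prod_fintype _ _ (by simp), Fin.prod_univ_four]
      rfl
    simp only [he]
    obtain h | h | h | h | h | h : (n 0 = 0 ∧ n 1 = 2 ∧ n 2 = 0) ∨ (n 0 = 0 ∧ n 1 = 1 ∧ n 2 = 1) ∨
        (n 0 = 0 ∧ n 1 = 0 ∧ n 2 = 2) ∨ (n 1 = 1 ∧ n 2 = 0) ∨ (n 1 = 0 ∧ n 2 = 1) ∨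
        (n 1 = 0 ∧ n 2 = 0) := by omega
    · exact ⟨fun w => k * w ^ n 3, 0, 0, 0, 0, 0, fun x₀ x₁ x₂ w => by simp [h]; ring⟩
    · exact ⟨0, fun w => k * w ^ n 3, 0, 0, 0, 0, fun x₀ x₁ x₂ w => by simp [h]; ring⟩
    · exact ⟨0, 0, fun w => k * w ^ n 3, 0, 0, 0, fun x₀ x₁ x₂ w => by simp [h]; ring⟩
    · exact ⟨0, 0, 0, fun x₀ w => k * x₀ ^ n 0 * w ^ n 3, 0, 0,
        fun x₀ x₁ x₂ w => by simp [h]; ring⟩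
    · exact ⟨0, 0, 0, 0, fun x₀ w => k * x₀ ^ n 0 * w ^ n 3, 0,
        fun x₀ x₁ x₂ w => by simp [h]; ring⟩
    · exact ⟨0, 0, 0, 0, 0, fun x₀ w => k * x₀ ^ n 0 * w ^ n 3,
        fun x₀ x₁ x₂ w => by simp [h]; ring⟩

lemma coeff_eq_zero_of_quartic {c₀ c₁ c₂ c₃ c₄ : ℂ}
    (h : ∀ x : ℂ, x ≠ 0 → c₄ * x ^ 4 + c₃ * x ^ 3 + c₂ * x ^ 2 + c₁ * x + c₀ = 0) :
    c₂ = 0 ∧ c₃ = 0 ∧ c₄ = 0 := by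
  have h1 := h 1 (by norm_num)
  have h2 := h (-1) (by norm_num)
  have h3 := h 2 (by norm_num)
  have h4 := h (-2) (by norm_num)
  have h5 := h 3 (by norm_num)
  have h6 := h (-3) (by norm_num)
  have e4 : c₄ = 0 := by
    linear_combination (1/80) * h5 + (1/80) * h6 - (1/30) * h3 - (1/30) * h4 + (1/48) * h1
      + (1/48) * h2
  have e2 : c₂ = 0 := by
    linear_combination (1/6) * (h3 + h4 - h1 - h2) - 5 * e4
  refine ⟨e2, ?_, e4⟩
  linear_combination (1/12) * (h3 - h4 - 2 * h1 + 2 * h2)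

/-- A quadratic polynomial in `a`, `b` that vanishes on the hyperbola `a * b = N` is a multiple of
`a * b - N`. -/
lemma quadratic_eq_of_vanishing {N f₂₀ f₁₁ f₀₂ f₁₀ f₀₁ f₀₀ : ℂ}
    (h : ∀ a b : ℂ, (a ≠ 0 ∨ b ≠ 0) → a * b = N →
      f₂₀ * a ^ 2 + f₁₁ * (a * b) + f₀₂ * b ^ 2 + f₁₀ * a + f₀₁ * b + f₀₀ = 0) :
    f₂₀ = 0 ∧ ∀ a b : ℂ, f₂₀ * a ^ 2 + f₁₁ * (a * b) + f₀₂ * b ^ 2 + f₁₀ * a + f₀₁ * b + f₀₀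
      = f₁₁ * (a * b - N) := by
  have h1 := coeff_eq_zero_of_quartic (c₄ := f₂₀) (c₃ := f₁₀) (c₂ := f₁₁ * N + f₀₀)
    (c₁ := f₀₁ * N) (c₀ := f₀₂ * N ^ 2) fun x hx => by
      have hb : x * (N / x) = N := by field_simp
      have := h x (N / x) (.inl hx) hb
      linear_combination x ^ 2 * this + (- f₁₁ * x ^ 2 - f₀₁ * x - f₀₂ * (N + x * (N / x))) * hb
  have h2 := coeff_eq_zero_of_quartic (c₄ := f₀₂) (c₃ := f₀₁) (c₂ := f₁₁ * N + f₀₀)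
    (c₁ := f₁₀ * N) (c₀ := f₂₀ * N ^ 2) fun x hx => by
      have hb : N / x * x = N := by field_simp
      have := h (N / x) x (.inr hx) hb
      linear_combination x ^ 2 * this + (- f₁₁ * x ^ 2 - f₁₀ * x - f₂₀ * (N + N / x * x)) * hb
  refine ⟨h1.2.2, fun a b => ?_⟩
  linear_combination a ^ 2 * h1.2.2 + b ^ 2 * h2.2.2 + a * h1.2.1 + b * h2.2.1 + h1.1

/-- Every point of the hyperbola `a * b = ∏ r_i` other than the origin comes from weights that do
not vanish in one of the two directions. -/
lemma exists_weights {D : ℕ} [Fintype (ZMod D)] (r : ZMod D → ℂ) {a b : ℂ} (ha : a ≠ 0)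
    (hab : a * b = ∏ i, r i) : ∃ s t : ZMod D → ℂ, (∀ i, s i ≠ 0) ∧ (∀ i, s i * t i = r i) ∧
      ∏ i, s i = a ∧ ∏ i, t i = b := by
  classical
  have hs : ∀ i, Function.update (1 : ZMod D → ℂ) 0 a i ≠ 0 := fun i => by
    rw [Function.update_apply]
    split_ifs
    exacts [ha, one_ne_zero]
  have hp : ∏ i, Function.update (1 : ZMod D → ℂ) 0 a i = a := by
    rw [Finset.prod_update_of_mem (Finset.mem_univ _)]
    simp
  refine ⟨Function.update 1 0 a, fun i => r i / Function.update (1 : ZMod D → ℂ) 0 a i, hs,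
    fun i => mul_div_cancel₀ _ (hs i), hp, ?_⟩
  rw [Finset.prod_div_distrib, hp, ← hab, mul_div_cancel_left₀ _ ha]

lemma eval_shadowCoords_eq_zero_of_mul_eq {q : ℂ} (hq : q ≠ 0) (hD : 2 < piDegree q)
    [Fintype (ZMod (piDegree q))] {σ w a b : ℂ} (hσ : σ ≠ 0) (hgen : (σ ^ piDegree q) ^ 2 ≠ 1)
    (hne : a ≠ 0 ∨ b ≠ 0) (hab : a * b = ∏ i, rCoeff q σ w i)
    {F : MvPolynomial (Fin 4) ℂ} (hF : centralMap hq F = 0) :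
    eval (shadowCoords q σ w a b) F = 0 := by
  rcases hne with ha | hb
  · obtain ⟨s, t, hs, hst, rfl, rfl⟩ := exists_weights (rCoeff q σ w) ha hab
    exact eval_shadowCoords_eq_zero hq hD hσ hgen hst (.inl hs) hF
  · rw [mul_comm] at hab
    obtain ⟨t, s, ht, hts, rfl, rfl⟩ := exists_weights (rCoeff q σ w) hb hab
    exact eval_shadowCoords_eq_zero hq hD hσ hgen (fun i => (mul_comm _ _).trans (hts i)) (.inr ht)
      hF

/-- In terms of the parameters of a representation, the equation of the center reads
`a * b = ∏ r_i`. -/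
lemma exists_eval_shadowCoords_eq {q : ℂ} (hq : q ≠ 0) (hD : 2 < piDegree q)
    [Fintype (ZMod (piDegree q))] {κ : ℂ} (hκ : κ ≠ 0) {g F : MvPolynomial (Fin 4) ℂ}
    (hg : ∀ n ∈ g.support, n 0 + n 1 + n 2 ≤ 2)
    (hFg : F = X 3 ^ piDegree q - C κ * (X 0 * X 1 * X 2) - g) (hF : centralMap hq F = 0) :
    ∃ η : ℂ, η ≠ 0 ∧ ∀ σ : ℂ, σ ≠ 0 → (σ ^ piDegree q) ^ 2 ≠ 1 → ∀ w a b,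
      eval (shadowCoords q σ w a b) F
        = η * (σ ^ piDegree q - (σ ^ piDegree q)⁻¹) ^ 2 * (a * b - ∏ i, rCoeff q σ w i) := by
  obtain ⟨ε, hε, hμ⟩ := exists_slopeRatio_eq q (by omega)
  have hε0 : ε ≠ 0 := by rintro rfl; norm_num at hε
  have hεi : ε⁻¹ = ε := by field_simp; exact hε.symm
  obtain ⟨A, B, Γ, l₁, l₂, l₀, hgev⟩ := exists_eval_eq_of_deg_le_two hg
  have key : ∀ σ w, σ ≠ 0 → (σ ^ piDegree q) ^ 2 ≠ 1 →
      -A w * slopeRatio q σ ^ 2 - (κ * (σ ^ piDegree q + (σ ^ piDegree q)⁻¹) + B w) * slopeRatio q σ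
        - Γ w = 0 ∧ ∀ a b, eval (shadowCoords q σ w a b) F
      = (-2 * A w - (κ * (σ ^ piDegree q + (σ ^ piDegree q)⁻¹) + B w)
          * (slopeRatio q σ + (slopeRatio q σ)⁻¹) - 2 * Γ w) * (a * b - ∏ i, rCoeff q σ w i) := by
    intro σ w hσ hgen
    set x := σ ^ piDegree q + (σ ^ piDegree q)⁻¹ with hx
    set μ := slopeRatio q σ with hμ'
    have hμ0 : μ ≠ 0 := slopeRatio_ne_zero hq hσ
    set p := pathCheb (rCoeff q σ w) (piDegree q) 0 with hp
    have hexp : ∀ a b, eval (shadowCoords q σ w a b) F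
        = (-A w * μ ^ 2 - (κ * x + B w) * μ - Γ w) * a ^ 2
          + (-2 * A w - (κ * x + B w) * (μ + μ⁻¹) - 2 * Γ w) * (a * b)
          + (-A w * (μ⁻¹) ^ 2 - (κ * x + B w) * μ⁻¹ - Γ w) * b ^ 2
          + (-2 * A w * μ * p - (κ * x + B w) * (μ * p + p) - 2 * Γ w * p - l₁ x w * μ - l₂ x w) * a
          + (-2 * A w * μ⁻¹ * p - (κ * x + B w) * (μ⁻¹ * p + p) - 2 * Γ w * p - l₁ x w * μ⁻¹
            - l₂ x w) * b
          + (w ^ piDegree q - (A w + κ * x + B w + Γ w) * p ^ 2 - (l₁ x w + l₂ x w) * p - l₀ x w) := by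
      intro a b
      rw [hFg, map_sub, shadowCoords, hgev, ← hx, ← hμ', ← hp]
      simp only [map_sub, map_mul, map_pow, eval_X, eval_C]
      change w ^ piDegree q - κ * (x * (μ * a + μ⁻¹ * b + p) * (a + b + p)) - _ = _
      field_simp
      ring
    have := quadratic_eq_of_vanishing fun a b hne hab =>
      (hexp a b).symm.trans (eval_shadowCoords_eq_zero_of_mul_eq hq hD hσ hgen hne hab hF)
    exact ⟨this.1, fun a b => (hexp a b).trans (this.2 a b)⟩
  -- The coefficient of `a ^ 2` vanishes identically in `ξ = σ ^ D`.
  have hξ : ∀ w ξ : ℂ, ξ ≠ 0 → ξ ^ 2 ≠ 1 → (A w + κ * ε) * ξ ^ 2 + B w * ε * ξ + (Γ w + κ * ε) = 0 := by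
    intro w ξ hξ0 hξ1
    obtain ⟨σ, rfl⟩ := IsAlgClosed.exists_pow_nat_eq ξ (show 0 < piDegree q by omega)
    have hσ : σ ≠ 0 := by rintro rfl; exact hξ0 (zero_pow (by omega))
    have := (key σ w hσ hξ1).1
    rw [hμ] at this
    field_simp at this
    linear_combination -this - A w * (σ ^ piDegree q) ^ 2 * hε
  have hcoef : ∀ w, A w = -(κ * ε) ∧ B w = 0 ∧ Γ w = -(κ * ε) := by
    intro w
    have h1 := hξ w 2 (by norm_num) (by norm_num)
    have h2 := hξ w (-2) (by norm_num) (by norm_num)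
    have h3 := hξ w 3 (by norm_num) (by norm_num)
    have hB : B w * ε = 0 := by linear_combination (1 / 4) * h1 - (1 / 4) * h2
    have hA : A w + κ * ε = 0 := by linear_combination (1 / 5) * h3 - (1 / 5) * h1 - (1 / 5) * hB
    refine ⟨by linear_combination hA, (mul_eq_zero.1 hB).resolve_right hε0, ?_⟩
    linear_combination h1 - 4 * hA - 2 * hB
  refine ⟨-(κ * ε), neg_ne_zero.2 (mul_ne_zero hκ hε0), fun σ hσ hgen w a b => ?_⟩
  obtain ⟨hA, hB, hΓ⟩ := hcoef w
  have hξ0 : σ ^ piDegree q ≠ 0 := pow_ne_zero _ hσ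
  rw [(key σ w hσ hgen).2, hA, hB, hΓ, hμ, mul_inv, hεi]
  congr 1
  field_simp
  ring

end

/-! ### Partial derivatives of the equation of the center -/

section

open MvPolynomial Topology

/-- The chain rule for a polynomial along a curve. -/
lemma hasDerivAt_eval {ι : Type*} [Fintype ι] (F : MvPolynomial ι ℂ) {γ : ℂ → ι → ℂ} {γ' : ι → ℂ}
    {t : ℂ} (h : ∀ i, HasDerivAt (fun u => γ u i) (γ' i) t) :
    HasDerivAt (fun u => eval (γ u) F) (∑ i, eval (γ t) (pderiv i F) * γ' i) t := by
  classical
  induction F using MvPolynomial.induction_on with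
  | C c => simpa using hasDerivAt_const t c
  | add f g hf hg =>
    simp only [map_add, add_mul, Finset.sum_add_distrib]
    exact hf.add hg
  | mul_X f i hf =>
    simp only [map_mul, eval_X, Derivation.leibniz, pderiv_X, smul_eq_mul, map_add]
    convert! hf.mul (h i) using 1
    simp only [add_mul, Finset.sum_add_distrib, Pi.single_apply, Finset.sum_mul]
    rw [add_comm]
    congr 1
    · exact Finset.sum_congr rfl fun j _ => by ring
    · rw [Finset.sum_eq_single i]
      · simp
      · intro j _ hj
        simp [hj.symm]
      · simp

lemma differentiableAt_pathCheb {D : ℕ} {r : ℂ → ZMod D → ℂ} {t : ℂ}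
    (h : ∀ i, DifferentiableAt ℂ (fun u => r u i) t) (k : ℕ) (m : ℤ) :
    DifferentiableAt ℂ (fun u => pathCheb (r u) k m) t := by
  have hup : ∀ m, DifferentiableAt ℂ (fun u => stepUp (r u) m) t := fun m => by
    unfold stepUp
    split_ifs
    exacts [differentiableAt_const _, h _]
  have hdown : ∀ m, DifferentiableAt ℂ (fun u => stepDown (r u) m) t := fun m => by
    unfold stepDown
    split_ifs
    exacts [differentiableAt_const _, h _]
  induction k using Nat.twoStepInduction generalizing m with
  | zero => exact differentiableAt_const _
  | one => simp only [pathCheb_one_apply]; exact differentiableAt_const _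
  | more k ih0 ih1 =>
    simp only [pathCheb, Finsupp.sub_apply, pathOp_apply]
    exact (((hup _).mul (ih1 _)).add ((hdown _).mul (ih1 _))).sub (ih0 m)

variable {q : ℂ}

lemma hasDerivAt_rCoeff_boundary (σ w : ℂ) (i : ZMod (piDegree q)) :
    HasDerivAt (fun u => rCoeff q σ u i) (1 / (lamHat q σ i * lamHat q σ (i + 1))) w := by
  unfold rCoeff
  exact (((hasDerivAt_id w).add_const _).add_const _).div_const _

lemma differentiableAt_rCoeff {σ : ℂ} (hσ : σ ≠ 0) (hat : ∀ i, lamHat q σ i ≠ 0) (w : ℂ)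
    (i : ZMod (piDegree q)) : DifferentiableAt ℂ (fun u => rCoeff q u w i) σ := by
  have hl : ∀ i, DifferentiableAt ℂ (fun u => lamHat q u i) σ := fun i => by
    unfold lamHat
    fun_prop (disch := assumption)
  unfold rCoeff
  exact DifferentiableAt.div (by fun_prop (disch := assumption)) ((hl i).mul (hl (i + 1)))
    (mul_ne_zero (hat i) (hat (i + 1)))

/-- If two factors of a product vanish, so does its derivative. -/
lemma hasDerivAt_prod_of_two_zeros {ι : Type*} [Fintype ι] {r : ℂ → ι → ℂ} {t : ℂ}
    (h : ∀ i, DifferentiableAt ℂ (fun u => r u i) t) {i j : ι} (hij : i ≠ j) (hi : r t i = 0)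
    (hj : r t j = 0) : HasDerivAt (fun u => ∏ i, r u i) 0 t := by
  classical
  have := HasDerivAt.fun_finsetProd (u := Finset.univ) (fun i _ => (h i).hasDerivAt)
  convert! this using 1
  symm
  refine Finset.sum_eq_zero fun k _ => ?_
  by_cases hk : k = i
  · rw [Finset.prod_eq_zero (Finset.mem_erase.2 ⟨fun h' => hij (hk.symm.trans h'.symm),
      Finset.mem_univ j⟩) hj, zero_smul]
  · rw [Finset.prod_eq_zero (Finset.mem_erase.2 ⟨Ne.symm hk, Finset.mem_univ i⟩) hi, zero_smul]

end

section

open MvPolynomial Topology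

variable {q : ℂ}

/-- The partial derivatives of the equation of the center all vanish at a generic point of the
hypersurface exactly when both products of weights and at least two of the `r_i` vanish. -/
lemma forall_pderiv_eq_zero_iff (hq : q ≠ 0) (hD : 2 < piDegree q) [Fintype (ZMod (piDegree q))]
    {F : MvPolynomial (Fin 4) ℂ} {η : ℂ} (hη : η ≠ 0)
    (hF : ∀ σ : ℂ, σ ≠ 0 → (σ ^ piDegree q) ^ 2 ≠ 1 → ∀ w a b, eval (shadowCoords q σ w a b) F
      = η * (σ ^ piDegree q - (σ ^ piDegree q)⁻¹) ^ 2 * (a * b - ∏ i, rCoeff q σ w i))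
    {σ w a b : ℂ} (hσ : σ ≠ 0) (hgen : (σ ^ piDegree q) ^ 2 ≠ 1)
    (hab : a * b = ∏ i, rCoeff q σ w i) :
    (∀ i, eval (shadowCoords q σ w a b) (pderiv i F) = 0) ↔
      a = 0 ∧ b = 0 ∧ ∃ i j, i ≠ j ∧ rCoeff q σ w i = 0 ∧ rCoeff q σ w j = 0 := by
  obtain ⟨ε, hε, hμ⟩ := exists_slopeRatio_eq q (by omega)
  have hat := lamHat_ne_zero_of_generic hq hσ hgen
  have hξ0 : σ ^ piDegree q ≠ 0 := pow_ne_zero _ hσ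
  have hμ0 : slopeRatio q σ ≠ 0 := slopeRatio_ne_zero hq hσ
  have hμ1 : slopeRatio q σ - (slopeRatio q σ)⁻¹ ≠ 0 := by
    intro h
    field_simp at h
    apply hgen
    rw [hμ, mul_pow, hε] at h
    linear_combination h
  set h := η * (σ ^ piDegree q - (σ ^ piDegree q)⁻¹) ^ 2 with hh
  have hh0 : h ≠ 0 := by
    refine mul_ne_zero hη (pow_ne_zero 2 fun h0 => hgen ?_)
    field_simp at h0
    linear_combination h0
  -- The four directional derivatives along `a`, `b`, `w` and `σ`.
  have da : eval (shadowCoords q σ w a b) (pderiv 1 F) * slopeRatio q σ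
      + eval (shadowCoords q σ w a b) (pderiv 2 F) = h * b := by
    have h1 := hasDerivAt_eval F (γ := fun u => shadowCoords q σ w u b) (t := a)
      (γ' := ![0, slopeRatio q σ * 1, 1, 0]) fun i => by
        fin_cases i
        · exact hasDerivAt_const _ _
        · exact (((hasDerivAt_id a).const_mul (slopeRatio q σ)).add_const _).add_const _
        · exact ((hasDerivAt_id a).add_const _).add_const _
        · exact hasDerivAt_const _ _
    simp only [hF σ hσ hgen, ← hh] at h1
    have h2 := (((hasDerivAt_id a).mul_const b).sub_const (∏ i, rCoeff q σ w i)).const_mul h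
    have := h1.unique h2
    simpa [Fin.sum_univ_four] using this
  have db : eval (shadowCoords q σ w a b) (pderiv 1 F) * (slopeRatio q σ)⁻¹
      + eval (shadowCoords q σ w a b) (pderiv 2 F) = h * a := by
    have h1 := hasDerivAt_eval F (γ := fun u => shadowCoords q σ w a u) (t := b)
      (γ' := ![0, (slopeRatio q σ)⁻¹ * 1, 1, 0]) fun i => by
        fin_cases i
        · exact hasDerivAt_const _ _
        · exact (((hasDerivAt_id b).const_mul (slopeRatio q σ)⁻¹).const_add
            (slopeRatio q σ * a)).add_const _
        · exact ((hasDerivAt_id b).const_add _).add_const _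
        · exact hasDerivAt_const _ _
    simp only [hF σ hσ hgen, ← hh] at h1
    have h2 := (((hasDerivAt_id b).const_mul a).sub_const (∏ i, rCoeff q σ w i)).const_mul h
    have := h1.unique h2
    simpa [Fin.sum_univ_four] using this
  have dw : ∃ p : ℂ, ∀ N', HasDerivAt (fun u => ∏ i, rCoeff q σ u i) N' w →
      (eval (shadowCoords q σ w a b) (pderiv 1 F) + eval (shadowCoords q σ w a b) (pderiv 2 F)) * p
        + eval (shadowCoords q σ w a b) (pderiv 3 F) = -(h * N') := by
    have hp := (differentiableAt_pathCheb (fun i => (hasDerivAt_rCoeff_boundary (q := q) σ w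
      i).differentiableAt) (piDegree q) 0).hasDerivAt
    refine ⟨deriv (fun u => pathCheb (rCoeff q σ u) (piDegree q) 0) w, fun N' hN' => ?_⟩
    have h1 := hasDerivAt_eval F (γ := fun u => shadowCoords q σ u a b) (t := w)
      (γ' := ![0, _, _, 1]) fun i => by
        fin_cases i
        · exact hasDerivAt_const _ _
        · exact hp.const_add _
        · exact hp.const_add _
        · exact hasDerivAt_id _
    simp only [hF σ hσ hgen, ← hh] at h1
    have := h1.unique ((hN'.const_sub (a * b)).const_mul h)
    simp [Fin.sum_univ_four] at this
    rw [← this]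
    ring
  have dσ : HasDerivAt (fun u => ∏ i, rCoeff q u w i) 0 σ → a = 0 → b = 0 →
      eval (shadowCoords q σ w a b) (pderiv 1 F) = 0 →
      eval (shadowCoords q σ w a b) (pderiv 2 F) = 0 →
      eval (shadowCoords q σ w a b) (pderiv 0 F) = 0 := by
    intro hN ha hb h1 h2
    have hp := (differentiableAt_pathCheb (fun i => differentiableAt_rCoeff hσ hat w i)
      (piDegree q) 0).hasDerivAt
    have hpow := hasDerivAt_pow (piDegree q) σ
    have hx := hpow.add (hpow.fun_inv hξ0)
    have hs : HasDerivAt (fun u => slopeRatio q u) (ε * (piDegree q * σ ^ (piDegree q - 1))) σ := by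
      simp only [hμ]
      exact hpow.const_mul ε
    have hc := hasDerivAt_eval F (γ := fun u => shadowCoords q u w a b) (t := σ)
      (γ' := ![_, _, _, 0]) fun i => by
        fin_cases i
        · exact hx
        · exact ((hs.mul_const a).add ((hs.fun_inv hμ0).mul_const b)).add hp
        · exact hp.const_add _
        · exact hasDerivAt_const _ _
    have hev : ∀ᶠ u in 𝓝 σ, u ≠ 0 ∧ (u ^ piDegree q) ^ 2 ≠ 1 := by
      refine (continuousAt_id.eventually_ne hσ).and ?_
      exact ContinuousAt.eventually_ne (by fun_prop) hgen
    have hr : HasDerivAt (fun u => η * (u ^ piDegree q - (u ^ piDegree q)⁻¹) ^ 2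
        * (a * b - ∏ i, rCoeff q u w i)) 0 σ := by
      have hl := (((hpow.sub (hpow.fun_inv hξ0)).pow 2).const_mul η).mul (hN.const_sub (a * b))
      convert! hl using 1
      simp [hab]
    have := hc.unique (hr.congr_of_eventuallyEq (hev.mono fun u hu => hF u hu.1 hu.2 w a b))
    rw [Fin.sum_univ_four, h1, h2] at this
    simp only [Matrix.cons_val_zero, zero_mul, add_zero, Matrix.cons_val, mul_zero] at this
    refine (mul_eq_zero.1 this).resolve_right ?_
    rw [neg_div, ← sub_eq_add_neg, sub_eq_zero]
    intro h0
    have hc0 : (piDegree q : ℂ) * σ ^ (piDegree q - 1) ≠ 0 :=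
      mul_ne_zero (Nat.cast_ne_zero.2 (by omega)) (pow_ne_zero _ hσ)
    rw [eq_div_iff (pow_ne_zero 2 hξ0)] at h0
    exact hgen (mul_left_cancel₀ hc0 (h0.trans (mul_one _).symm))
  obtain ⟨p, dw⟩ := dw
  constructor
  · intro hall
    rw [hall, hall] at da db dw
    rw [zero_mul, zero_add, eq_comm, mul_eq_zero] at da db
    have hb := da.resolve_left hh0
    have ha := db.resolve_left hh0
    refine ⟨ha, hb, ?_⟩
    rw [ha, zero_mul, eq_comm, Finset.prod_eq_zero_iff] at hab
    obtain ⟨i, -, hi⟩ := hab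
    classical
    have hN := HasDerivAt.fun_finsetProd (u := Finset.univ)
      (fun i _ => hasDerivAt_rCoeff_boundary (q := q) σ w i)
    have := dw _ hN
    rw [hall, Finset.sum_eq_single i] at this
    · have h0 : ∏ j ∈ Finset.univ.erase i, rCoeff q σ w j = 0 := by
        simpa [hh0, hat] using this
      obtain ⟨j, hj, hj0⟩ := Finset.prod_eq_zero_iff.1 h0
      exact ⟨i, j, (Finset.mem_erase.1 hj).1.symm, hi, hj0⟩
    · intro k _ hk
      rw [Finset.prod_eq_zero (Finset.mem_erase.2 ⟨hk.symm, Finset.mem_univ i⟩) hi, zero_smul]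
    · simp
  · rintro ⟨ha, hb, i, j, hij, hi, hj⟩
    have h1 : eval (shadowCoords q σ w a b) (pderiv 1 F) = 0 := by
      refine (mul_eq_zero.1 ?_).resolve_right hμ1
      linear_combination da - db + h * hb - h * ha
    have h2 : eval (shadowCoords q σ w a b) (pderiv 2 F) = 0 := by
      linear_combination da + h * hb - slopeRatio q σ * h1
    have h3 : eval (shadowCoords q σ w a b) (pderiv 3 F) = 0 := by
      have := dw 0 (hasDerivAt_prod_of_two_zeros
        (fun i => (hasDerivAt_rCoeff_boundary (q := q) σ w i).differentiableAt) hij hi hj)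
      linear_combination this - p * h1 - p * h2
    have h0 := dσ (hasDerivAt_prod_of_two_zeros
      (fun i => differentiableAt_rCoeff hσ hat w i) hij hi hj) ha hb h1 h2
    intro k
    fin_cases k
    exacts [h0, h1, h2, h3]

end

end PuncturedTorus

end

/-! ### Reducible representations and singular points -/

open PuncturedTorus in
theorem lemma4p10 (q : ℂ) (hq : ∃ k : ℕ, 0 < k ∧ q ^ k = 1) (hq4 : q ^ 4 ≠ 1)
    {V : Type*} [AddCommGroup V] [Module ℂ V]
    (ρ : SkeinAlgebra q →ₐ[ℂ] Module.End ℂ V) (hρ : IsTypeZero ρ)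
    (z : Center q →ₐ[ℂ] ℂ) (hz : IsClassicalShadow ρ z)
    (hz₀ : z (centralA q .zero) ≠ 2 ∧ z (centralA q .zero) ≠ -2) :
    IsReducible ρ ↔ IsSingularPoint (shadowPoint z) := by
  obtain ⟨k, hk, hqk⟩ := hq
  have hq0 : q ≠ 0 := by rintro rfl; rw [zero_pow hk.ne'] at hqk; exact zero_ne_one hqk
  have hD0 : 0 < piDegree q := orderOf_pos_iff.2 (isOfFinOrder_iff_pow_eq_one.2
    ⟨k, hk, by rw [← pow_mul, mul_comm, pow_mul, hqk, one_pow]⟩)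
  -- This is where `q ^ 4 ≠ 1` enters: the two neighbours of a vertex of the cycle are distinct.
  have hD : 2 < piDegree q := by
    by_contra! hle
    apply hq4
    have hdvd : piDegree q ∣ 2 := by interval_cases piDegree q <;> norm_num
    have := orderOf_dvd_iff_pow_eq_one.1 hdvd
    rw [← this]; ring
  have : NeZero (piDegree q) := ⟨hD0.ne'⟩
  obtain ⟨v, σ, w, s, t, h⟩ := (isTypeZero_iff hq0 ρ).1 hρ
  have hcoords := shadow_eq_shadowCoords hq0 hD0 h (χ := z) fun x => by rw [hz x]; rfl
  have hgen : (σ ^ piDegree q) ^ 2 ≠ 1 := by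
    have h0 : z (centralA q .zero) = σ ^ piDegree q + (σ ^ piDegree q)⁻¹ := by
      have := congrFun hcoords 0
      rwa [centralMap, MvPolynomial.aeval_X] at this
    rw [h0] at hz₀
    intro h1
    rcases sq_eq_sq_iff_eq_or_eq_neg.1 (h1.trans (one_pow 2).symm) with h1 | h1 <;> rw [h1] at hz₀ <;> norm_num at hz₀
  obtain ⟨κ, g, hκ, hg, hker⟩ := exists_center_equation hq0 hD0
  set F := MvPolynomial.X 3 ^ piDegree q
    - MvPolynomial.C κ * (MvPolynomial.X 0 * MvPolynomial.X 1 * MvPolynomial.X 2) - g with hFdef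
  have hF0 : centralMap hq0 F = 0 := by
    rw [← RingHom.mem_ker]
    exact hker ▸ Ideal.mem_span_singleton_self F
  have hgdeg : ∀ n ∈ g.support, n 0 + n 1 + n 2 ≤ 2 := fun n hn => by
    have h1 := (hg n hn).2
    rw [centralWeight] at h1
    have h2 : piDegree q * (n 0 + n 1 + n 2) < piDegree q * 3 := by omega
    have := lt_of_mul_lt_mul_left h2 (Nat.zero_le _)
    omega
  obtain ⟨η, hη, hFη⟩ := exists_eval_shadowCoords_eq hq0 hD hκ hgdeg hFdef hF0
  have hab : (∏ i, s i) * ∏ i, t i = ∏ i, rCoeff q σ w i := by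
    rw [← Finset.prod_mul_distrib]
    exact Finset.prod_congr rfl fun i _ => h.mul_eq i
  have hFne : F ≠ 0 := by
    intro hF
    have h1 := hFη σ h.ne_zero hgen w 1 (∏ i, rCoeff q σ w i + 1)
    have hξ0 : σ ^ piDegree q ≠ 0 := pow_ne_zero _ h.ne_zero
    rw [hF, map_zero, one_mul, add_sub_cancel_left, mul_one, eq_comm, mul_eq_zero] at h1
    have h2 := pow_eq_zero_iff two_ne_zero |>.1 (h1.resolve_left hη)
    apply hgen
    field_simp at h2
    linear_combination h2
  rw [isReducible_iff hq0 hD h hgen, ← forall_pderiv_eq_zero_iff hq0 hD hη hFη h.ne_zero hgen hab,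
    ← hcoords]
  have : (RingHom.ker z).IsPrime := (shadowPoint z).isMaximal.isPrime
  have key := isRegularLocalRing_hypersurface_iff (centralMap_surjective hq0 hD0) hFne hker z
  rw [← not_iff_not, not_forall, ← key]
  exact not_not.symm
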